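/- Let $m\ge 1$ and $n=2m$ or $n=2m+1$, let $I\subseteq\mathbb R$ and $J\subseteq(0,\infty)$ be non-empty open intervals, and let $F(p,\rho)$ be any smooth state function on $I\times J$. Consider the equations of adiabatic gas dynamics in $\mathbb R^n$, $$\rho_t+\nabla\cdot(\rho\mathbf u)=0,\qquad \mathbf u_t+\mathbf u\cdot\nabla\mathbf u+\rho^{-1}\nabla p=0,\qquad p_t+\mathbf u\cdot\nabla p+F(p,\rho)\,\nabla\cdot\mathbf u=0,$$ with $p\in I$, $\rho\in J$. A density $T$, formed from $\rho,p,\mathbf u$ and their spatial derivatives, is \emph{conserved} if there is a flux $\mathbf X$, a smooth function of $t,\mathbf x,\rho,p,\mathbf u$ and finitely many spatial derivatives of $\rho,p,\mathbf u$, such that $D_tT+D_{\mathbf x}\cdot\mathbf X=0$ holds formally for all solutions, i.e. identically for all smooth fields after the time derivatives of $\rho,p,\mathbf u$ have been eliminated by the equations. It is \emph{trivial} if $T=D_{\mathbf x}\cdot\boldsymbol\Theta$ identically for some such vector function $\boldsymbol\Theta$; it is \emph{kinematic} if $T=c(\rho,p,\mathbf u)$ with $c$ smooth. Put $\omega_{ij}=\tfrac12(\partial_ju_i-\partial_iu_j)$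 and $$\varpi=\epsilon^{i_1j_1\cdots i_mj_m}\omega_{i_1j_1}\cdots\omega_{i_mj_m},\qquad w_{ij}=\epsilon_{ij}{}^{i_1j_1\cdots i_{m-1}j_{m-1}}\omega_{i_1j_1}\cdots\omega_{i_{m-1}j_{m-1}}\qquad(n=2m),$$ $$\varpi^i=\epsilon^{ij_1k_1\cdots j_mk_m}\omega_{j_1k_1}\cdots\omega_{j_mk_m}\qquad(n=2m+1).$$ An \emph{entropy function} is a smooth solution $S(p,\rho)$ on $I\times J$ of $\rho S_\rho+FS_p=0$, and an \emph{energy function} is a smooth solution $e(p,\rho)$ on $I\times J$ of $\rho e_\rho+Fe_p=p/\rho$. (i) Let $n=2m$. A smooth density $T(\rho,p,\mathbf u,\varpi)$ is conserved if and only if $$T=S(p,\rho)\,\varpi+c(\rho,p,\mathbf u)$$ for some entropy function $S$ and some smooth conserved kinematic density $c$. For every entropy function $S$: the density $S\varpi$ is trivial if and only if $S$ is constant; $S\varpi+\mathbf w\cdot(\mathbf u\wedge\nabla S)$ is trivial, where $\mathbf w\cdot(\mathbf u\wedge\nabla S)=w_{ij}u_i\partial_jS$ is the circulatory entropy density; $\nabla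 S=S_p(\nabla p-\rho^{-1}F\nabla\rho)$; and for every energy function $e$, writing $e_S\nabla S$ for $e_p(\nabla p-\rho^{-1}F\nabla\rho)$, which equals $(e_p/S_p)\nabla S$ wherever $S_p\ne0$, the conservation laws $$D_t(S\varpi)+D_i\big(S\varpi\,u_i+m\,S\,w_{ij}\,e_S\,\partial_jS\big)=0,$$ $$D_tC+D_i\big(C\,u_i+(e+p/\rho-\tfrac12|\mathbf u|^2)\,w_{ij}\,\partial_jS\big)=0,\qquad C=w_{ij}u_i\partial_jS,$$ hold formally for all solutions. (ii) Let $n=2m+1$. A smooth density $T(\rho,p,\mathbf u,\boldsymbol\varpi)$ is conserved if and only if $$T=\mathbf b\cdot\boldsymbol\varpi+c(\rho,p,\mathbf u)$$ for some constant vector $\mathbf b\in\mathbb R^n$ and some smooth conserved kinematic density $c$; and every density $\mathbf b\cdot\boldsymbol\varpi$ is trivial. In particular, in every dimension $n>1$, no state function $F$ admits, up to kinematic and trivial densities, any conserved density of vorticity form other than the circulatory entropies in even dimensions. -/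

import Mathlib

open scoped ContDiff

noncomputable section

namespace GasDynamics

/-- Euclidean space `ℝⁿ`. -/
abbrev Space (n : ℕ) : Type := EuclideanSpace ℝ (Fin n)

/-- The values `(ρ, p, u)` of density, pressure and velocity at a point. -/
abbrev State (n : ℕ) : Type := ℝ × ℝ × Space n

/-- The gas variables as functions of the position, at a fixed time. -/
abbrev Field (n : ℕ) : Type := Space n → State n

variable {n : ℕ}

/-- The partial derivative `∂f/∂xⁱ`. -/
def pd (i : Fin n) (f : Space n → ℝ) (x : Space n) : ℝ :=
  fderiv ℝ f x (EuclideanSpace.single i 1)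

/-- The divergence of a vector field on `ℝⁿ`. -/
def divergence (X : Space n → Space n) (x : Space n) : ℝ :=
  ∑ i, pd i (fun y => X y i) x

/-- The density `ρ` of a gas field. -/
def dens (v : Field n) (x : Space n) : ℝ := (v x).1

/-- The pressure `p` of a gas field. -/
def pres (v : Field n) (x : Space n) : ℝ := (v x).2.1

/-- The velocity `u` of a gas field. -/
def vel (v : Field n) (x : Space n) : Space n := (v x).2.2

/-! ### State functions, entropy and internal energy

Functions of state are functions of the pair `(p, ρ)`; the pressure ranges over a set `I` and
the density over a set `J`. -/

/-- The partial derivative with respect to the pressure. -/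
def derivP (f : ℝ × ℝ → ℝ) (z : ℝ × ℝ) : ℝ := deriv (fun q => f (q, z.2)) z.1

/-- The partial derivative with respect to the density. -/
def derivRho (f : ℝ × ℝ → ℝ) (z : ℝ × ℝ) : ℝ := deriv (fun r => f (z.1, r)) z.2

/-- `S(p, ρ)` is a smooth solution of the entropy equation `ρ S_ρ + F S_p = 0`. -/
def IsEntropy (F : ℝ × ℝ → ℝ) (I J : Set ℝ) (S : ℝ × ℝ → ℝ) : Prop :=
  ContDiffOn ℝ ∞ S (I ×ˢ J) ∧
    ∀ z ∈ I ×ˢ J, z.2 * derivRho S z + F z * derivP S z = 0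

/-- `e(p, ρ)` is a smooth solution of the internal energy equation `ρ e_ρ + F e_p = p / ρ`. -/
def IsEnergy (F : ℝ × ℝ → ℝ) (I J : Set ℝ) (e : ℝ × ℝ → ℝ) : Prop :=
  ContDiffOn ℝ ∞ e (I ×ˢ J) ∧
    ∀ z ∈ I ×ˢ J, z.2 * derivRho e z + F z * derivP e z = z.1 / z.2

/-- The pair `(p, ρ)` of a gas field. -/
def thermo (v : Field n) (x : Space n) : ℝ × ℝ := (pres v x, dens v x)

/-- The states with pressure in `I` and density in `J`. -/
def stateDomain (n : ℕ) (I J : Set ℝ) : Set (State n) := {s | s.1 ∈ J ∧ s.2.1 ∈ I}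

/-- Smooth gas fields on `ℝⁿ` with pressure in `I` and density in `J`. -/
def Admissible (I J : Set ℝ) (v : Field n) : Prop :=
  ContDiff ℝ ∞ v ∧ ∀ x, v x ∈ stateDomain n I J

/-! ### The gas dynamics equations and their local conservation laws -/

/-- The time derivatives `(ρ_t, p_t, u_t)` prescribed by the gas dynamics equations
`ρ_t = -∇·(ρ u)`, `p_t = -u·∇p - F(p, ρ) ∇·u`, `u_t = -u·∇u - ρ⁻¹ ∇p`. -/
def evolution (F : ℝ × ℝ → ℝ) (v : Field n) : Field n := fun x =>
  (-divergence (fun y => dens v y • vel v y) x,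
   -(∑ j, vel v x j * pd j (pres v) x) - F (thermo v x) * divergence (vel v) x,
   WithLp.toLp 2 fun i =>
     -(∑ j, vel v x j * pd j (fun y => vel v y i) x) - (dens v x)⁻¹ * pd i (pres v) x)

/-- Scalar densities formed from the gas fields and their spatial derivatives. -/
abbrev Density (n : ℕ) : Type := Field n → Space n → ℝ

/-- The total time derivative of a density on formal solutions of the gas dynamics equations:
the time derivatives of the gas fields (and of their spatial derivatives) are replaced through
the equations, so that it is the linearization of the density in the direction `evolution F v`. -/
def timeDeriv (F : ℝ × ℝ → ℝ) (T : Density n) (v : Field n) (x : Space n) : ℝ :=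
  deriv (fun ε : ℝ => T (fun y => v y + ε • evolution F v y) x) 0

/-- The continuity equation `D_t T + D_x · X = 0` holds formally for all solutions. -/
def ContinuityEquation (F : ℝ × ℝ → ℝ) (I J : Set ℝ) (T : Density n)
    (X : Field n → Space n → Space n) : Prop :=
  ∀ v, Admissible I J v → ∀ x, timeDeriv F T v x + divergence (X v) x = 0

/-- Values of the gas variables and of their spatial derivatives of order at most `k`. -/
abbrev Jet (n k : ℕ) : Type :=
  (j : Fin (k + 1)) → ContinuousMultilinearMap ℝ (fun _ : Fin (j : ℕ) => Space n) (State n)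

/-- The spatial jet of order `k` of a gas field at a point. -/
def jet (k : ℕ) (v : Field n) (x : Space n) : Jet n k :=
  fun j => iteratedFDeriv ℝ (j : ℕ) v x

/-- The values of `(t, x, jet)` whose derivative-free part lies in the domain of states. -/
def jetDomain (n k : ℕ) (I J : Set ℝ) : Set (ℝ × Space n × Jet n k) :=
  {z | z.2.2 0 (fun _ => 0) ∈ stateDomain n I J}

/-- Vectors that are smooth functions of `t`, `x`, the gas variables and finitely many of their
spatial derivatives. -/
def IsLocalVector (I J : Set ℝ) (X : ℝ → Field n → Space n → Space n) : Prop :=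
  ∃ (k : ℕ) (Φ : ℝ × Space n × Jet n k → Space n),
    ContDiffOn ℝ ∞ Φ (jetDomain n k I J) ∧
      ∀ t v, Admissible I J v → ∀ x, X t v x = Φ (t, x, jet k v x)

/-- `T` is a conserved density: for some flux `X` depending on `t`, `x`, the gas variables and
finitely many of their spatial derivatives, the continuity equation holds formally. -/
def IsConserved (F : ℝ × ℝ → ℝ) (I J : Set ℝ) (T : Density n) : Prop :=
  ∃ X : ℝ → Field n → Space n → Space n,
    IsLocalVector I J X ∧ ∀ t, ContinuityEquation F I J T (X t)

/-- `T` is locally trivial: it is a spatial divergence `div Θ` of a local vector. -/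
def IsTrivial (I J : Set ℝ) (T : Density n) : Prop :=
  ∃ Θ : ℝ → Field n → Space n → Space n,
    IsLocalVector I J Θ ∧ ∀ t v, Admissible I J v → ∀ x, T v x = divergence (Θ t v) x

/-! ### Vorticity -/

/-- The curl of the velocity, `ω_ij = (∂_j u_i - ∂_i u_j) / 2`. -/
def curl (v : Field n) (x : Space n) (i j : Fin n) : ℝ :=
  (pd j (fun y => vel v y i) x - pd i (fun y => vel v y j) x) / 2

/-- The components of the Hodge dual `∗(ω^r)`, an antisymmetric tensor of rank `q = n - 2 r`:
`∗(ω^r)_{a₁ … a_q} = ε_{a₁ … a_q i₁ j₁ … i_r j_r} ω_{i₁ j₁} ⋯ ω_{i_r j_r}`, where the sum over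
the indices of the Levi-Civita symbol is written as a sum over permutations. -/
def starPow {q r : ℕ} (h : q + 2 * r = n) (om : Fin n → Fin n → ℝ) (a : Fin q → Fin n) : ℝ :=
  open Classical in
  ∑ σ : Equiv.Perm (Fin n),
    if ∀ l : Fin q, σ ⟨l, by omega⟩ = a l then
      ((Equiv.Perm.sign σ : ℤ) : ℝ) *
        ∏ k : Fin r, om (σ ⟨q + 2 * k, by omega⟩) (σ ⟨q + 2 * k + 1, by omega⟩)
    else 0

/-- The vorticity scalar `ϖ = ∗(ω^m)` in dimension `n = 2 m`. -/
def vortScalar {m : ℕ} (h : n = 2 * m) (v : Field n) (x : Space n) : ℝ :=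
  starPow (q := 0) (r := m) (by omega) (curl v x) ![]

/-- The antisymmetric tensor `w = ∗(ω^(m-1))` in dimension `n = 2 m ≥ 2`. -/
def vortTensor {m : ℕ} (hm : 1 ≤ m) (h : n = 2 * m) (v : Field n) (x : Space n)
    (i j : Fin n) : ℝ :=
  starPow (q := 2) (r := m - 1) (by omega) (curl v x) ![i, j]

/-- The vorticity vector `ϖ = ∗(ω^m)` in dimension `n = 2 m + 1`. -/
def vortVector {m : ℕ} (h : n = 2 * m + 1) (v : Field n) (x : Space n) : Space n :=
  WithLp.toLp 2 fun i => starPow (q := 1) (r := m) (by omega) (curl v x) ![i]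

/-! ### Densities -/

/-- The kinematic density `c(ρ, p, u)`. -/
def kinematicDensity (c : State n → ℝ) : Density n := fun v x => c (v x)

/-- The vorticity density `T(ρ, p, u, ϖ)` in dimension `n = 2 m`. -/
def evenDensity {m : ℕ} (h : n = 2 * m) (T : State n × ℝ → ℝ) : Density n :=
  fun v x => T (v x, vortScalar h v x)

/-- The vorticity density `T(ρ, p, u, ϖ)` in dimension `n = 2 m + 1`. -/
def oddDensity {m : ℕ} (h : n = 2 * m + 1) (T : State n × Space n → ℝ) : Density n :=
  fun v x => T (v x, vortVector h v x)

/-- The density `S(p, ρ) ϖ` in dimension `n = 2 m`. -/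
def entropyVorticity {m : ℕ} (h : n = 2 * m) (S : ℝ × ℝ → ℝ) : Density n :=
  fun v x => S (thermo v x) * vortScalar h v x

/-- The circulatory entropy density `w · (u ∧ ∇S) = w_ij u_i ∂_j S` in dimension `n = 2 m`. -/
def circulatoryEntropy {m : ℕ} (hm : 1 ≤ m) (h : n = 2 * m) (S : ℝ × ℝ → ℝ) : Density n :=
  fun v x => ∑ i, ∑ j,
    vortTensor hm h v x i j * vel v x i * pd j (fun y => S (thermo v y)) x

/-- The vector `e_p (∇p - ρ⁻¹ F ∇ρ)`, which is `e_S ∇S`. -/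
def energyEntropyGrad (F e : ℝ × ℝ → ℝ) (v : Field n) (x : Space n) (i : Fin n) : ℝ :=
  derivP e (thermo v x) *
    (pd i (pres v) x - (dens v x)⁻¹ * F (thermo v x) * pd i (dens v) x)

/-- The flux `S ϖ u + ξ`, `ξ_i = m S w_ij (e_S ∂_j S)`, that goes with the density `S ϖ`. -/
def entropyVorticityFlux {m : ℕ} (hm : 1 ≤ m) (h : n = 2 * m) (F S e : ℝ × ℝ → ℝ)
    (v : Field n) (x : Space n) : Space n :=
  WithLp.toLp 2 fun i =>
    entropyVorticity h S v x * vel v x i +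
      m * S (thermo v x) * ∑ j, vortTensor hm h v x i j * energyEntropyGrad F e v x j

/-- The flux `C u + ξ`, `ξ_i = (e + p / ρ - |u|² / 2) w_ij ∂_j S`, that goes with the circulatory
entropy density `C`. -/
def circulatoryEntropyFlux {m : ℕ} (hm : 1 ≤ m) (h : n = 2 * m) (S e : ℝ × ℝ → ℝ)
    (v : Field n) (x : Space n) : Space n :=
  WithLp.toLp 2 fun i =>
    circulatoryEntropy hm h S v x * vel v x i +
      (e (thermo v x) + pres v x / dens v x - ‖vel v x‖ ^ 2 / 2) *
        ∑ j, vortTensor hm h v x i j * pd j (fun y => S (thermo v y)) x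

end GasDynamics

end

/-! Write N for the velocity gradient ∂_j u_i. Contraction with the Levi-Civita symbol sees only the
antisymmetric part of N, so every Hodge dual of powers of the curl can be computed with N itself
(`star_antisymm`, `starPow_curl`).

Existence of the conservation laws. Along the flow N changes by −N², by a multiple of the pressure
Hessian, and by ρ⁻² ∇p ⊗ ∇ρ (`ug_evolution`). The Hessian is symmetric and drops out of the dual.
The infinitesimal invariance of the Levi-Civita symbol (`trace_mul_star`) balances N² against the
trace of N that comes from the divergence of the convective flux. What remains
(`hasDerivAt_star_evolution`) is the baroclinic source ρ⁻² ∇p ∧ ∇ρ ∧ ω^(m−1) and, in odd dimensions,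
vortex stretching. An entropy is carried along by the flow, so S only multiplies the source. As dω =
0 (`sum_pd_star`), the source is a divergence: modulo symmetric tensors S ρ⁻² ∇p ⊗ ∇ρ is the
gradient of B ∇p with B_ρ = S/ρ², or of S e_S ∇S if an energy function is given. Expanding the
divergence of S u ∧ ω^(m−1) exchanges Sϖ for minus the circulatory entropy. In odd dimensions b · ϖ
is itself a divergence, and stretching is the divergence form d(b·u) ∧ ω^m.

Rigidity. If T is conserved, then D_tT + div(Tu) is a function L of the fields and their first
derivatives only, and it is the divergence of a local vector of unknown order
(`IsConserved.isNullLagrangian`). Compactly supported perturbations do not change the integral of L,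
so the Euler-Lagrange expression of L vanishes identically. On quadratic fields this says that L is
affine along rank-one lines of gradients (`IsNullLagrangian.rankOne_affine`). Along such a line the
vorticity is affine in the parameter t. Switching on a pressure gradient proportional to t adds to L
the number t times a directional derivative of T, which is therefore constant on the line
(`fderiv_eq_of_isNullLagrangian`).

In even dimensions these lines sweep out all values of ϖ, whence T = Sϖ + c with S independent of u;
the t² coefficient of L on another rank-one line is a multiple of ρS_ρ + FS_p and gives the entropy
equation. Triviality of Sϖ makes Sϖ itself a null Lagrangian, and affine fields with constant ρ and
p then force ∇S = 0.

In odd dimensions, bilinear forms built from the rows of an inverse matrix realize prescribed pairs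
of vorticity and direction; a limit of invertible matrices shows that T is affine on rays in ϖ, so T
= B·ϖ + c (`oddDensity_affine`). The same lines force ∂B_i/∂u_j = β δ_ij, the t² coefficient gives
ρB_ρ + FB_p = 0, and the Euler-Lagrange equation for p on affine fields gives B_p + ρ⁻¹∇_uβ = 0 and
ρβ_ρ = (1+m)β. Symmetry of second derivatives reduces these to B_p = B_ρ = 0 and β = 0, so B is
constant (`fderiv_coeff_eq_zero`). -/

noncomputable section

namespace GasDynamics

variable {n : ℕ}

open Equiv Function

/-! ### Antisymmetrized tensors -/

/-- The contraction of a tensor of rank `n` with the Levi-Civita symbol. -/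
def alt (f : (Fin n → Fin n) → ℝ) : ℝ :=
  ∑ σ : Perm (Fin n), ((Perm.sign σ : ℤ) : ℝ) * f σ

theorem alt_add (f g : (Fin n → Fin n) → ℝ) : alt (fun s => f s + g s) = alt f + alt g := by
  simp [alt, mul_add, Finset.sum_add_distrib]

theorem alt_const_mul (c : ℝ) (f : (Fin n → Fin n) → ℝ) :
    alt (fun s => c * f s) = c * alt f := by
  simp only [alt, Finset.mul_sum]
  exact Finset.sum_congr rfl fun σ _ => by ring

theorem alt_sum {ι : Type*} (t : Finset ι) (f : ι → (Fin n → Fin n) → ℝ) :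
    alt (fun s => ∑ i ∈ t, f i s) = ∑ i ∈ t, alt (f i) := by
  simp only [alt, Finset.mul_sum]
  exact Finset.sum_comm

theorem alt_comp_perm (τ : Perm (Fin n)) (f : (Fin n → Fin n) → ℝ) :
    alt (fun s => f (s ∘ τ)) = ((Perm.sign τ : ℤ) : ℝ) * alt f := by
  simp only [alt, Finset.mul_sum]
  refine Fintype.sum_equiv (Equiv.mulRight τ) _ _ fun σ => ?_
  have h1 : (((Perm.sign τ : ℤ) : ℝ)) * ((Perm.sign τ : ℤ) : ℝ) = 1 := by
    rw [← Int.cast_mul, ← Units.val_mul, Int.units_mul_self]; simp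
  simp only [Equiv.coe_mulRight, Perm.sign_mul, Units.val_mul, Int.cast_mul, Perm.coe_mul]
  linear_combination (-((Perm.sign σ : ℤ) : ℝ) * f (⇑σ ∘ ⇑τ)) * h1

theorem alt_perm_comp (τ : Perm (Fin n)) (f : (Fin n → Fin n) → ℝ) :
    alt (fun s => f (τ ∘ s)) = ((Perm.sign τ : ℤ) : ℝ) * alt f := by
  simp only [alt, Finset.mul_sum]
  refine Fintype.sum_equiv (Equiv.mulLeft τ) _ _ fun σ => ?_
  have h1 : (((Perm.sign τ : ℤ) : ℝ)) * ((Perm.sign τ : ℤ) : ℝ) = 1 := by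
    rw [← Int.cast_mul, ← Units.val_mul, Int.units_mul_self]; simp
  simp only [Equiv.coe_mulLeft, Perm.sign_mul, Units.val_mul, Int.cast_mul, Perm.coe_mul]
  linear_combination (-((Perm.sign σ : ℤ) : ℝ) * f (⇑τ ∘ ⇑σ)) * h1

theorem alt_comp_swap {p r : Fin n} (hpr : p ≠ r) (f : (Fin n → Fin n) → ℝ) :
    alt (fun s => f (s ∘ swap p r)) = -alt f := by
  rw [alt_comp_perm, Perm.sign_swap hpr]; simp

/-- The transposition reverses the sign of the contraction but leaves the tensor unchanged. Most
cancellations below come from this: symmetric Hessians, repeated gradients, dω = 0. -/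
theorem alt_eq_zero_of_symm {p r : Fin n} (hpr : p ≠ r) {f : (Fin n → Fin n) → ℝ}
    (hf : ∀ s, f (s ∘ swap p r) = f s) : alt f = 0 := by
  have h := alt_comp_swap hpr f
  rw [show (fun s => f (s ∘ swap p r)) = f from funext hf] at h
  linarith

/-- For `i ≠ l` the tensor no longer distinguishes the index values `i` and `l`; exchanging these
values changes the sign of the contraction and nothing else, so it vanishes. -/
theorem alt_comp_update (f : (Fin n → Fin n) → ℝ) (i l : Fin n) :
    alt (fun s => f (update id i l ∘ s)) = if i = l then alt f else 0 := by
  split_ifs with h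
  · subst h
    rw [show update id i i = id from update_eq_self i id]
    rfl
  · have h1 := alt_perm_comp (swap i l) fun s => f (update id i l ∘ s)
    have h2 : ∀ s : Fin n → Fin n, update id i l ∘ (swap i l ∘ s) = update id i l ∘ s := by
      intro s
      ext x
      simp only [comp_apply, update_apply, id]
      rcases eq_or_ne (s x) i with hx | hx
      · simp [hx]
      · rcases eq_or_ne (s x) l with hx' | hx'
        · simp [hx']
        · rw [swap_apply_of_ne_of_ne hx hx']
    simp only [h2, Perm.sign_swap h] at h1
    push_cast at h1
    linarith

/-- Infinitesimal invariance of the Levi-Civita symbol. -/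
theorem trace_mul_alt (B : Fin n → Fin n → ℝ) (f : (Fin n → Fin n) → ℝ) :
    (∑ i, B i i) * alt f = ∑ r, alt (fun s => ∑ l, B l (s r) * f (update s r l)) := by
  -- A permutation takes each value in exactly one slot, so replacing the entry of slot `r` is the
  -- same as replacing the value `σ r` wherever it occurs. This turns the sum over slots into a sum
  -- over values.
  have key : ∀ σ : Perm (Fin n), ∑ r, ∑ l, B l (σ r) * f (update σ r l) =
      ∑ i, ∑ l, B l i * f (update id i l ∘ σ) := by
    intro σ
    rw [← Equiv.sum_comp σ fun i => ∑ l, B l i * f (update id i l ∘ σ)]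
    refine Finset.sum_congr rfl fun r _ => Finset.sum_congr rfl fun l _ => ?_
    have h1 : update (⇑σ) r l = update id (σ r) l ∘ σ := by
      funext x
      simp only [comp_apply, update_apply, id, σ.injective.eq_iff]
    rw [h1]
  calc (∑ i, B i i) * alt f
      = ∑ i, ∑ l, B l i * alt (fun s => f (update id i l ∘ s)) := by
        simp [alt_comp_update, Finset.sum_mul]
    _ = alt (fun s => ∑ i, ∑ l, B l i * f (update id i l ∘ s)) := by
        simp only [alt_sum, alt_const_mul]
    _ = alt (fun s => ∑ r, ∑ l, B l (s r) * f (update s r l)) := by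
        simp only [alt, key]
    _ = _ := by rw [alt_sum]

/-- The antisymmetrization of a tensor all of whose indices but two are fixed. -/
theorem alt_ite_two (π : Perm (Fin n)) {p r : Fin n} (hpr : p ≠ r) (z x : Fin n → ℝ) :
    alt (fun s => open Classical in
        if ∀ k, k ≠ p → k ≠ r → s k = π k then z (s p) * x (s r) else 0) =
      ((Perm.sign π : ℤ) : ℝ) * (z (π p) * x (π r) - z (π r) * x (π p)) := by
  classical
  have hne : π ≠ π * swap p r := by
    intro h
    have h1 := congrArg (fun e : Perm (Fin n) => e p) h
    simp only [Perm.coe_mul, comp_apply, swap_apply_left, π.injective.eq_iff] at h1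
    exact hpr h1
  rw [alt, Fintype.sum_eq_add π (π * swap p r) hne]
  · rw [if_pos (fun _ _ _ => rfl), if_pos]
    · simp [Perm.sign_swap hpr]; ring
    · intro k hk hk'
      simp [swap_apply_of_ne_of_ne hk hk']
  · rintro σ ⟨h1, h2⟩
    rw [if_neg, mul_zero]
    intro h
    -- Off `p` and `r` the permutation `σ` agrees with `π`, so the values `π p` and `π r` can only
    -- be taken at `p` or `r`. Hence `σ` is `π` or `π * swap p r`.
    have hp : ∀ k, σ k = π p ∨ σ k = π r → k = p ∨ k = r := by
      intro k hk
      by_contra hc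
      push Not at hc
      rw [h k hc.1 hc.2, π.injective.eq_iff, π.injective.eq_iff] at hk
      tauto
    obtain ⟨a, ha⟩ := σ.surjective (π p)
    obtain ⟨b, hb⟩ := σ.surjective (π r)
    have hab : a ≠ b := by
      rintro rfl
      exact hpr (π.injective (ha.symm.trans hb))
    rcases hp a (.inl ha) with rfl | rfl <;> rcases hp b (.inr hb) with rfl | rfl
    · exact hab rfl
    · refine h1 (Equiv.ext fun k => ?_)
      rcases eq_or_ne k a with rfl | hk
      · exact ha
      · rcases eq_or_ne k b with rfl | hk'
        · exact hb
        · exact h k hk hk'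
    · refine h2 (Equiv.ext fun k => ?_)
      rcases eq_or_ne k b with rfl | hk
      · simpa using hb
      · rcases eq_or_ne k a with rfl | hk'
        · simpa using ha
        · simpa [swap_apply_of_ne_of_ne hk hk'] using h k hk hk'
    · exact hab rfl

/-! ### Hodge duals of products of two-forms -/

/-- The position of the `l`-th free index. -/
def freePos {q r : ℕ} (h : q + 2 * r = n) (l : Fin q) : Fin n := ⟨l, by omega⟩

/-- The position of the first index of the `k`-th two-form. -/
def fstPos {q r : ℕ} (h : q + 2 * r = n) (k : Fin r) : Fin n := ⟨q + 2 * k, by omega⟩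

/-- The position of the second index of the `k`-th two-form. -/
def sndPos {q r : ℕ} (h : q + 2 * r = n) (k : Fin r) : Fin n := ⟨q + 2 * k + 1, by omega⟩

section Positions

variable {q r : ℕ} (h : q + 2 * r = n)

theorem freePos_ne_fstPos (l : Fin q) (k : Fin r) : freePos h l ≠ fstPos h k := by
  simp only [freePos, fstPos, ne_eq, Fin.mk.injEq]; omega

theorem freePos_ne_sndPos (l : Fin q) (k : Fin r) : freePos h l ≠ sndPos h k := by
  simp only [freePos, sndPos, ne_eq, Fin.mk.injEq]; omega

theorem fstPos_ne_sndPos (j k : Fin r) : fstPos h j ≠ sndPos h k := by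
  simp only [fstPos, sndPos, ne_eq, Fin.mk.injEq]; omega

theorem freePos_inj {l l' : Fin q} : freePos h l = freePos h l' ↔ l = l' := by
  simp only [freePos, Fin.ext_iff]

theorem fstPos_inj {l l' : Fin r} : fstPos h l = fstPos h l' ↔ l = l' := by
  simp only [fstPos, Fin.ext_iff]; omega

theorem sndPos_inj {l l' : Fin r} : sndPos h l = sndPos h l' ↔ l = l' := by
  simp only [sndPos, Fin.ext_iff]; omega

theorem pos_cases (x : Fin n) :
    (∃ l, x = freePos h l) ∨ (∃ k, x = fstPos h k) ∨ ∃ k, x = sndPos h k := by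
  rcases lt_or_ge (x : ℕ) q with hx | hx
  · exact .inl ⟨⟨x, hx⟩, rfl⟩
  · rcases Nat.even_or_odd' ((x : ℕ) - q) with ⟨c, hc | hc⟩
    · exact .inr (.inl ⟨⟨c, by omega⟩, by simp only [fstPos, Fin.ext_iff]; omega⟩)
    · exact .inr (.inr ⟨⟨c, by omega⟩, by simp only [sndPos, Fin.ext_iff]; omega⟩)

theorem sum_pos (g : Fin n → ℝ) :
    ∑ x, g x = ∑ l, g (freePos h l) + ∑ k, (g (fstPos h k) + g (sndPos h k)) := by
  let e : Fin q ⊕ (Fin r ⊕ Fin r) → Fin n :=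
    Sum.elim (freePos h) (Sum.elim (fstPos h) (sndPos h))
  have he : Bijective e := by
    refine (Fintype.bijective_iff_surjective_and_card e).2 ⟨fun x => ?_, ?_⟩
    · rcases pos_cases h x with ⟨l, rfl⟩ | ⟨k, rfl⟩ | ⟨k, rfl⟩
      · exact ⟨.inl l, rfl⟩
      · exact ⟨.inr (.inl k), rfl⟩
      · exact ⟨.inr (.inr k), rfl⟩
    · simp; omega
  rw [← he.sum_comp]
  simp [e, Finset.sum_add_distrib]

end Positions

/-- The tensor `b ⊗ A₁ ⊗ ⋯ ⊗ A_r`. -/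
def tens {q r : ℕ} (h : q + 2 * r = n) (b : (Fin q → Fin n) → ℝ)
    (A : Fin r → Fin n → Fin n → ℝ) (s : Fin n → Fin n) : ℝ :=
  b (fun l => s (freePos h l)) * ∏ k, A k (s (fstPos h k)) (s (sndPos h k))

/-- The antisymmetrization of `b ⊗ A₁ ⊗ ⋯ ⊗ A_r`. -/
def star {q r : ℕ} (h : q + 2 * r = n) (b : (Fin q → Fin n) → ℝ)
    (A : Fin r → Fin n → Fin n → ℝ) : ℝ := alt (tens h b A)

section Star

variable {q r : ℕ} (h : q + 2 * r = n) (b : (Fin q → Fin n) → ℝ)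
  (A : Fin r → Fin n → Fin n → ℝ)

theorem tens_update (k : Fin r) (X : Fin n → Fin n → ℝ) (s : Fin n → Fin n) :
    tens h b (update A k X) s =
      X (s (fstPos h k)) (s (sndPos h k)) * (b (fun l => s (freePos h l)) *
        ∏ j ∈ Finset.univ.erase k, A j (s (fstPos h j)) (s (sndPos h j))) := by
  rw [tens, ← Finset.mul_prod_erase _ _ (Finset.mem_univ k), update_self]
  have : ∏ j ∈ Finset.univ.erase k,
      update A k X j (s (fstPos h j)) (s (sndPos h j)) =
      ∏ j ∈ Finset.univ.erase k, A j (s (fstPos h j)) (s (sndPos h j)) := by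
    refine Finset.prod_congr rfl fun j hj => ?_
    rw [update_of_ne (Finset.ne_of_mem_erase hj)]
  rw [this]; ring

theorem star_update_add (k : Fin r) (X Y : Fin n → Fin n → ℝ) :
    star h b (update A k fun i j => X i j + Y i j) =
      star h b (update A k X) + star h b (update A k Y) := by
  simp only [star, ← alt_add]
  congr 1; ext s
  simp only [tens_update]; ring

theorem star_update_const_mul (k : Fin r) (c : ℝ) (X : Fin n → Fin n → ℝ) :
    star h b (update A k fun i j => c * X i j) = c * star h b (update A k X) := by
  simp only [star, ← alt_const_mul]
  congr 1; ext s
  simp only [tens_update]; ring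

theorem star_update_transpose (k : Fin r) (X : Fin n → Fin n → ℝ) :
    star h b (update A k fun i j => X j i) = -star h b (update A k X) := by
  rw [star, star, ← alt_comp_swap (fstPos_ne_sndPos h k k)]
  congr 1; ext s
  simp only [tens_update, comp_apply, swap_apply_left, swap_apply_right]
  congr 2
  · congr 1; ext l
    rw [swap_apply_of_ne_of_ne (freePos_ne_fstPos h l k) (freePos_ne_sndPos h l k)]
  · refine Finset.prod_congr rfl fun j hj => ?_
    have hj := Finset.ne_of_mem_erase hj
    rw [swap_apply_of_ne_of_ne (by simpa [fstPos_inj] using hj) (fstPos_ne_sndPos h j k),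
      swap_apply_of_ne_of_ne (fstPos_ne_sndPos h k j).symm (by simpa [sndPos_inj] using hj)]

theorem star_update_eq_zero_of_symm (k : Fin r) {X : Fin n → Fin n → ℝ}
    (hX : ∀ i j, X i j = X j i) : star h b (update A k X) = 0 := by
  have h1 := star_update_transpose h b A k X
  have h2 : (fun i j => X j i) = X := by ext i j; exact hX j i
  rw [h2] at h1
  linarith

theorem star_update_antisymm (k : Fin r) (X : Fin n → Fin n → ℝ) :
    star h b (update A k fun i j => (X i j - X j i) / 2) = star h b (update A k X) := by
  have h1 : (fun i j => (X i j - X j i) / 2) =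
      fun i j => 2⁻¹ * (fun i j => X i j + (fun i j => -1 * (fun i j => X j i) i j) i j) i j := by
    ext i j; ring
  rw [h1, star_update_const_mul, star_update_add, star_update_const_mul, star_update_transpose]
  ring

/-- Each slot may be antisymmetrized separately, because its symmetric part contributes nothing;
induction over the slots treats all of them. This is what allows the curl to be replaced by the full
velocity gradient. -/
theorem star_antisymm :
    star h b (fun k i j => (A k i j - A k j i) / 2) = star h b A := by
  classical
  have key : ∀ t : Finset (Fin r),
      star h b (fun k => if k ∈ t then fun i j => (A k i j - A k j i) / 2 else A k) =
        star h b A := by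
    intro t
    induction t using Finset.induction_on with
    | empty => simp
    | insert k t hk ih =>
      rw [← ih]
      set A' : Fin r → Fin n → Fin n → ℝ :=
        fun k => if k ∈ t then fun i j => (A k i j - A k j i) / 2 else A k
      have h1 := star_update_antisymm h b A' k (A k)
      have h2 : update A' k (A k) = A' := by
        rw [update_eq_self_iff]; simp [A', hk]
      rw [h2] at h1
      rw [← h1]
      congr 1; ext j
      rcases eq_or_ne j k with rfl | hj
      · simp
      · simp [hj, A']
  simpa using key Finset.univ

/-- Two-forms have even degree and therefore commute: exchanging two of them is a product of two
transpositions of indices, an even permutation. -/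
theorem star_swap_slots (j k : Fin r) : star h b (fun l => A (swap j k l)) = star h b A := by
  rcases eq_or_ne j k with rfl | hjk
  · simp
  have hs : ((Perm.sign (swap (fstPos h j) (fstPos h k) * swap (sndPos h j) (sndPos h k)) : ℤ)
      : ℝ) = 1 := by
    rw [Perm.sign_mul, Perm.sign_swap (by simpa [fstPos_inj] using hjk),
      Perm.sign_swap (by simpa [sndPos_inj] using hjk)]
    simp
  have h1 := alt_comp_perm (swap (fstPos h j) (fstPos h k) * swap (sndPos h j) (sndPos h k))
    (tens h b A)
  rw [hs, one_mul] at h1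
  rw [star, star, ← h1]
  congr 1; ext s
  have e1 : ∀ l, (swap (fstPos h j) (fstPos h k) * swap (sndPos h j) (sndPos h k))
      (freePos h l) = freePos h l := fun l => by
    rw [Perm.mul_apply, swap_apply_of_ne_of_ne (freePos_ne_sndPos h l j) (freePos_ne_sndPos h l k),
      swap_apply_of_ne_of_ne (freePos_ne_fstPos h l j) (freePos_ne_fstPos h l k)]
  have e2 : ∀ l, (swap (fstPos h j) (fstPos h k) * swap (sndPos h j) (sndPos h k))
      (fstPos h l) = fstPos h (swap j k l) := fun l => by
    rw [Perm.mul_apply, swap_apply_of_ne_of_ne (fstPos_ne_sndPos h l j) (fstPos_ne_sndPos h l k)]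
    simp only [swap_apply_def, fstPos_inj]
    split_ifs <;> rfl
  have e3 : ∀ l, (swap (fstPos h j) (fstPos h k) * swap (sndPos h j) (sndPos h k))
      (sndPos h l) = sndPos h (swap j k l) := fun l => by
    have : swap (sndPos h j) (sndPos h k) (sndPos h l) = sndPos h (swap j k l) := by
      simp only [swap_apply_def, sndPos_inj]
      split_ifs <;> rfl
    rw [Perm.mul_apply, this,
      swap_apply_of_ne_of_ne (fstPos_ne_sndPos h _ _).symm (fstPos_ne_sndPos h _ _).symm]
  simp only [tens, comp_apply, e1, e2, e3]
  congr 1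
  rw [← Equiv.prod_comp (swap j k)]
  simp

theorem star_perm_slots (τ : Perm (Fin r)) : star h b (fun l => A (τ l)) = star h b A := by
  induction τ using Perm.swap_induction_on generalizing A with
  | one => simp
  | swap_mul f x y _ ih =>
    have h1 := ih fun l => A (swap x y l)
    simp only [Perm.coe_mul, comp_apply]
    rw [h1, star_swap_slots]

theorem star_update_slot (N X : Fin n → Fin n → ℝ) (j k : Fin r) :
    star h b (update (fun _ => N) j X) = star h b (update (fun _ => N) k X) := by
  rw [← star_swap_slots h b _ j k]
  congr 1; ext l
  simp only [update_apply, swap_apply_eq_iff, swap_apply_left]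

/-- Infinitesimal invariance of the Hodge dual under linear maps. -/
theorem trace_mul_star (N : Fin n → Fin n → ℝ) :
    (∑ i, N i i) * star h b (fun _ => N) =
      star h (fun a => ∑ c, ∑ l, N l (a c) * b (update a c l)) (fun _ => N) +
        ∑ k, star h b (update (fun _ => N) k fun i j => ∑ l, N i l * N l j) := by
  rw [star, trace_mul_alt, sum_pos h]
  congr 1
  · rw [star, ← alt_sum]
    congr 1; ext s
    simp only [tens, Finset.sum_mul]
    refine Finset.sum_congr rfl fun c _ => Finset.sum_congr rfl fun l _ => ?_
    rw [mul_assoc]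
    congr 2
    · congr 1; ext x
      simp only [update_apply, freePos_inj]
    · refine Finset.prod_congr rfl fun k _ => ?_
      rw [update_of_ne (freePos_ne_fstPos h c k).symm, update_of_ne (freePos_ne_sndPos h c k).symm]
  · refine Finset.sum_congr rfl fun k _ => ?_
    -- Changing one index of the `k`-th two-form affects this factor only, so the altered tensor is
    -- the original one with a new factor in slot `k`.
    have e : ∀ s : Fin n → Fin n, ∀ p : Fin n, (p = fstPos h k ∨ p = sndPos h k) → ∀ l,
        tens h b (fun _ => N) (update s p l) =
        tens h b (update (fun _ => N) k fun _ _ =>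
          N (update s p l (fstPos h k)) (update s p l (sndPos h k))) s := by
      intro s p hp l
      have h0 := tens_update h b (fun _ => N) k N (update s p l)
      rw [update_eq_self_iff.2 rfl] at h0
      rw [h0, tens_update]
      congr 2
      · congr 1; ext x
        rcases hp with rfl | rfl
        · rw [update_of_ne (freePos_ne_fstPos h x k)]
        · rw [update_of_ne (freePos_ne_sndPos h x k)]
      · refine Finset.prod_congr rfl fun j hj => ?_
        have hj := Finset.ne_of_mem_erase hj
        rcases hp with rfl | rfl
        · rw [update_of_ne (by simpa [fstPos_inj] using hj),
            update_of_ne (fstPos_ne_sndPos h k j).symm]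
        · rw [update_of_ne (fstPos_ne_sndPos h j k),
            update_of_ne (by simpa [sndPos_inj] using hj)]
    have e1 : alt (fun s => ∑ l, N l (s (fstPos h k)) *
        tens h b (fun _ => N) (update s (fstPos h k) l)) =
        star h b (update (fun _ => N) k fun i j => ∑ l, N l i * N l j) := by
      rw [star]
      congr 1; ext s
      rw [tens_update, Finset.sum_mul]
      refine Finset.sum_congr rfl fun l _ => ?_
      rw [e s _ (.inl rfl) l, tens_update, update_self, update_of_ne (fstPos_ne_sndPos h k k).symm]
      ring
    have e2 : alt (fun s => ∑ l, N l (s (sndPos h k)) *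
        tens h b (fun _ => N) (update s (sndPos h k) l)) =
        star h b (update (fun _ => N) k fun i j => ∑ l, N i l * N l j) := by
      rw [star]
      congr 1; ext s
      rw [tens_update, Finset.sum_mul]
      refine Finset.sum_congr rfl fun l _ => ?_
      rw [e s _ (.inr rfl) l, tens_update, update_self, update_of_ne (fstPos_ne_sndPos h k k)]
      ring
    -- Changing the first index produces NᵀN, which is symmetric and drops out; changing the second
    -- index produces N².
    rw [e1, e2, star_update_eq_zero_of_symm, zero_add]
    intro i j
    exact Finset.sum_congr rfl fun l _ => mul_comm _ _

end Star

/-- The first two-form can be regarded as a part of the first factor. -/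
theorem star_update_zero {q r : ℕ} (h : q + 2 * (r + 1) = n) (h' : (q + 2) + 2 * r = n)
    (b : (Fin q → Fin n) → ℝ) (N X : Fin n → Fin n → ℝ) :
    star h b (update (fun _ => N) 0 X) =
      star h' (fun a => b (fun l => a (Fin.castAdd 2 l)) *
        X (a (Fin.natAdd q 0)) (a (Fin.natAdd q 1))) (fun _ => N) := by
  rw [star, star]
  congr 1; ext s
  simp only [tens, Fin.prod_univ_succ, update_self, ne_eq, Fin.succ_ne_zero, not_false_eq_true,
    update_of_ne]
  rw [mul_assoc]
  congr 2
  refine Finset.prod_congr rfl fun k _ => ?_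
  congr 2
  · simp only [fstPos, Fin.ext_iff, Fin.val_succ]; ring
  · simp only [sndPos, Fin.ext_iff, Fin.val_succ]; ring

theorem sum_star_update {q r : ℕ} (h : q + 2 * (r + 1) = n) (h' : (q + 2) + 2 * r = n)
    (b : (Fin q → Fin n) → ℝ) (N X : Fin n → Fin n → ℝ) :
    ∑ k, star h b (update (fun _ => N) k X) =
      (r + 1) * star h' (fun a => b (fun l => a (Fin.castAdd 2 l)) *
        X (a (Fin.natAdd q 0)) (a (Fin.natAdd q 1))) (fun _ => N) := by
  rw [← star_update_zero h h', Finset.sum_congr rfl fun k _ => star_update_slot h b N X k 0]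
  simp

end GasDynamics
end

noncomputable section

namespace GasDynamics

variable {n : ℕ}

open Function

/-! ### Partial derivatives -/

theorem hasDerivAt_line {f : Space n → ℝ} {x : Space n} (hf : DifferentiableAt ℝ f x)
    (j : Fin n) :
    HasDerivAt (fun t : ℝ => f (x + t • EuclideanSpace.single j (1 : ℝ))) (pd j f x) 0 :=
  hf.hasFDerivAt.hasLineDerivAt _

theorem pd_eq_of_hasDerivAt {f : Space n → ℝ} {x : Space n} (hf : DifferentiableAt ℝ f x)
    {j : Fin n} {c : ℝ}
    (h : HasDerivAt (fun t : ℝ => f (x + t • EuclideanSpace.single j (1 : ℝ))) c 0) :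
    pd j f x = c :=
  (hasDerivAt_line hf j).unique h

theorem pd_add {f g : Space n → ℝ} {x : Space n} (hf : DifferentiableAt ℝ f x)
    (hg : DifferentiableAt ℝ g x) (j : Fin n) :
    pd j (fun y => f y + g y) x = pd j f x + pd j g x := by
  simp [pd, fderiv_fun_add hf hg]

theorem pd_sub {f g : Space n → ℝ} {x : Space n} (hf : DifferentiableAt ℝ f x)
    (hg : DifferentiableAt ℝ g x) (j : Fin n) :
    pd j (fun y => f y - g y) x = pd j f x - pd j g x := by
  simp [pd, fderiv_fun_sub hf hg]

theorem pd_neg (f : Space n → ℝ) (x : Space n) (j : Fin n) :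
    pd j (fun y => -f y) x = -pd j f x := by
  simp [pd]

theorem pd_mul {f g : Space n → ℝ} {x : Space n} (hf : DifferentiableAt ℝ f x)
    (hg : DifferentiableAt ℝ g x) (j : Fin n) :
    pd j (fun y => f y * g y) x = f x * pd j g x + g x * pd j f x := by
  simp [pd, fderiv_fun_mul hf hg]

theorem pd_const (c : ℝ) (x : Space n) (j : Fin n) : pd j (fun _ => c) x = 0 := by
  simp [pd]

theorem pd_const_mul {f : Space n → ℝ} {x : Space n} (hf : DifferentiableAt ℝ f x) (c : ℝ)
    (j : Fin n) : pd j (fun y => c * f y) x = c * pd j f x := by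
  simp [pd, fderiv_const_mul hf]

theorem pd_sum {ι : Type*} (t : Finset ι) {f : ι → Space n → ℝ} {x : Space n}
    (hf : ∀ i ∈ t, DifferentiableAt ℝ (f i) x) (j : Fin n) :
    pd j (fun y => ∑ i ∈ t, f i y) x = ∑ i ∈ t, pd j (f i) x := by
  simp [pd, fderiv_fun_sum hf]

theorem pd_inv {f : Space n → ℝ} {x : Space n} (hf : DifferentiableAt ℝ f x) (h0 : f x ≠ 0)
    (j : Fin n) : pd j (fun y => (f y)⁻¹) x = -((f x)⁻¹ ^ 2 * pd j f x) := by
  refine pd_eq_of_hasDerivAt (hf.fun_inv h0) ?_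
  have h1 := (hasDerivAt_line hf j).fun_inv (by simpa using h0)
  convert! h1 using 1
  simp; field_simp

theorem contDiff_pd {f : Space n → ℝ} (hf : ContDiff ℝ ∞ f) (j : Fin n) :
    ContDiff ℝ ∞ (pd j f) :=
  (hf.fderiv_right (m := ∞) (by simp)).clm_apply contDiff_const

theorem two_le_infty : (2 : WithTop ℕ∞) ≤ ∞ := by
  exact ENat.LEInfty.out

theorem pd_pd_comm {f : Space n → ℝ} (hf : ContDiff ℝ ∞ f) (i j : Fin n) (x : Space n) :
    pd i (pd j f) x = pd j (pd i f) x := by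
  have h1 : ∀ i j, pd i (pd j f) x = fderiv ℝ (fderiv ℝ f) x
      (EuclideanSpace.single i 1) (EuclideanSpace.single j 1) := by
    intro i j
    have h2 : DifferentiableAt ℝ (fderiv ℝ f) x :=
      (hf.fderiv_right (m := ∞) (by simp)).differentiable (by simp) x
    change fderiv ℝ (fun y => fderiv ℝ f y (EuclideanSpace.single j 1)) x _ = _
    rw [fderiv_clm_apply h2 (differentiableAt_const _)]
    simp
  rw [h1, h1]
  exact (hf.contDiffAt.isSymmSndFDerivAt (by simp [two_le_infty])).eq _ _

/-- A derivative along a curve of functions commutes with a partial derivative. -/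
theorem hasDerivAt_pd {Ψ : ℝ × Space n → ℝ} {x : Space n} (hΨ : ContDiffAt ℝ ∞ Ψ (0, x))
    {g : Space n → ℝ} (hg : ∀ y, HasDerivAt (fun ε => Ψ (ε, y)) (g y) 0) (j : Fin n) :
    HasDerivAt (fun ε => pd j (fun y => Ψ (ε, y)) x) (pd j g x) 0 := by
  have hd : ∀ᶠ z in nhds ((0 : ℝ), x), DifferentiableAt ℝ Ψ z := by
    filter_upwards [(hΨ.of_le (m := 1) (by simp)).eventually (by simp)] with z hz
    exact hz.differentiableAt (by simp)
  have h2 : DifferentiableAt ℝ (fderiv ℝ Ψ) (0, x) :=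
    (hΨ.fderiv_right (m := ∞) (by simp)).differentiableAt (by simp)
  have e1 : (fun ε => pd j (fun y => Ψ (ε, y)) x) =ᶠ[nhds 0]
      fun ε => fderiv ℝ Ψ (ε, x) (0, EuclideanSpace.single j 1) := by
    have hc : Filter.Tendsto (fun ε : ℝ => (ε, x)) (nhds 0) (nhds (0, x)) :=
      (continuous_id.prodMk continuous_const).tendsto _
    filter_upwards [hc.eventually hd] with ε hε
    have h3 : HasFDerivAt (fun y : Space n => (ε, y))
        (ContinuousLinearMap.inr ℝ ℝ (Space n)) x := hasFDerivAt_prodMk_right ε x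
    have h4 := HasFDerivAt.comp x hε.hasFDerivAt h3
    simp only [pd]
    change fderiv ℝ (Ψ ∘ fun y => (ε, y)) x _ = _
    rw [h4.fderiv]; simp
  have e2 : g =ᶠ[nhds x] fun y => fderiv ℝ Ψ (0, y) (1, 0) := by
    have hc : Filter.Tendsto (fun y : Space n => ((0 : ℝ), y)) (nhds x) (nhds (0, x)) :=
      (continuous_const.prodMk continuous_id).tendsto _
    filter_upwards [hc.eventually hd] with y hy
    have h3 : HasDerivAt (fun ε : ℝ => (ε, y)) (1, 0) 0 :=
      (hasDerivAt_id _).prodMk (hasDerivAt_const _ _)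
    exact (hg y).unique (HasFDerivAt.comp_hasDerivAt (0 : ℝ) hy.hasFDerivAt h3)
  have e3 : pd j g x = fderiv ℝ (fderiv ℝ Ψ) (0, x) (0, EuclideanSpace.single j 1) (1, 0) := by
    have h3 : HasFDerivAt (fun y : Space n => ((0 : ℝ), y))
        (ContinuousLinearMap.inr ℝ ℝ (Space n)) x := hasFDerivAt_prodMk_right 0 x
    have h4 := (HasFDerivAt.comp x h2.hasFDerivAt h3).clm_apply
      (hasFDerivAt_const ((1 : ℝ), (0 : Space n)) x)
    rw [pd, e2.fderiv_eq]
    change fderiv ℝ (fun y => (fderiv ℝ Ψ ∘ fun y => (0, y)) y (1, 0)) x _ = _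
    rw [h4.fderiv]; simp
  -- Both sides are mixed second derivatives of `Ψ` at `(0, x)`, once in the parameter and once in
  -- space.
  rw [e3, ((hΨ.isSymmSndFDerivAt (by simp [two_le_infty])).eq _ _ :
    fderiv ℝ (fderiv ℝ Ψ) (0, x) (0, EuclideanSpace.single j 1) (1, 0) = _)]
  refine HasDerivAt.congr_of_eventuallyEq ?_ e1
  have h3 : HasDerivAt (fun ε : ℝ => (ε, x)) (1, 0) 0 :=
    (hasDerivAt_id _).prodMk (hasDerivAt_const _ _)
  have h4 := HasFDerivAt.comp_hasDerivAt (0 : ℝ) h2.hasFDerivAt h3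
  have h5 := h4.clm_apply (hasDerivAt_const (0 : ℝ) ((0 : ℝ), EuclideanSpace.single j (1 : ℝ)))
  simpa using h5

/-! ### Derivatives of Hodge duals -/

section StarDeriv

variable {q r : ℕ} (h : q + 2 * r = n)

theorem hasDerivAt_star {b : ℝ → (Fin q → Fin n) → ℝ} {b' : (Fin q → Fin n) → ℝ}
    {A : ℝ → Fin n → Fin n → ℝ} {A' : Fin n → Fin n → ℝ} {t : ℝ}
    (hb : ∀ a, HasDerivAt (fun s => b s a) (b' a) t)
    (hA : ∀ i j, HasDerivAt (fun s => A s i j) (A' i j) t) :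
    HasDerivAt (fun s => star h (b s) (fun _ => A s))
      (star h b' (fun _ => A t) + ∑ k, star h (b t) (update (fun _ => A t) k A')) t := by
  have h1 : ∀ σ : Fin n → Fin n, HasDerivAt (fun s => tens h (b s) (fun _ => A s) σ)
      (tens h b' (fun _ => A t) σ + ∑ k, tens h (b t) (update (fun _ => A t) k A') σ) t := by
    intro σ
    have h2 := (hb fun l => σ (freePos h l)).mul (HasDerivAt.fun_finsetProd
      (u := (Finset.univ : Finset (Fin r))) (f := fun k s => A s (σ (fstPos h k)) (σ (sndPos h k)))
      fun k _ => hA (σ (fstPos h k)) (σ (sndPos h k)))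
    refine h2.congr_deriv ?_
    simp only [tens_update, Finset.mul_sum]
    congr 1
    refine Finset.sum_congr rfl fun k _ => ?_
    simp only [smul_eq_mul]; ring
  have h2 := HasDerivAt.fun_sum (u := (Finset.univ : Finset (Equiv.Perm (Fin n))))
    fun σ _ => (h1 σ).const_mul ((Equiv.Perm.sign σ : ℤ) : ℝ)
  refine h2.congr_deriv ?_
  simp only [star]
  rw [← alt_sum, ← alt_add, alt]

theorem contDiffWithinAt_star {X : Type*} [NormedAddCommGroup X] [NormedSpace ℝ X] {k : WithTop ℕ∞}
    {b : X → (Fin q → Fin n) → ℝ} {A : X → Fin r → Fin n → Fin n → ℝ} {s : Set X} {x : X}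
    (hb : ∀ a, ContDiffWithinAt ℝ k (fun y => b y a) s x)
    (hA : ∀ c i j, ContDiffWithinAt ℝ k (fun y => A y c i j) s x) :
    ContDiffWithinAt ℝ k (fun y => star h (b y) (A y)) s x := by
  simp only [star, alt, tens]
  exact ContDiffWithinAt.sum fun σ _ => contDiffWithinAt_const.mul
    ((hb _).mul (contDiffWithinAt_prod fun c _ => hA _ _ _))

theorem contDiff_star {X : Type*} [NormedAddCommGroup X] [NormedSpace ℝ X] {k : WithTop ℕ∞}
    {b : X → (Fin q → Fin n) → ℝ} {A : X → Fin r → Fin n → Fin n → ℝ}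
    (hb : ∀ a, ContDiff ℝ k (fun y => b y a))
    (hA : ∀ c i j, ContDiff ℝ k (fun y => A y c i j)) :
    ContDiff ℝ k (fun y => star h (b y) (A y)) := by
  rw [contDiff_iff_contDiffAt]
  intro x
  exact contDiffWithinAt_star h (fun a => (hb a).contDiffAt.contDiffWithinAt)
    fun c i j => (hA c i j).contDiffAt.contDiffWithinAt

theorem pd_star {b : Space n → (Fin q → Fin n) → ℝ} {A : Space n → Fin n → Fin n → ℝ}
    (hb : ∀ a, ContDiff ℝ ∞ (fun y => b y a)) (hA : ∀ i j, ContDiff ℝ ∞ (fun y => A y i j))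
    (x : Space n) (j : Fin n) :
    pd j (fun y => star h (b y) (fun _ => A y)) x =
      star h (fun a => pd j (fun y => b y a) x) (fun _ => A x) +
        ∑ k, star h (b x) (update (fun _ => A x) k fun i l => pd j (fun y => A y i l) x) := by
  refine pd_eq_of_hasDerivAt ((contDiff_star h hb fun _ => hA).differentiable (by simp) x) ?_
  have := hasDerivAt_star h (fun a => hasDerivAt_line ((hb a).differentiable (by simp) x) j)
    (fun i l => hasDerivAt_line ((hA i l).differentiable (by simp) x) j)
  simpa using this

end StarDeriv

/-! ### The derivatives of the gas variables -/

/-- The velocity gradient `∂_j u_i`. -/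
def ug (v : Field n) (x : Space n) (i j : Fin n) : ℝ := pd j (fun y => vel v y i) x

section Fields

variable {v : Field n} (hv : ContDiff ℝ ∞ v)
include hv

theorem contDiff_dens : ContDiff ℝ ∞ (dens v) := hv.fst

theorem contDiff_pres : ContDiff ℝ ∞ (pres v) := hv.snd.fst

theorem contDiff_vel : ContDiff ℝ ∞ (vel v) := hv.snd.snd

theorem contDiff_vel_apply (i : Fin n) : ContDiff ℝ ∞ (fun y => vel v y i) :=
  (EuclideanSpace.proj (𝕜 := ℝ) i).contDiff.comp (contDiff_vel hv)

theorem contDiff_ug (i j : Fin n) : ContDiff ℝ ∞ (fun y => ug v y i j) :=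
  contDiff_pd (contDiff_vel_apply hv i) j

theorem contDiff_thermo : ContDiff ℝ ∞ (thermo v) :=
  (contDiff_pres hv).prodMk (contDiff_dens hv)

theorem pd_ug_symm (x : Space n) (i j k : Fin n) :
    pd k (fun y => ug v y i j) x = pd j (fun y => ug v y i k) x :=
  pd_pd_comm (contDiff_vel_apply hv i) k j x

end Fields

/-- The prescribed free indices become an indicator tensor in the free slots, and `star_antisymm`
trades the curl for the velocity gradient. In the form `star` the dual has a product rule. -/
theorem starPow_curl {q r : ℕ} (h : q + 2 * r = n) (v : Field n) (x : Space n)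
    (a : Fin q → Fin n) :
    starPow h (curl v x) a =
      star h (fun c => open Classical in if c = a then 1 else 0) (fun _ => ug v x) := by
  rw [← star_antisymm]
  simp only [starPow, star, alt, tens]
  refine Finset.sum_congr rfl fun σ _ => ?_
  have e : (∀ l : Fin q, σ ⟨l, by omega⟩ = a l) ↔ (fun l => σ (freePos h l)) = a :=
    funext_iff.symm
  by_cases h1 : (fun l => σ (freePos h l)) = a
  · rw [if_pos (e.2 h1), if_pos h1, one_mul]; rfl
  · rw [if_neg (fun h2 => h1 (e.1 h2)), if_neg h1]; simp

/-- The divergence of a Hodge dual of powers of the vorticity. -/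
theorem sum_pd_star {q r : ℕ} (h : (q + 1) + 2 * r = n) {v : Field n} (hv : ContDiff ℝ ∞ v)
    {b : Space n → (Fin q → Fin n) → ℝ} (hb : ∀ a, ContDiff ℝ ∞ (fun y => b y a)) (x : Space n) :
    ∑ j, pd j (fun y => star h
        (fun a => b y (fun l => a l.castSucc) * if a (Fin.last q) = j then 1 else 0)
        (fun _ => ug v y)) x =
      star h (fun a => pd (a (Fin.last q)) (fun y => b y (fun l => a l.castSucc)) x)
        (fun _ => ug v x) := by
  have h1 : ∀ j, pd j (fun y => star h
        (fun a => b y (fun l => a l.castSucc) * if a (Fin.last q) = j then 1 else 0)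
        (fun _ => ug v y)) x = _ := fun j =>
    pd_star h (b := fun y a => b y (fun l => a l.castSucc) * if a (Fin.last q) = j then 1 else 0)
      (fun a => (hb _).mul contDiff_const) (contDiff_ug hv) x j
  simp only [h1, Finset.sum_add_distrib]
  have h2 : ∀ j (a : Fin (q + 1) → Fin n),
      pd j (fun y => b y (fun l => a l.castSucc) * if a (Fin.last q) = j then 1 else 0) x =
      pd j (fun y => b y (fun l => a l.castSucc)) x * if a (Fin.last q) = j then 1 else 0 := by
    intro j a
    rw [pd_mul ((hb _).differentiable (by simp) x) (differentiableAt_const _), pd_const]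
    ring
  have h3 : ∑ j, star h (fun a => pd j (fun y => b y (fun l => a l.castSucc) *
      if a (Fin.last q) = j then 1 else 0) x) (fun _ => ug v x) =
      star h (fun a => pd (a (Fin.last q)) (fun y => b y (fun l => a l.castSucc)) x)
        (fun _ => ug v x) := by
    simp only [star, ← alt_sum, h2]
    congr 1; ext s
    simp [tens]
  rw [h3, add_eq_left, Finset.sum_comm]
  refine Finset.sum_eq_zero fun k _ => ?_
  simp only [star, ← alt_sum]
  -- This is dω = 0. The index of differentiation sits in the last free slot, and second derivatives
  -- of `u` are symmetric under its exchange with the second index of the differentiated factor.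
  refine alt_eq_zero_of_symm (freePos_ne_sndPos h (Fin.last q) k) fun s => ?_
  simp only [tens_update, mul_ite, mul_one, mul_zero, ite_mul, zero_mul, Finset.sum_ite_eq,
    Finset.mem_univ, if_true, comp_apply, Equiv.swap_apply_left, Equiv.swap_apply_right]
  rw [pd_ug_symm hv, Equiv.swap_apply_of_ne_of_ne (freePos_ne_fstPos h _ k).symm
    (fstPos_ne_sndPos h k k)]
  congr 2
  · congr 1; ext l
    rw [Equiv.swap_apply_of_ne_of_ne ((freePos_inj h).not.2 (Fin.castSucc_lt_last l).ne)
      (freePos_ne_sndPos h _ k)]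
  · refine Finset.prod_congr rfl fun j hj => ?_
    have hj := Finset.ne_of_mem_erase hj
    rw [Equiv.swap_apply_of_ne_of_ne (freePos_ne_fstPos h _ j).symm (fstPos_ne_sndPos h j k),
      Equiv.swap_apply_of_ne_of_ne (freePos_ne_sndPos h _ j).symm
        (by simpa [sndPos_inj] using hj)]

end GasDynamics
end

/-! ### Linearity of Hodge duals, evolution of the vorticity, and functions of state -/

noncomputable section

namespace GasDynamics

variable {n : ℕ}

open Function

section StarAlgebra

variable {q r : ℕ} (h : q + 2 * r = n)

theorem star_add_left (b c : (Fin q → Fin n) → ℝ) (A : Fin r → Fin n → Fin n → ℝ) :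
    star h (fun a => b a + c a) A = star h b A + star h c A := by
  simp only [star, ← alt_add]
  congr 1; ext s; simp only [tens]; ring

theorem star_const_mul_left (k : ℝ) (b : (Fin q → Fin n) → ℝ) (A : Fin r → Fin n → Fin n → ℝ) :
    star h (fun a => k * b a) A = k * star h b A := by
  simp only [star, ← alt_const_mul]
  congr 1; ext s; simp only [tens]; ring

theorem star_neg_left (b : (Fin q → Fin n) → ℝ) (A : Fin r → Fin n → Fin n → ℝ) :
    star h (fun a => -b a) A = -star h b A := by
  simpa using star_const_mul_left h (-1) b A

theorem star_sum_left {ι : Type*} (t : Finset ι) (b : ι → (Fin q → Fin n) → ℝ)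
    (A : Fin r → Fin n → Fin n → ℝ) :
    star h (fun a => ∑ i ∈ t, b i a) A = ∑ i ∈ t, star h (b i) A := by
  simp only [star, ← alt_sum]
  congr 1; ext s; simp only [tens, Finset.sum_mul]

theorem star_update_sum {ι : Type*} (t : Finset ι) (b : (Fin q → Fin n) → ℝ)
    (A : Fin r → Fin n → Fin n → ℝ) (k : Fin r) (X : ι → Fin n → Fin n → ℝ) :
    star h b (update A k fun i j => ∑ l ∈ t, X l i j) =
      ∑ l ∈ t, star h b (update A k (X l)) := by
  simp only [star, ← alt_sum]
  congr 1; ext s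
  simp only [tens_update, Finset.sum_mul]

theorem star_swap_left {c d : Fin q} (hcd : c ≠ d) (b : (Fin q → Fin n) → ℝ)
    (A : Fin r → Fin n → Fin n → ℝ) :
    star h (fun a => b (a ∘ Equiv.swap c d)) A = -star h b A := by
  rw [star, star, ← alt_comp_swap ((freePos_inj h).not.2 hcd)]
  congr 1; ext s
  simp only [tens, comp_apply]
  congr 1
  · have hl : ∀ l, Equiv.swap (freePos h c) (freePos h d) (freePos h l) =
        freePos h (Equiv.swap c d l) := by
      intro l
      simp only [Equiv.swap_apply_def, freePos_inj]
      split_ifs <;> rfl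
    simp only [hl]
    rfl
  · refine Finset.prod_congr rfl fun k _ => ?_
    rw [Equiv.swap_apply_of_ne_of_ne (freePos_ne_fstPos h c k).symm (freePos_ne_fstPos h d k).symm,
      Equiv.swap_apply_of_ne_of_ne (freePos_ne_sndPos h c k).symm (freePos_ne_sndPos h d k).symm]

theorem star_eq_zero_of_symm {c d : Fin q} (hcd : c ≠ d) {b : (Fin q → Fin n) → ℝ}
    (A : Fin r → Fin n → Fin n → ℝ) (hb : ∀ a, b (a ∘ Equiv.swap c d) = b a) :
    star h b A = 0 := by
  have h1 := star_swap_left h hcd b A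
  rw [show (fun a => b (a ∘ Equiv.swap c d)) = b from funext hb] at h1
  linarith

theorem sum_star_update' (hr : 1 ≤ r) (h' : (q + 2) + 2 * (r - 1) = n)
    (b : (Fin q → Fin n) → ℝ) (N X : Fin n → Fin n → ℝ) :
    ∑ k, star h b (update (fun _ => N) k X) =
      r * star h' (fun a => b (fun l => a (Fin.castAdd 2 l)) *
        X (a (Fin.natAdd q 0)) (a (Fin.natAdd q 1))) (fun _ => N) := by
  obtain ⟨r, rfl⟩ : ∃ k, r = k + 1 := ⟨r - 1, by omega⟩
  rw [sum_star_update h h']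
  push_cast
  rfl

theorem star_peel (hr : 1 ≤ r) (h' : (q + 2) + 2 * (r - 1) = n)
    (b : (Fin q → Fin n) → ℝ) (N : Fin n → Fin n → ℝ) :
    star h b (fun _ => N) =
      star h' (fun a => b (fun l => a (Fin.castAdd 2 l)) *
        N (a (Fin.natAdd q 0)) (a (Fin.natAdd q 1))) (fun _ => N) := by
  obtain ⟨r, rfl⟩ : ∃ k, r = k + 1 := ⟨r - 1, by omega⟩
  have h1 := star_update_zero h h' b N N
  rwa [update_eq_self_iff.2 rfl] at h1

end StarAlgebra

theorem star_two_swap {r : ℕ} (h : 2 + 2 * r = n) (f : Fin n → Fin n → ℝ)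
    (A : Fin r → Fin n → Fin n → ℝ) :
    star h (fun a => f (a 1) (a 0)) A = -star h (fun a => f (a 0) (a 1)) A := by
  rw [← star_swap_left h (c := 0) (d := 1) (by simp)]
  simp

theorem star_two_symm {r : ℕ} (h : 2 + 2 * r = n) {f : Fin n → Fin n → ℝ}
    (A : Fin r → Fin n → Fin n → ℝ) (hf : ∀ i j, f i j = f j i) :
    star h (fun a => f (a 0) (a 1)) A = 0 :=
  star_eq_zero_of_symm h (c := 0) (d := 1) (by simp) A fun a => by simp [hf (a 0) (a 1)]

/-! ### The evolution of the gas variables -/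

section Evolution

variable {I J : Set ℝ} {F : ℝ × ℝ → ℝ} {v : Field n}

theorem Admissible.thermo_mem (hv : Admissible I J v) (x : Space n) : thermo v x ∈ I ×ˢ J :=
  ⟨(hv.2 x).2, (hv.2 x).1⟩

theorem Admissible.dens_pos (hJ : ∀ r ∈ J, 0 < r) (hv : Admissible I J v) (x : Space n) :
    0 < dens v x := hJ _ (hv.2 x).1

theorem Admissible.contDiff_comp_thermo {S : ℝ × ℝ → ℝ} (hS : ContDiffOn ℝ ∞ S (I ×ˢ J))
    (hv : Admissible I J v) : ContDiff ℝ ∞ (fun y => S (thermo v y)) :=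
  hS.comp_contDiff (contDiff_thermo hv.1) hv.thermo_mem

theorem evolution_dens (hv : ContDiff ℝ ∞ v) (x : Space n) :
    (evolution F v x).1 =
      -(∑ j, vel v x j * pd j (dens v) x) - dens v x * ∑ i, ug v x i i := by
  have h1 : ∀ i, pd i (fun y => (dens v y • vel v y) i) x =
      dens v x * ug v x i i + vel v x i * pd i (dens v) x := fun i =>
    pd_mul ((contDiff_dens hv).differentiable (by simp) x)
      ((contDiff_vel_apply hv i).differentiable (by simp) x) i
  simp only [evolution, divergence, h1, Finset.sum_add_distrib, ← Finset.mul_sum]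
  ring

theorem evolution_pres (x : Space n) :
    (evolution F v x).2.1 =
      -(∑ j, vel v x j * pd j (pres v) x) - F (thermo v x) * ∑ i, ug v x i i := rfl

theorem evolution_vel (x : Space n) (i : Fin n) :
    (evolution F v x).2.2 i =
      -(∑ j, vel v x j * ug v x i j) - (dens v x)⁻¹ * pd i (pres v) x := rfl

theorem Admissible.contDiff_inv_dens (hJ : ∀ r ∈ J, 0 < r) (hv : Admissible I J v) :
    ContDiff ℝ ∞ (fun y => (dens v y)⁻¹) :=
  (contDiff_dens hv.1).inv fun x => (hv.dens_pos hJ x).ne'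

theorem Admissible.contDiff_evolution (hJ : ∀ r ∈ J, 0 < r) (hF : ContDiffOn ℝ ∞ F (I ×ˢ J))
    (hv : Admissible I J v) : ContDiff ℝ ∞ (evolution F v) := by
  have hu := contDiff_vel_apply hv.1
  refine ContDiff.prodMk ?_ (ContDiff.prodMk ?_ ?_)
  · refine (ContDiff.sum fun i _ => contDiff_pd ?_ i).neg
    exact (contDiff_dens hv.1).mul (hu i)
  · exact ((ContDiff.sum fun i _ => (hu i).mul (contDiff_pd (contDiff_pres hv.1) i)).neg).sub
      ((hv.contDiff_comp_thermo hF).mul (ContDiff.sum fun i _ => contDiff_pd (hu i) i))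
  · rw [contDiff_euclidean]
    intro i
    exact ((ContDiff.sum fun j _ => (hu j).mul (contDiff_pd (hu i) j)).neg).sub
      ((hv.contDiff_inv_dens hJ).mul (contDiff_pd (contDiff_pres hv.1) i))

theorem ug_add_smul {w : Field n} (hv : ContDiff ℝ ∞ v) (hw : ContDiff ℝ ∞ w) (ε : ℝ)
    (x : Space n) (i j : Fin n) :
    ug (fun y => v y + ε • w y) x i j = ug v x i j + ε * ug w x i j := by
  have h1 := (contDiff_vel_apply hv i).differentiable (by simp) x
  have h2 := (contDiff_vel_apply hw i).differentiable (by simp) x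
  change pd j (fun y => vel v y i + ε * vel w y i) x = _
  rw [pd_add h1 (h2.const_mul ε), pd_const_mul h2]
  rfl

/-- Gradient of the momentum equation. Differentiating the convective term gives −N² and the
transport of N; differentiating `ρ⁻¹ ∇p` gives a Hessian, which antisymmetrization will remove, and
the baroclinic product, which survives. -/
theorem ug_evolution (hJ : ∀ r ∈ J, 0 < r) (hv : Admissible I J v) (x : Space n) (i j : Fin n) :
    ug (evolution F v) x i j =
      -(∑ l, ug v x i l * ug v x l j) - ∑ l, vel v x l * pd l (fun y => ug v y i j) x
        - (dens v x)⁻¹ * pd j (pd i (pres v)) x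
        + (dens v x)⁻¹ ^ 2 * (pd i (pres v) x * pd j (dens v) x) := by
  have hu := fun l => (contDiff_vel_apply hv.1 l).differentiable (by simp) x
  have hug := fun l => (contDiff_ug hv.1 i l).differentiable (by simp) x
  have hp := (contDiff_pd (contDiff_pres hv.1) i).differentiable (by simp) x
  have hr := (hv.contDiff_inv_dens hJ).differentiable (by simp) x
  have hr' := (contDiff_dens hv.1).differentiable (by simp) x
  change pd j (fun y => -(∑ l, vel v y l * ug v y i l) - (dens v y)⁻¹ * pd i (pres v) y) x = _
  rw [pd_sub (DifferentiableAt.fun_neg (DifferentiableAt.fun_sum fun l _ => (hu l).fun_mul (hug l)))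
    (hr.fun_mul hp), pd_neg, pd_sum _ (fun l _ => (hu l).fun_mul (hug l)), pd_mul hr hp,
    pd_inv hr' (hv.dens_pos hJ x).ne']
  have e : ∀ l, pd j (fun y => vel v y l * ug v y i l) x =
      ug v x i l * ug v x l j + vel v x l * pd l (fun y => ug v y i j) x := fun l => by
    rw [pd_mul (hu l) (hug l), pd_ug_symm hv.1]
    simp only [ug]; ring
  simp only [e, Finset.sum_add_distrib]
  ring

theorem sum_pd_mul_vel (hv : ContDiff ℝ ∞ v) {f : Space n → ℝ} (hf : ContDiff ℝ ∞ f)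
    (x : Space n) :
    ∑ j, pd j (fun y => f y * vel v y j) x =
      ∑ j, vel v x j * pd j f x + (∑ j, ug v x j j) * f x := by
  rw [Finset.sum_mul, ← Finset.sum_add_distrib]
  refine Finset.sum_congr rfl fun j _ => ?_
  rw [pd_mul (hf.differentiable (by simp) x) ((contDiff_vel_apply hv j).differentiable (by simp) x)]
  simp only [ug]; ring

/-- The evolution of `∗(b ∧ ω^r)`. -/
theorem hasDerivAt_star_evolution (hJ : ∀ r ∈ J, 0 < r) (hF : ContDiffOn ℝ ∞ F (I ×ˢ J))
    (hv : Admissible I J v) {q r : ℕ} (h : q + 2 * r = n) (x : Space n)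
    {B : ℝ → (Fin q → Fin n) → ℝ} {β : Space n → (Fin q → Fin n) → ℝ}
    {β' : (Fin q → Fin n) → ℝ} (hB0 : B 0 = β x) (hB : ∀ a, HasDerivAt (fun ε => B ε a) (β' a) 0)
    (hβ : ∀ a, ContDiff ℝ ∞ (fun y => β y a)) :
    HasDerivAt (fun ε : ℝ => star h (B ε) (fun _ => ug (fun y => v y + ε • evolution F v y) x))
      (star h (fun a => β' a + ∑ j, vel v x j * pd j (fun y => β y a) x +
          ∑ c, ∑ l, ug v x l (a c) * β x (update a c l)) (fun _ => ug v x) +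
        ∑ k, star h (β x) (update (fun _ => ug v x) k fun i j =>
          (dens v x)⁻¹ ^ 2 * (pd i (pres v) x * pd j (dens v) x)) -
        ∑ j, pd j (fun y => star h (β y) (fun _ => ug v y) * vel v y j) x) 0 := by
  have hA : ∀ i j, HasDerivAt (fun ε : ℝ => ug (fun y => v y + ε • evolution F v y) x i j)
      (ug (evolution F v) x i j) 0 := by
    intro i j
    simp only [ug_add_smul hv.1 (hv.contDiff_evolution hJ hF)]
    simpa using ((hasDerivAt_id (0 : ℝ)).mul_const (ug (evolution F v) x i j)).const_add
      (ug v x i j)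
  refine (hasDerivAt_star h hB hA).congr_deriv ?_
  have h0 : ug (fun y => v y + (0 : ℝ) • evolution F v y) x = ug v x := by simp
  -- The divergence of the convective flux is transport plus trace N times the dual. By
  -- `trace_mul_star` this trace term supplies exactly the N² terms of the evolution of N, and the
  -- action of N on the free indices.
  rw [sum_pd_mul_vel hv.1 (contDiff_star h hβ fun _ => contDiff_ug hv.1), trace_mul_star, hB0]
  simp only [h0, pd_star h hβ (contDiff_ug hv.1)]
  have h1 : ∀ k, star h (β x) (update (fun _ => ug v x) k (ug (evolution F v) x)) =
      -star h (β x) (update (fun _ => ug v x) k fun i j => ∑ l, ug v x i l * ug v x l j)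
      - (∑ l, vel v x l * star h (β x) (update (fun _ => ug v x) k
          fun i j => pd l (fun y => ug v y i j) x))
      + star h (β x) (update (fun _ => ug v x) k fun i j =>
          (dens v x)⁻¹ ^ 2 * (pd i (pres v) x * pd j (dens v) x)) := by
    intro k
    have e1 : ug (evolution F v) x = fun i j =>
        (fun i j => (fun i j => -1 * (fun i j => ∑ l, ug v x i l * ug v x l j) i j) i j +
        (fun i j => -1 * (fun i j => ∑ l, (fun l i j => vel v x l *
          (fun i j => pd l (fun y => ug v y i j) x) i j) l i j) i j) i j) i j +
        (fun i j => (fun i j => -(dens v x)⁻¹ * (fun i j => pd j (pd i (pres v)) x) i j) i j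
        + (fun i j => (dens v x)⁻¹ ^ 2 * (pd i (pres v) x * pd j (dens v) x)) i j) i j := by
      ext i j
      rw [ug_evolution hJ hv]; ring
    -- The pressure Hessian is symmetric, so it does not enter the dual.
    have e2 : star h (β x) (update (fun _ => ug v x) k fun i j => pd j (pd i (pres v)) x) = 0 :=
      star_update_eq_zero_of_symm h _ _ k fun i j => pd_pd_comm (contDiff_pres hv.1) _ _ _
    have e3 : star h (β x) (update (fun _ => ug v x) k fun i j =>
        ∑ l, vel v x l * pd l (fun y => ug v y i j) x) =
        ∑ l, vel v x l * star h (β x) (update (fun _ => ug v x) k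
          fun i j => pd l (fun y => ug v y i j) x) := by
      rw [star_update_sum]
      simp only [star_update_const_mul]
    rw [e1, star_update_add, star_update_add, star_update_const_mul, star_update_const_mul,
      star_update_add, star_update_const_mul, e2, e3]
    ring
  have h2 : star h (fun a => β' a + ∑ j, vel v x j * pd j (fun y => β y a) x +
      ∑ c, ∑ l, ug v x l (a c) * β x (update a c l)) (fun _ => ug v x) =
      star h β' (fun _ => ug v x) +
      ∑ j, vel v x j * star h (fun a => pd j (fun y => β y a) x) (fun _ => ug v x) +
      star h (fun a => ∑ c, ∑ l, ug v x l (a c) * β x (update a c l)) (fun _ => ug v x) := by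
    rw [star_add_left, star_add_left, star_sum_left]
    simp only [star_const_mul_left]
  rw [h2, Finset.sum_congr rfl fun k _ => h1 k]
  simp only [mul_add, Finset.sum_add_distrib, Finset.sum_sub_distrib, Finset.sum_neg_distrib,
    Finset.mul_sum]
  rw [Finset.sum_comm (γ := Fin r) (α := Fin n)]
  ring

end Evolution

/-! ### Functions of state -/

section StateFunctions

variable {I J : Set ℝ} {F S : ℝ × ℝ → ℝ} {v : Field n}

theorem fderiv_apply_eq {z : ℝ × ℝ} (hS : DifferentiableAt ℝ S z) (a b : ℝ) :
    fderiv ℝ S z (a, b) = a * derivP S z + b * derivRho S z := by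
  have h1 : derivP S z = fderiv ℝ S z (1, 0) := by
    have h2 : HasDerivAt (fun q : ℝ => (q, z.2)) (1, 0) z.1 :=
      (hasDerivAt_id _).prodMk (hasDerivAt_const _ _)
    exact (HasFDerivAt.comp_hasDerivAt z.1 hS.hasFDerivAt h2).deriv
  have h2 : derivRho S z = fderiv ℝ S z (0, 1) := by
    have h2 : HasDerivAt (fun q : ℝ => (z.1, q)) (0, 1) z.2 :=
      (hasDerivAt_const _ _).prodMk (hasDerivAt_id _)
    exact (HasFDerivAt.comp_hasDerivAt z.2 hS.hasFDerivAt h2).deriv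
  rw [h1, h2, ← smul_eq_mul, ← smul_eq_mul, ← map_smul, ← map_smul, ← map_add]
  simp

variable (hI : IsOpen I) (hJ' : IsOpen J) (hS : ContDiffOn ℝ ∞ S (I ×ˢ J))
include hI hJ' hS

theorem contDiffAt_of_mem {z : ℝ × ℝ} (hz : z ∈ I ×ˢ J) : ContDiffAt ℝ ∞ S z :=
  hS.contDiffAt ((hI.prod hJ').mem_nhds hz)

theorem differentiableAt_of_mem {z : ℝ × ℝ} (hz : z ∈ I ×ˢ J) : DifferentiableAt ℝ S z :=
  (contDiffAt_of_mem hI hJ' hS hz).differentiableAt (by simp)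

theorem pd_comp_thermo (hv : Admissible I J v) (x : Space n) (i : Fin n) :
    pd i (fun y => S (thermo v y)) x =
      derivP S (thermo v x) * pd i (pres v) x + derivRho S (thermo v x) * pd i (dens v) x := by
  have hS' := differentiableAt_of_mem hI hJ' hS (hv.thermo_mem x)
  refine pd_eq_of_hasDerivAt ((hv.contDiff_comp_thermo hS).differentiable (by simp) x) ?_
  have h1 := (hasDerivAt_line ((contDiff_pres hv.1).differentiable (by simp) x) i).prodMk
    (hasDerivAt_line ((contDiff_dens hv.1).differentiable (by simp) x) i)
  have h2 := HasFDerivAt.comp_hasDerivAt_of_eq (0 : ℝ) hS'.hasFDerivAt h1 (by simp [thermo])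
  refine h2.congr_deriv ?_
  rw [fderiv_apply_eq hS']; ring

theorem hasDerivAt_comp_thermo (hv : Admissible I J v) (x : Space n) (w : Field n) :
    HasDerivAt (fun ε : ℝ => S (thermo (fun y => v y + ε • w y) x))
      (derivP S (thermo v x) * (w x).2.1 + derivRho S (thermo v x) * (w x).1) 0 := by
  have hS' := differentiableAt_of_mem hI hJ' hS (hv.thermo_mem x)
  have h1 : HasDerivAt (fun ε : ℝ => (pres v x + ε * (w x).2.1, dens v x + ε * (w x).1))
      ((w x).2.1, (w x).1) 0 := by
    refine HasDerivAt.prodMk ?_ ?_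
    · simpa using ((hasDerivAt_id (0 : ℝ)).mul_const (w x).2.1).const_add (pres v x)
    · simpa using ((hasDerivAt_id (0 : ℝ)).mul_const (w x).1).const_add (dens v x)
  have h2 := HasFDerivAt.comp_hasDerivAt_of_eq (0 : ℝ) hS'.hasFDerivAt h1 (by simp [thermo])
  refine h2.congr_deriv ?_
  rw [fderiv_apply_eq hS']; ring

end StateFunctions

section Entropy

variable {I J : Set ℝ} {F S e : ℝ × ℝ → ℝ} {v : Field n} (hI : IsOpen I) (hJ' : IsOpen J)
  (hJ : ∀ r ∈ J, 0 < r)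
include hI hJ' hJ

theorem pd_entropy (hS : IsEntropy F I J S) (hv : Admissible I J v) (x : Space n) (i : Fin n) :
    pd i (fun y => S (thermo v y)) x =
      derivP S (thermo v x) *
        (pd i (pres v) x - (dens v x)⁻¹ * F (thermo v x) * pd i (dens v) x) := by
  rw [pd_comp_thermo hI hJ' hS.1 hv]
  have h1 := hS.2 _ (hv.thermo_mem x)
  have h2 := (hv.dens_pos hJ x).ne'
  change dens v x * _ + _ = 0 at h1
  field_simp
  linear_combination pd i (dens v) x * h1

omit hJ in
-- The coefficient of ∇·u in the evolution of S is `-(ρ S_ρ + F S_p)`, which vanishes; only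
-- advection is left.
theorem hasDerivAt_entropy (hS : IsEntropy F I J S) (hv : Admissible I J v) (x : Space n) :
    HasDerivAt (fun ε : ℝ => S (thermo (fun y => v y + ε • evolution F v y) x))
      (-∑ j, vel v x j * pd j (fun y => S (thermo v y)) x) 0 := by
  refine (hasDerivAt_comp_thermo hI hJ' hS.1 hv x _).congr_deriv ?_
  have h1 := hS.2 _ (hv.thermo_mem x)
  change dens v x * _ + _ = 0 at h1
  rw [evolution_dens hv.1, evolution_pres]
  have h2 : ∑ j, vel v x j * pd j (fun y => S (thermo v y)) x =
      derivP S (thermo v x) * ∑ j, vel v x j * pd j (pres v) x +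
      derivRho S (thermo v x) * ∑ j, vel v x j * pd j (dens v) x := by
    rw [Finset.mul_sum, Finset.mul_sum, ← Finset.sum_add_distrib]
    refine Finset.sum_congr rfl fun j _ => ?_
    rw [pd_comp_thermo hI hJ' hS.1 hv]; ring
  rw [h2]
  linear_combination (-∑ i, ug v x i i) * h1

/-- The Gibbs relation e_S ∇S = ∇(e + p/ρ) − ρ⁻¹ ∇p: the energy equation eliminates e_ρ. It exhibits
the vector as a gradient up to the pressure term, which makes its antisymmetrized derivative
computable. -/
theorem energyEntropyGrad_eq (he : IsEnergy F I J e) (hv : Admissible I J v) (x : Space n)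
    (i : Fin n) :
    energyEntropyGrad F e v x i =
      pd i (fun y => e (thermo v y) + pres v y * (dens v y)⁻¹) x -
        (dens v x)⁻¹ * pd i (pres v) x := by
  have hp := (contDiff_pres hv.1).differentiable (by simp) x
  have hr := (contDiff_dens hv.1).differentiable (by simp) x
  have h2 := (hv.dens_pos hJ x).ne'
  have h1 := he.2 _ (hv.thermo_mem x)
  change dens v x * _ + _ = pres v x / dens v x at h1
  rw [pd_add ((hv.contDiff_comp_thermo he.1).differentiable (by simp) x)
    (hp.fun_mul ((hv.contDiff_inv_dens hJ).differentiable (by simp) x)),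
    pd_mul hp ((hv.contDiff_inv_dens hJ).differentiable (by simp) x), pd_inv hr h2,
    pd_comp_thermo hI hJ' he.1 hv, energyEntropyGrad]
  field_simp at h1 ⊢
  linear_combination -pd i (dens v) x * h1

end Entropy

end GasDynamics
end

noncomputable section

namespace GasDynamics

variable {n : ℕ}

open Function

theorem star_zero_left {q r : ℕ} (h : q + 2 * r = n) {b : (Fin q → Fin n) → ℝ}
    (hb : ∀ a, b a = 0) (A : Fin r → Fin n → Fin n → ℝ) : star h b A = 0 := by
  have := star_const_mul_left h 0 b A
  rw [show b = fun a => 0 * b a from funext fun a => by rw [hb, zero_mul], this, zero_mul]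

theorem divergence_toLp (f : Fin n → Space n → ℝ) (x : Space n) :
    divergence (fun y => WithLp.toLp 2 fun i => f i y) x = ∑ i, pd i (f i) x := rfl

/-! ### Even dimensions -/

section Even

variable {m : ℕ}

theorem vortScalar_eq (h : n = 2 * m) (v : Field n) (x : Space n) :
    vortScalar h v x = star (q := 0) (r := m) (by omega) (fun _ => 1) (fun _ => ug v x) := by
  rw [vortScalar, starPow_curl]
  congr 1

theorem entropyVorticity_eq (h : n = 2 * m) (S : ℝ × ℝ → ℝ) (v : Field n) (x : Space n) :
    entropyVorticity h S v x =
      star (q := 0) (r := m) (by omega) (fun _ => S (thermo v x)) (fun _ => ug v x) := by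
  rw [entropyVorticity, vortScalar_eq, ← star_const_mul_left]
  simp

variable (hm : 1 ≤ m) (h : n = 2 * m)

theorem vortTensor_eq (v : Field n) (x : Space n) (i j : Fin n) :
    vortTensor hm h v x i j = star (q := 2) (r := m - 1) (by omega)
      (fun a => (if a 0 = i then 1 else 0) * if a 1 = j then 1 else 0) (fun _ => ug v x) := by
  rw [vortTensor, starPow_curl]
  congr 1; ext c
  have : c = ![i, j] ↔ c 0 = i ∧ c 1 = j := by
    rw [funext_iff, Fin.forall_fin_two]; simp
  by_cases h0 : c 0 = i <;> by_cases h1 : c 1 = j <;> simp [this, h0, h1]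

theorem sum_vortTensor (v : Field n) (x : Space n) (f : Fin n → Fin n → ℝ) :
    ∑ i, ∑ j, vortTensor hm h v x i j * f i j =
      star (q := 2) (r := m - 1) (by omega) (fun a => f (a 0) (a 1)) (fun _ => ug v x) := by
  simp only [vortTensor_eq, mul_comm _ (f _ _), ← star_const_mul_left, ← star_sum_left]
  congr 1; ext a
  simp

/-- The minus sign comes from exchanging the two free indices. It puts the index `i`, along which a
divergence will be taken, into the last slot, as `sum_pd_star` requires. -/
theorem sum_vortTensor_right (v : Field n) (x : Space n) (i : Fin n) (g : Fin n → ℝ) :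
    ∑ j, vortTensor hm h v x i j * g j =
      -star (q := 2) (r := m - 1) (by omega) (fun a => g (a 0) * if a 1 = i then 1 else 0)
        (fun _ => ug v x) := by
  have h2 : 2 + 2 * (m - 1) = n := by omega
  rw [← star_two_swap h2 (fun i' j' => g i' * if j' = i then 1 else 0)]
  simp only [vortTensor_eq, mul_comm _ (g _), ← star_const_mul_left, ← star_sum_left]
  congr 1; ext a
  simp

theorem circulatoryEntropy_eq (S : ℝ × ℝ → ℝ) (v : Field n) (x : Space n) :
    circulatoryEntropy hm h S v x = star (q := 2) (r := m - 1) (by omega)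
      (fun a => vel v x (a 0) * pd (a 1) (fun y => S (thermo v y)) x) (fun _ => ug v x) := by
  simp only [circulatoryEntropy, mul_assoc]
  exact sum_vortTensor hm h v x _

variable {I J : Set ℝ} {F S e : ℝ × ℝ → ℝ} (hI : IsOpen I) (hJ' : IsOpen J)
  (hJ : ∀ r ∈ J, 0 < r) {v : Field n}

omit hm in
theorem contDiff_entropyVorticity (hS : ContDiffOn ℝ ∞ S (I ×ˢ J)) (hv : Admissible I J v) :
    ContDiff ℝ ∞ (entropyVorticity h S v) := by
  rw [show entropyVorticity h S v = _ from funext fun x => entropyVorticity_eq h S v x]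
  exact contDiff_star _ (fun _ => hv.contDiff_comp_thermo hS) fun _ => contDiff_ug hv.1

/-- The divergence of the field `w_ij f g_j`. -/
theorem sum_pd_vortTensor (hv : ContDiff ℝ ∞ v) {g : Fin n → Space n → ℝ}
    (hg : ∀ i, ContDiff ℝ ∞ (g i)) (x : Space n) :
    ∑ i, pd i (fun y => ∑ j, vortTensor hm h v y i j * g j y) x =
      -star (q := 2) (r := m - 1) (by omega) (fun a => pd (a 1) (g (a 0)) x)
        (fun _ => ug v x) := by
  simp only [sum_vortTensor_right, pd_neg, Finset.sum_neg_distrib]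
  congr 1
  exact sum_pd_star (q := 1) (by omega) hv (b := fun y a => g (a 0) y) (fun a => hg _) x

include hI hJ' hJ in
-- Here the free tensor has rank zero and is the scalar S. Its advection cancels against the
-- transport term, so only the baroclinic source multiplied by S is left besides the convective
-- flux.
theorem hasDerivAt_entropyVorticity (hF : ContDiffOn ℝ ∞ F (I ×ˢ J)) (hS : IsEntropy F I J S)
    (hv : Admissible I J v) (x : Space n) :
    HasDerivAt (fun ε : ℝ => entropyVorticity h S (fun y => v y + ε • evolution F v y) x)
      (m * star (q := 2) (r := m - 1) (by omega) (fun a => S (thermo v x) *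
          ((dens v x)⁻¹ ^ 2 * (pd (a 0) (pres v) x * pd (a 1) (dens v) x))) (fun _ => ug v x) -
        ∑ j, pd j (fun y => entropyVorticity h S v y * vel v y j) x) 0 := by
  have h0 : 0 + 2 * m = n := by omega
  have h1 := hasDerivAt_star_evolution hJ hF hv h0 x
    (B := fun ε _ => S (thermo (fun y => v y + ε • evolution F v y) x))
    (β := fun y _ => S (thermo v y)) (by simp)
    (fun _ => hasDerivAt_entropy hI hJ' hS hv x) (fun _ => hv.contDiff_comp_thermo hS.1)
  simp only [← entropyVorticity_eq h] at h1
  refine h1.congr_deriv ?_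
  rw [star_zero_left, sum_star_update' h0 hm (by omega), zero_add]
  · rfl
  · intro a
    simp

include hI hJ' hJ in
-- Modulo symmetric tensors, ∂_j(S e_S ∂_i S) is S ρ⁻² ∂_i p ∂_j ρ. The Gibbs relation contributes
-- symmetric Hessians and this baroclinic term, while ∇S and e_S ∇S are parallel, so that the
-- derivative of the factor S yields a symmetric product.
theorem continuityEquation_entropyVorticity (hF : ContDiffOn ℝ ∞ F (I ×ˢ J))
    (hS : IsEntropy F I J S) (he : IsEnergy F I J e) :
    ContinuityEquation F I J (entropyVorticity h S) (entropyVorticityFlux hm h F S e) := by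
  intro v hv x
  have hSv := hv.contDiff_comp_thermo hS.1
  have hHv : ContDiff ℝ ∞ (fun y => e (thermo v y) + pres v y * (dens v y)⁻¹) :=
    (hv.contDiff_comp_thermo he.1).add ((contDiff_pres hv.1).mul (hv.contDiff_inv_dens hJ))
  have hp := contDiff_pres hv.1
  have hri := hv.contDiff_inv_dens hJ
  have hg : ∀ i, ContDiff ℝ ∞ (fun y => energyEntropyGrad F e v y i) := by
    intro i
    simp only [energyEntropyGrad_eq hI hJ' hJ he hv]
    exact (contDiff_pd hHv i).sub (hri.mul (contDiff_pd hp i))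
  have hSg : ∀ i, ContDiff ℝ ∞ (fun y => S (thermo v y) * energyEntropyGrad F e v y i) :=
    fun i => hSv.mul (hg i)
  have e1 : divergence (entropyVorticityFlux hm h F S e v) x =
      ∑ j, pd j (fun y => entropyVorticity h S v y * vel v y j) x +
      m * ∑ i, pd i (fun y => ∑ j, vortTensor hm h v y i j *
        (S (thermo v y) * energyEntropyGrad F e v y j)) x := by
    unfold entropyVorticityFlux
    rw [divergence_toLp, Finset.mul_sum, ← Finset.sum_add_distrib]
    refine Finset.sum_congr rfl fun i _ => ?_
    have hw : ContDiff ℝ ∞ (fun y => ∑ j, vortTensor hm h v y i j *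
        (S (thermo v y) * energyEntropyGrad F e v y j)) := by
      simp only [sum_vortTensor_right]
      exact (contDiff_star _ (fun a => (hSg _).mul contDiff_const)
        fun _ => contDiff_ug hv.1).neg
    rw [← pd_const_mul (hw.differentiable (by simp) x), ← pd_add]
    · congr 1; ext y
      simp only [Finset.mul_sum]
      congr 1
      exact Finset.sum_congr rfl fun j _ => by ring
    · exact ((contDiff_entropyVorticity h hS.1 hv).mul
        (contDiff_vel_apply hv.1 i)).differentiable (by simp) x
    · exact (hw.differentiable (by simp) x).const_mul _
  rw [timeDeriv, (hasDerivAt_entropyVorticity hm h hI hJ' hJ hF hS hv x).deriv, e1,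
    sum_pd_vortTensor hm h hv.1 hSg]
  have h2 : 2 + 2 * (m - 1) = n := by omega
  have e2 : ∀ i j, pd j (fun y => S (thermo v y) * energyEntropyGrad F e v y i) x =
      S (thermo v x) * ((dens v x)⁻¹ ^ 2 * (pd i (pres v) x * pd j (dens v) x)) +
      (S (thermo v x) * (pd j (pd i fun y => e (thermo v y) + pres v y * (dens v y)⁻¹) x -
        (dens v x)⁻¹ * pd j (pd i (pres v)) x) +
      derivP S (thermo v x) * derivP e (thermo v x) *
        ((pd i (pres v) x - (dens v x)⁻¹ * F (thermo v x) * pd i (dens v) x) *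
        (pd j (pres v) x - (dens v x)⁻¹ * F (thermo v x) * pd j (dens v) x))) := by
    intro i j
    have h3 := (contDiff_pd hp i).differentiable (by simp) x
    have h4 := hri.differentiable (by simp) x
    rw [pd_mul (hSv.differentiable (by simp) x) ((hg i).differentiable (by simp) x),
      pd_entropy hI hJ' hJ hS hv, show (fun y => energyEntropyGrad F e v y i) = _ from
      funext fun y => energyEntropyGrad_eq hI hJ' hJ he hv y i,
      pd_sub ((contDiff_pd hHv i).differentiable (by simp) x) (h4.fun_mul h3), pd_mul h4 h3,
      pd_inv ((contDiff_dens hv.1).differentiable (by simp) x) (hv.dens_pos hJ x).ne',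
      energyEntropyGrad]
    ring
  simp only [e2]
  rw [star_add_left h2, star_two_symm h2
    (f := fun i j => S (thermo v x) * (pd j (pd i fun y => e (thermo v y) +
        pres v y * (dens v y)⁻¹) x - (dens v x)⁻¹ * pd j (pd i (pres v)) x) +
      derivP S (thermo v x) * derivP e (thermo v x) *
        ((pd i (pres v) x - (dens v x)⁻¹ * F (thermo v x) * pd i (dens v) x) *
        (pd j (pres v) x - (dens v x)⁻¹ * F (thermo v x) * pd j (dens v) x)))]
  · ring
  · intro i j
    rw [pd_pd_comm hHv i j, pd_pd_comm hp i j]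
    ring

include hI hJ' hJ in
-- Since S is advected, ∇S is transported as a one-form and its stretching cancels against the
-- action of N on the second free index. Transport of `u` also cancels, leaving the action of N on
-- the first free index, which is ½∇|u|², and the pressure force.
theorem hasDerivAt_circulatoryEntropy (hF : ContDiffOn ℝ ∞ F (I ×ˢ J)) (hS : IsEntropy F I J S)
    (hv : Admissible I J v) (x : Space n) :
    HasDerivAt (fun ε : ℝ => circulatoryEntropy hm h S (fun y => v y + ε • evolution F v y) x)
      (star (q := 2) (r := m - 1) (by omega)
        (fun a => (∑ l, ug v x l (a 0) * vel v x l - (dens v x)⁻¹ * pd (a 0) (pres v) x) *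
          pd (a 1) (fun y => S (thermo v y)) x) (fun _ => ug v x) -
        ∑ j, pd j (fun y => circulatoryEntropy hm h S v y * vel v y j) x) 0 := by
  have h2 : 2 + 2 * (m - 1) = n := by omega
  have hSv := hv.contDiff_comp_thermo hS.1
  have hev := hv.contDiff_evolution hJ hF
  -- Joint smoothness in the parameter and the position is needed to interchange the time derivative
  -- with the derivative in ∇S; the perturbed state need only stay in the domain near the base
  -- point.
  have hΨ : ContDiffAt ℝ ∞ (fun z : ℝ × Space n =>
      S (thermo (fun y => v y + z.1 • evolution F v y) z.2)) (0, x) := by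
    have h3 : ContDiffAt ℝ ∞ (fun z : ℝ × Space n =>
        v z.2 + z.1 • evolution F v z.2) (0, x) :=
      ((hv.1.comp contDiff_snd).add
        (contDiff_fst.smul (hev.comp contDiff_snd))).contDiffAt
    have h4 : ContDiffAt ℝ ∞ (fun z : ℝ × Space n =>
        thermo (fun y => v y + z.1 • evolution F v y) z.2) (0, x) := h3.snd.fst.prodMk h3.fst
    refine ContDiffAt.comp ((0 : ℝ), x) (g := S) ?_ h4
    simpa using contDiffAt_of_mem hI hJ' hS.1 (hv.thermo_mem x)
  have hSj : ∀ j, HasDerivAt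
      (fun ε : ℝ => pd j (fun y => S (thermo (fun y => v y + ε • evolution F v y) y)) x)
      (pd j (fun y => -∑ j, vel v y j * pd j (fun y => S (thermo v y)) y) x) 0 := fun j =>
    hasDerivAt_pd hΨ (fun y => hasDerivAt_entropy hI hJ' hS hv y) j
  have hu : ∀ i, HasDerivAt (fun ε : ℝ => vel (fun y => v y + ε • evolution F v y) x i)
      ((evolution F v x).2.2 i) 0 := fun i => by
    change HasDerivAt (fun ε : ℝ => vel v x i + ε * (evolution F v x).2.2 i) _ 0
    simpa using ((hasDerivAt_id (0 : ℝ)).mul_const ((evolution F v x).2.2 i)).const_add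
      (vel v x i)
  have h1 := hasDerivAt_star_evolution hJ hF hv h2 x
    (B := fun ε a => vel (fun y => v y + ε • evolution F v y) x (a 0) *
      pd (a 1) (fun y => S (thermo (fun y => v y + ε • evolution F v y) y)) x)
    (β := fun y a => vel v y (a 0) * pd (a 1) (fun y => S (thermo v y)) y) (by simp)
    (fun a => (hu (a 0)).mul (hSj (a 1)))
    (fun a => (contDiff_vel_apply hv.1 _).mul (contDiff_pd hSv _))
  simp only [← circulatoryEntropy_eq hm h] at h1
  refine h1.congr_deriv ?_
  congr 1
  -- By the entropy equation ∇S is a combination of ∇p and ∇ρ, so ∇S ∧ ∇p ∧ ∇ρ = 0: the term with ∇p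
  -- is symmetric in the first index of the two-form, the term with ∇ρ in the second.
  have hforce : ∀ k, star h2 (fun a => vel v x (a 0) * pd (a 1) (fun y => S (thermo v y)) x)
      (update (fun _ => ug v x) k fun i j =>
        (dens v x)⁻¹ ^ 2 * (pd i (pres v) x * pd j (dens v) x)) = 0 := by
    intro k
    have key : ∀ s, tens h2 (fun a => vel v x (a 0) * pd (a 1) (fun y => S (thermo v y)) x)
        (update (fun _ => ug v x) k fun i j =>
          (dens v x)⁻¹ ^ 2 * (pd i (pres v) x * pd j (dens v) x)) s =
        derivP S (thermo v x) * tens h2 (fun a => vel v x (a 0) * pd (a 1) (pres v) x)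
        (update (fun _ => ug v x) k fun i j =>
          (dens v x)⁻¹ ^ 2 * (pd i (pres v) x * pd j (dens v) x)) s +
        (-derivP S (thermo v x) * ((dens v x)⁻¹ * F (thermo v x))) *
        tens h2 (fun a => vel v x (a 0) * pd (a 1) (dens v) x)
        (update (fun _ => ug v x) k fun i j =>
          (dens v x)⁻¹ ^ 2 * (pd i (pres v) x * pd j (dens v) x)) s := by
      intro s
      simp only [tens_update, pd_entropy hI hJ' hJ hS hv]
      ring
    have hne : freePos h2 0 ≠ freePos h2 1 := (freePos_inj h2).not.2 (by simp)
    rw [star, show tens h2 _ _ = _ from funext key, alt_add, alt_const_mul, alt_const_mul,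
      alt_eq_zero_of_symm (freePos_ne_fstPos h2 1 k), alt_eq_zero_of_symm
      (freePos_ne_sndPos h2 1 k)]
    · ring
    · intro s
      simp only [tens_update, comp_apply, Equiv.swap_apply_right, Equiv.swap_apply_left]
      rw [Equiv.swap_apply_of_ne_of_ne hne (freePos_ne_sndPos h2 0 k),
        Equiv.swap_apply_of_ne_of_ne (freePos_ne_fstPos h2 1 k).symm (fstPos_ne_sndPos h2 k k)]
      have e : ∀ j ∈ Finset.univ.erase k,
          ug v x ((s ∘ Equiv.swap (freePos h2 1) (sndPos h2 k)) (fstPos h2 j))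
            ((s ∘ Equiv.swap (freePos h2 1) (sndPos h2 k)) (sndPos h2 j)) =
          ug v x (s (fstPos h2 j)) (s (sndPos h2 j)) := by
        intro j hj
        have hj := Finset.ne_of_mem_erase hj
        simp only [comp_apply]
        rw [Equiv.swap_apply_of_ne_of_ne (freePos_ne_fstPos h2 1 j).symm
          (fstPos_ne_sndPos h2 j k), Equiv.swap_apply_of_ne_of_ne
          (freePos_ne_sndPos h2 1 j).symm (by simpa [sndPos_inj] using hj)]
      have e' := Finset.prod_congr rfl e
      simp only [comp_apply] at e'
      rw [e']
      ring
    · intro s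
      simp only [tens_update, comp_apply, Equiv.swap_apply_right, Equiv.swap_apply_left]
      rw [Equiv.swap_apply_of_ne_of_ne hne (freePos_ne_fstPos h2 0 k),
        Equiv.swap_apply_of_ne_of_ne (freePos_ne_sndPos h2 1 k).symm
          (fstPos_ne_sndPos h2 k k).symm]
      have e : ∀ j ∈ Finset.univ.erase k,
          ug v x ((s ∘ Equiv.swap (freePos h2 1) (fstPos h2 k)) (fstPos h2 j))
            ((s ∘ Equiv.swap (freePos h2 1) (fstPos h2 k)) (sndPos h2 j)) =
          ug v x (s (fstPos h2 j)) (s (sndPos h2 j)) := by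
        intro j hj
        have hj := Finset.ne_of_mem_erase hj
        simp only [comp_apply]
        rw [Equiv.swap_apply_of_ne_of_ne (freePos_ne_fstPos h2 1 j).symm
          (by simpa [fstPos_inj] using hj), Equiv.swap_apply_of_ne_of_ne
          (freePos_ne_sndPos h2 1 j).symm (fstPos_ne_sndPos h2 k j).symm]
      have e' := Finset.prod_congr rfl e
      simp only [comp_apply] at e'
      rw [e']
      ring
  rw [Finset.sum_eq_zero fun k _ => hforce k, add_zero]
  congr 1; ext a
  have d1 := fun i => (contDiff_vel_apply hv.1 i).differentiable (by simp) x
  have d2 := fun i => (contDiff_pd hSv i).differentiable (by simp) x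
  have e1 : ∀ j, pd j (fun y => vel v y (a 0) * pd (a 1) (fun y => S (thermo v y)) y) x =
      vel v x (a 0) * pd (a 1) (pd j (fun y => S (thermo v y))) x +
      pd (a 1) (fun y => S (thermo v y)) x * ug v x (a 0) j := fun j => by
    rw [pd_mul (d1 _) (d2 _), pd_pd_comm hSv j]; rfl
  have e2 : pd (a 1) (fun y => -∑ j, vel v y j * pd j (fun y => S (thermo v y)) y) x =
      -∑ j, (vel v x j * pd (a 1) (pd j (fun y => S (thermo v y))) x +
        pd j (fun y => S (thermo v y)) x * ug v x j (a 1)) := by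
    rw [pd_neg, pd_sum _ fun j _ => (d1 j).fun_mul (d2 j)]
    congr 1
    exact Finset.sum_congr rfl fun j _ => pd_mul (d1 j) (d2 j) _
  simp only [e1, e2, evolution_vel, Fin.sum_univ_two, update_self, ne_eq, Fin.isValue,
    one_ne_zero, zero_ne_one, not_false_eq_true, update_of_ne]
  simp only [zero_smul, add_zero, mul_add, sub_mul, neg_mul, Finset.sum_add_distrib,
    Finset.mul_sum, Finset.sum_mul, mul_neg, neg_add]
  have c1 : ∀ i, vel v x (a 0) * (vel v x i * pd (a 1) (pd i (fun y => S (thermo v y))) x) =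
      vel v x i * (vel v x (a 0) * pd (a 1) (pd i (fun y => S (thermo v y))) x) := fun i => by ring
  have c2 : ∀ i, vel v x (a 0) * (pd i (fun y => S (thermo v y)) x * ug v x i (a 1)) =
      ug v x i (a 1) * (vel v x (a 0) * pd i (fun y => S (thermo v y)) x) := fun i => by ring
  have c3 : ∀ i, vel v x i * ug v x (a 0) i * pd (a 1) (fun y => S (thermo v y)) x =
      vel v x i * (pd (a 1) (fun y => S (thermo v y)) x * ug v x (a 0) i) := fun i => by ring
  have c4 : ∀ i, ug v x i (a 0) * vel v x i * pd (a 1) (fun y => S (thermo v y)) x =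
      ug v x i (a 0) * (vel v x i * pd (a 1) (fun y => S (thermo v y)) x) := fun i => by ring
  simp only [c1, c2, c3, c4]
  ring

end Even

end GasDynamics
end

/-! ### Law of the circulatory entropy, divergence identities, and the vorticity vector -/

noncomputable section

namespace GasDynamics

variable {n : ℕ}

open Function

section Even

variable {m : ℕ} (hm : 1 ≤ m) (h : n = 2 * m) {I J : Set ℝ} {F S e : ℝ × ℝ → ℝ}
  (hI : IsOpen I) (hJ' : IsOpen J) (hJ : ∀ r ∈ J, 0 < r) {v : Field n}

theorem contDiff_norm_vel_sq (hv : ContDiff ℝ ∞ v) : ContDiff ℝ ∞ (fun y => ‖vel v y‖ ^ 2) :=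
  (contDiff_vel hv).norm_sq ℝ

theorem pd_norm_vel_sq (hv : ContDiff ℝ ∞ v) (x : Space n) (i : Fin n) :
    pd i (fun y => ‖vel v y‖ ^ 2) x = 2 * ∑ l, ug v x l i * vel v x l := by
  have d := fun l => (contDiff_vel_apply hv l).differentiable (by simp) x
  have e : (fun y => ‖vel v y‖ ^ 2) = fun y => ∑ l, vel v y l * vel v y l := by
    ext y
    rw [EuclideanSpace.real_norm_sq_eq]
    exact Finset.sum_congr rfl fun l _ => sq _
  rw [e, pd_sum _ fun l _ => (d l).fun_mul (d l), Finset.mul_sum]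
  refine Finset.sum_congr rfl fun l _ => ?_
  rw [pd_mul (d l) (d l)]
  simp only [ug]; ring

include hI hJ' hJ in
-- Put k = e + p/ρ − ½|u|². The Gibbs relation turns the source ½∇|u|² − ρ⁻¹∇p into e_S ∇S − ∇k.
-- Wedged with ∇S, the first part vanishes because it is parallel to ∇S, and −∇k ∧ ∇S = ∇S ∧ ∇k is
-- cancelled by the divergence of w_ij k ∂_j S.
theorem continuityEquation_circulatoryEntropy (hF : ContDiffOn ℝ ∞ F (I ×ˢ J))
    (hS : IsEntropy F I J S) (he : IsEnergy F I J e) :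
    ContinuityEquation F I J (circulatoryEntropy hm h S) (circulatoryEntropyFlux hm h S e) := by
  intro v hv x
  have h2 : 2 + 2 * (m - 1) = n := by omega
  have hSv := hv.contDiff_comp_thermo hS.1
  have hHv : ContDiff ℝ ∞ (fun y => e (thermo v y) + pres v y * (dens v y)⁻¹) :=
    (hv.contDiff_comp_thermo he.1).add ((contDiff_pres hv.1).mul (hv.contDiff_inv_dens hJ))
  have hk : ContDiff ℝ ∞ (fun y => e (thermo v y) + pres v y * (dens v y)⁻¹ -
      2⁻¹ * ‖vel v y‖ ^ 2) := hHv.sub (contDiff_const.mul (contDiff_norm_vel_sq hv.1))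
  have hC : ContDiff ℝ ∞ (circulatoryEntropy hm h S v) := by
    rw [show circulatoryEntropy hm h S v = _ from funext fun x => circulatoryEntropy_eq hm h S v x]
    exact contDiff_star _ (fun _ => (contDiff_vel_apply hv.1 _).mul (contDiff_pd hSv _))
      fun _ => contDiff_ug hv.1
  have hkS : ∀ i, ContDiff ℝ ∞ (fun y => (e (thermo v y) + pres v y * (dens v y)⁻¹ -
      2⁻¹ * ‖vel v y‖ ^ 2) * pd i (fun y => S (thermo v y)) y) :=
    fun i => hk.mul (contDiff_pd hSv i)
  have e1 : divergence (circulatoryEntropyFlux hm h S e v) x =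
      ∑ j, pd j (fun y => circulatoryEntropy hm h S v y * vel v y j) x +
      ∑ i, pd i (fun y => ∑ j, vortTensor hm h v y i j *
        ((e (thermo v y) + pres v y * (dens v y)⁻¹ - 2⁻¹ * ‖vel v y‖ ^ 2) *
          pd j (fun y => S (thermo v y)) y)) x := by
    unfold circulatoryEntropyFlux
    rw [divergence_toLp, ← Finset.sum_add_distrib]
    refine Finset.sum_congr rfl fun i _ => ?_
    have hw : ContDiff ℝ ∞ (fun y => ∑ j, vortTensor hm h v y i j *
        ((e (thermo v y) + pres v y * (dens v y)⁻¹ - 2⁻¹ * ‖vel v y‖ ^ 2) *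
          pd j (fun y => S (thermo v y)) y)) := by
      simp only [sum_vortTensor_right]
      exact (contDiff_star _ (fun a => (hkS _).mul contDiff_const)
        fun _ => contDiff_ug hv.1).neg
    rw [← pd_add]
    · congr 1; ext y
      congr 1
      rw [Finset.mul_sum]
      exact Finset.sum_congr rfl fun j _ => by ring
    · exact (hC.mul (contDiff_vel_apply hv.1 i)).differentiable (by simp) x
    · exact hw.differentiable (by simp) x
  rw [timeDeriv, (hasDerivAt_circulatoryEntropy hm h hI hJ' hJ hF hS hv x).deriv, e1,
    sum_pd_vortTensor hm h hv.1 hkS]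
  have e2 : ∀ i, ∑ l, ug v x l i * vel v x l - (dens v x)⁻¹ * pd i (pres v) x =
      energyEntropyGrad F e v x i - pd i (fun y => e (thermo v y) + pres v y * (dens v y)⁻¹ -
      2⁻¹ * ‖vel v y‖ ^ 2) x := by
    intro i
    have hn := (contDiff_norm_vel_sq hv.1).differentiable (by simp) x
    rw [pd_sub (hHv.differentiable (by simp) x) (hn.const_mul _), pd_const_mul hn,
      pd_norm_vel_sq hv.1, energyEntropyGrad_eq hI hJ' hJ he hv]
    ring
  have e3 : ∀ i j, pd j (fun y => (e (thermo v y) + pres v y * (dens v y)⁻¹ -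
      2⁻¹ * ‖vel v y‖ ^ 2) * pd i (fun y => S (thermo v y)) y) x =
      (e (thermo v x) + pres v x * (dens v x)⁻¹ - 2⁻¹ * ‖vel v x‖ ^ 2) *
        pd j (pd i (fun y => S (thermo v y))) x + pd i (fun y => S (thermo v y)) x *
        pd j (fun y => e (thermo v y) + pres v y * (dens v y)⁻¹ - 2⁻¹ * ‖vel v y‖ ^ 2) x :=
    fun i j => pd_mul (hk.differentiable (by simp) x)
      ((contDiff_pd hSv i).differentiable (by simp) x) j
  simp only [e2, e3]
  set k' : Fin n → ℝ := fun j =>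
    pd j (fun y => e (thermo v y) + pres v y * (dens v y)⁻¹ - 2⁻¹ * ‖vel v y‖ ^ 2) x
  set s : Fin n → ℝ := fun j => pd j (fun y => S (thermo v y)) x
  have e4 : star h2 (fun a => (energyEntropyGrad F e v x (a 0) - k' (a 0)) * s (a 1))
      (fun _ => ug v x) = star h2 (fun a => s (a 0) * k' (a 1)) (fun _ => ug v x) := by
    have h3 := star_add_left h2 (fun a => energyEntropyGrad F e v x (a 0) * s (a 1))
      (fun a => -(k' (a 0) * s (a 1))) (fun _ => ug v x)
    simp only [← sub_eq_add_neg, ← sub_mul] at h3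
    rw [h3, star_neg_left, ← star_two_swap h2 (fun i j => k' i * s j),
      star_two_symm h2 (f := fun i j => energyEntropyGrad F e v x i * s j), zero_add]
    · congr 1; ext a; ring
    · intro i j
      simp only [s, pd_entropy hI hJ' hJ hS hv, energyEntropyGrad]
      ring
  have e5 := star_two_symm h2 (f := fun i j =>
    (e (thermo v x) + pres v x * (dens v x)⁻¹ - 2⁻¹ * ‖vel v x‖ ^ 2) *
        pd j (pd i (fun y => S (thermo v y))) x) (fun _ => ug v x)
    (fun i j => by rw [pd_pd_comm hSv])
  rw [e4, star_add_left h2, e5]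
  ring

/-- The circulatory entropy density is equivalent to `-S ϖ`. -/
theorem entropyVorticity_add_circulatoryEntropy (hS : ContDiffOn ℝ ∞ S (I ×ˢ J))
    (hv : Admissible I J v) (x : Space n) :
    entropyVorticity h S v x + circulatoryEntropy hm h S v x =
      divergence (fun y => WithLp.toLp 2 fun j => star (q := 2) (r := m - 1) (by omega)
        (fun a => S (thermo v y) * vel v y (a 0) * if a 1 = j then 1 else 0)
        (fun _ => ug v y)) x := by
  have h2 : 2 + 2 * (m - 1) = n := by omega
  have hSv := hv.contDiff_comp_thermo hS
  have hu := contDiff_vel_apply hv.1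
  have h3 := sum_pd_star (q := 1) h2 hv.1
    (b := fun y a => S (thermo v y) * vel v y (a 0)) (fun a => hSv.mul (hu _)) x
  -- One factor N is peeled off ϖ. Then S ∂_j u_i + u_i ∂_j S = ∂_j(S u_i), and the remaining
  -- factors are closed by `sum_pd_star`.
  rw [divergence_toLp, entropyVorticity_eq, star_peel _ hm h2, circulatoryEntropy_eq,
    ← star_add_left h2]
  refine Eq.trans ?_ h3.symm
  congr 1; ext a
  change S (thermo v x) * ug v x (a 0) (a 1) +
    vel v x (a 0) * pd (a 1) (fun y => S (thermo v y)) x =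
    pd (a 1) (fun y => S (thermo v y) * vel v y (a 0)) x
  rw [pd_mul (hSv.differentiable (by simp) x) ((hu _).differentiable (by simp) x)]
  rfl

include hI hJ' hJ in
/-- A flux for `S ϖ` that does not involve an energy function. -/
theorem timeDeriv_entropyVorticity (hF : ContDiffOn ℝ ∞ F (I ×ˢ J)) (hS : IsEntropy F I J S)
    {B : ℝ × ℝ → ℝ} (hB : ContDiffOn ℝ ∞ B (I ×ˢ J))
    (hBS : ∀ z ∈ I ×ˢ J, derivRho B z = S z * z.2⁻¹ ^ 2) (hv : Admissible I J v) (x : Space n) :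
    timeDeriv F (entropyVorticity h S) v x + divergence (fun y => WithLp.toLp 2 fun j =>
      entropyVorticity h S v y * vel v y j - m * star (q := 2) (r := m - 1) (by omega)
        (fun a => B (thermo v y) * pd (a 0) (pres v) y * if a 1 = j then 1 else 0)
        (fun _ => ug v y)) x = 0 := by
  have h2 : 2 + 2 * (m - 1) = n := by omega
  have hBv := hv.contDiff_comp_thermo hB
  have hp := contDiff_pd (contDiff_pres hv.1)
  have hw : ∀ j, ContDiff ℝ ∞ (fun y => star h2
      (fun a => B (thermo v y) * pd (a 0) (pres v) y * if a 1 = j then 1 else 0)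
        (fun _ => ug v y)) := fun j =>
    contDiff_star _ (fun _ => (hBv.mul (hp _)).mul contDiff_const) fun _ => contDiff_ug hv.1
  have h3 := sum_pd_star (q := 1) h2 hv.1
    (b := fun y a => B (thermo v y) * pd (a 0) (pres v) y) (fun a => hBv.mul (hp _)) x
  have e1 : ∀ j, pd j (fun y => entropyVorticity h S v y * vel v y j - m * star h2
        (fun a => B (thermo v y) * pd (a 0) (pres v) y * if a 1 = j then 1 else 0)
        (fun _ => ug v y)) x = pd j (fun y => entropyVorticity h S v y * vel v y j) x -
      m * pd j (fun y => star h2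
        (fun a => B (thermo v y) * pd (a 0) (pres v) y * if a 1 = j then 1 else 0)
        (fun _ => ug v y)) x := fun j => by
    rw [pd_sub, pd_const_mul ((hw j).differentiable (by simp) x)]
    · exact ((contDiff_entropyVorticity h hS.1 hv).mul
        (contDiff_vel_apply hv.1 j)).differentiable (by simp) x
    · exact ((hw j).differentiable (by simp) x).const_mul _
  rw [timeDeriv, (hasDerivAt_entropyVorticity hm h hI hJ' hJ hF hS hv x).deriv, divergence_toLp]
  simp only [e1, Finset.sum_sub_distrib, ← Finset.mul_sum]
  -- As B_ρ = S ρ⁻², the density part of the derivative of B ∂_i p is exactly the baroclinic source;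
  -- the Hessian of p and the product ∂_i p ∂_j p are symmetric.
  have e2 : ∀ i j, pd j (fun y => B (thermo v y) * pd i (pres v) y) x =
      S (thermo v x) * ((dens v x)⁻¹ ^ 2 * (pd i (pres v) x * pd j (dens v) x)) +
      (B (thermo v x) * pd j (pd i (pres v)) x +
        derivP B (thermo v x) * (pd i (pres v) x * pd j (pres v) x)) := by
    intro i j
    rw [pd_mul (hBv.differentiable (by simp) x) ((hp i).differentiable (by simp) x),
      pd_comp_thermo hI hJ' hB hv, hBS _ (hv.thermo_mem x)]
    simp only [thermo]; ring
  have e3 := star_two_symm h2 (f := fun i j => B (thermo v x) * pd j (pd i (pres v)) x +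
    derivP B (thermo v x) * (pd i (pres v) x * pd j (pres v) x)) (fun _ => ug v x)
    (fun i j => by rw [pd_pd_comm (contDiff_pres hv.1)]; ring)
  have e4 : star h2 (fun a => pd (a 1) (fun y => B (thermo v y) * pd (a 0) (pres v) y) x)
      (fun _ => ug v x) = star h2 (fun a => S (thermo v x) *
          ((dens v x)⁻¹ ^ 2 * (pd (a 0) (pres v) x * pd (a 1) (dens v) x)))
      (fun _ => ug v x) := by
    simp only [e2]
    rw [star_add_left h2, e3, add_zero]
  have h4 : ∑ j, pd j (fun y => star h2
        (fun a => B (thermo v y) * pd (a 0) (pres v) y * if a 1 = j then 1 else 0)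
        (fun _ => ug v y)) x = _ := h3.trans e4
  rw [h4]
  ring

end Even

/-! ### Odd dimensions -/

section Odd

variable {m : ℕ} (hm : 1 ≤ m) (h : n = 2 * m + 1) {I J : Set ℝ} {F : ℝ × ℝ → ℝ}
  (hJ : ∀ r ∈ J, 0 < r) {v : Field n}

theorem inner_vortVector (b : Space n) (v : Field n) (x : Space n) :
    inner ℝ b (vortVector h v x) =
      star (q := 1) (r := m) (by omega) (fun a => b (a 0)) (fun _ => ug v x) := by
  simp only [vortVector, PiLp.inner_apply, starPow_curl, RCLike.inner_apply, conj_trivial]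
  simp only [mul_comm _ (b _), ← star_const_mul_left, ← star_sum_left]
  congr 1; ext c
  have e : ∀ i, c = ![i] ↔ c 0 = i := fun i => by
    rw [funext_iff]; simp
  simp [e]

/-- With one factor peeled off, b_i ∂_k u_j = ∂_k(b_i u_j) because `b` is constant, and
`sum_pd_star` applies to the remaining factors. -/
theorem inner_vortVector_eq_divergence (b : Space n) (hv : ContDiff ℝ ∞ v) (x : Space n) :
    inner ℝ b (vortVector h v x) =
      divergence (fun y => WithLp.toLp 2 fun j => star (q := 3) (r := m - 1) (by omega)
        (fun a => b (a 0) * vel v y (a 1) * if a 2 = j then 1 else 0) (fun _ => ug v y)) x := by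
  have h2 : 3 + 2 * (m - 1) = n := by omega
  have hu := contDiff_vel_apply hv
  have h3 := sum_pd_star (q := 2) h2 hv
    (b := fun y a => b (a 0) * vel v y (a 1)) (fun a => contDiff_const.mul (hu _)) x
  rw [divergence_toLp, inner_vortVector, star_peel _ hm h2]
  refine Eq.trans ?_ h3.symm
  congr 1; ext a
  change b (a 0) * ug v x (a 1) (a 2) = pd (a 2) (fun y => b (a 0) * vel v y (a 1)) x
  rw [pd_const_mul ((hu _).differentiable (by simp) x)]
  rfl

include hJ in
/-- The evolution of the vorticity vector. -/
theorem hasDerivAt_inner_vortVector (hF : ContDiffOn ℝ ∞ F (I ×ˢ J)) (hv : Admissible I J v)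
    (b : Space n) (x : Space n) :
    HasDerivAt (fun ε : ℝ => (inner ℝ b (vortVector h (fun y => v y + ε • evolution F v y) x) : ℝ))
      (star (q := 1) (r := m) (by omega) (fun a => ∑ l, ug v x l (a 0) * b l) (fun _ => ug v x) +
        m * star (q := 3) (r := m - 1) (by omega) (fun a => b (a 0) *
          ((dens v x)⁻¹ ^ 2 * (pd (a 1) (pres v) x * pd (a 2) (dens v) x))) (fun _ => ug v x) -
        ∑ j, pd j (fun y => inner ℝ b (vortVector h v y) * vel v y j) x) 0 := by
  have h0 : 1 + 2 * m = n := by omega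
  have h1 := hasDerivAt_star_evolution hJ hF hv h0 x
    (B := fun ε a => b (a 0)) (β := fun y a => b (a 0)) rfl (β' := fun _ => 0)
    (fun _ => hasDerivAt_const _ _) (fun _ => contDiff_const)
  simp only [← inner_vortVector h] at h1
  refine h1.congr_deriv ?_
  rw [sum_star_update' h0 hm (by omega)]
  congr 2
  congr 1; ext a
  simp [pd_const]

include hJ in
-- Both sources are divergences: stretching is d(b·u) ∧ ω^m because `b` is constant, and the
-- baroclinic term b ∧ ρ⁻²∇p ∧ ∇ρ ∧ ω^(m−1) is minus the divergence built from b ∧ ρ⁻¹∇p. The signs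
-- of the last two parts of the flux follow from this.
theorem timeDeriv_inner_vortVector (hF : ContDiffOn ℝ ∞ F (I ×ˢ J)) (hv : Admissible I J v)
    (b : Space n) (x : Space n) :
    timeDeriv F (fun v x => inner ℝ b (vortVector h v x)) v x +
      divergence (fun y => WithLp.toLp 2 fun j =>
        inner ℝ b (vortVector h v y) * vel v y j - star (q := 1) (r := m) (by omega)
          (fun a => (∑ l, b l * vel v y l) * if a 0 = j then 1 else 0) (fun _ => ug v y) +
        m * star (q := 3) (r := m - 1) (by omega) (fun a => b (a 0) *
          ((dens v y)⁻¹ * pd (a 1) (pres v) y) * if a 2 = j then 1 else 0)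
          (fun _ => ug v y)) x = 0 := by
  have h1 : 1 + 2 * m = n := by omega
  have h3 : 3 + 2 * (m - 1) = n := by omega
  have hu := contDiff_vel_apply hv.1
  have hp := contDiff_pd (contDiff_pres hv.1)
  have hr := hv.contDiff_inv_dens hJ
  have hbu : ContDiff ℝ ∞ (fun y => ∑ l, b l * vel v y l) :=
    ContDiff.sum fun l _ => contDiff_const.mul (hu l)
  have hw1 : ∀ j, ContDiff ℝ ∞ (fun y => star h1
      (fun a => (∑ l, b l * vel v y l) * if a 0 = j then 1 else 0) (fun _ => ug v y)) := fun j =>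
    contDiff_star _ (fun _ => hbu.mul contDiff_const) fun _ => contDiff_ug hv.1
  have hw3 : ∀ j, ContDiff ℝ ∞ (fun y => star h3 (fun a => b (a 0) *
      ((dens v y)⁻¹ * pd (a 1) (pres v) y) * if a 2 = j then 1 else 0) (fun _ => ug v y)) :=
    fun j => contDiff_star _ (fun _ => (contDiff_const.mul (hr.mul (hp _))).mul contDiff_const)
      fun _ => contDiff_ug hv.1
  have hb : ContDiff ℝ ∞ (fun y => (inner ℝ b (vortVector h v y) : ℝ)) := by
    simp only [inner_vortVector]
    exact contDiff_star _ (fun _ => contDiff_const) fun _ => contDiff_ug hv.1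
  have s1 := sum_pd_star (q := 0) h1 hv.1
    (b := fun y a => ∑ l, b l * vel v y l) (fun a => hbu) x
  have s3 := sum_pd_star (q := 2) h3 hv.1
    (b := fun y a => b (a 0) * ((dens v y)⁻¹ * pd (a 1) (pres v) y))
    (fun a => contDiff_const.mul (hr.mul (hp _))) x
  have e1 : ∀ j, pd j (fun y => inner ℝ b (vortVector h v y) * vel v y j - star h1
          (fun a => (∑ l, b l * vel v y l) * if a 0 = j then 1 else 0) (fun _ => ug v y) +
        m * star h3 (fun a => b (a 0) *
          ((dens v y)⁻¹ * pd (a 1) (pres v) y) * if a 2 = j then 1 else 0)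
          (fun _ => ug v y)) x =
      pd j (fun y => inner ℝ b (vortVector h v y) * vel v y j) x - pd j (fun y => star h1
        (fun a => (∑ l, b l * vel v y l) * if a 0 = j then 1 else 0) (fun _ => ug v y)) x +
      m * pd j (fun y => star h3 (fun a => b (a 0) *
        ((dens v y)⁻¹ * pd (a 1) (pres v) y) * if a 2 = j then 1 else 0)
        (fun _ => ug v y)) x := fun j => by
    have d0 := (hb.mul (hu j)).differentiable (by simp) x
    have d1 := (hw1 j).differentiable (by simp) x
    have d3 := (hw3 j).differentiable (by simp) x
    rw [pd_add (DifferentiableAt.fun_sub d0 d1) (d3.const_mul _), pd_sub d0 d1, pd_const_mul d3]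
  rw [timeDeriv, (hasDerivAt_inner_vortVector hm h hJ hF hv b x).deriv, divergence_toLp]
  simp only [e1, Finset.sum_sub_distrib, Finset.sum_add_distrib, ← Finset.mul_sum]
  have t1 : star h1 (fun a => ∑ l, ug v x l (a 0) * b l) (fun _ => ug v x) =
      star h1 (fun a => pd (a (Fin.last 0)) (fun y => ∑ l, b l * vel v y l) x)
        (fun _ => ug v x) := by
    congr 1; ext a
    rw [pd_sum _ fun l _ => ((hu l).differentiable (by simp) x).const_mul _]
    refine Finset.sum_congr rfl fun l _ => ?_
    rw [pd_const_mul ((hu l).differentiable (by simp) x), mul_comm]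
    rfl
  have t3 : star h3 (fun a => pd (a (Fin.last 2)) (fun y => b (a 0) *
      ((dens v y)⁻¹ * pd (a 1) (pres v) y)) x) (fun _ => ug v x) =
      -star h3 (fun a => b (a 0) *
          ((dens v x)⁻¹ ^ 2 * (pd (a 1) (pres v) x * pd (a 2) (dens v) x))) (fun _ => ug v x) := by
    have t4 : ∀ a : Fin 3 → Fin n, pd (a (Fin.last 2)) (fun y => b (a 0) *
      ((dens v y)⁻¹ * pd (a 1) (pres v) y)) x = -(b (a 0) *
          ((dens v x)⁻¹ ^ 2 * (pd (a 1) (pres v) x * pd (a 2) (dens v) x))) +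
          b (a 0) * ((dens v x)⁻¹ * pd (a 2) (pd (a 1) (pres v)) x) := by
      intro a
      have d1 := hr.differentiable (by simp) x
      have d2 := (hp (a 1)).differentiable (by simp) x
      rw [pd_const_mul (d1.fun_mul d2), pd_mul d1 d2,
        pd_inv ((contDiff_dens hv.1).differentiable (by simp) x) (hv.dens_pos hJ x).ne']
      change _ * (_ + _ * -(_ * pd (a 2) (dens v) x)) = _
      simp only [show Fin.last 2 = (2 : Fin 3) from rfl]
      ring
    simp only [t4]
    rw [star_add_left h3, star_neg_left, star_eq_zero_of_symm h3 (c := 1) (d := 2) (by decide)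
      (b := fun a => b (a 0) * ((dens v x)⁻¹ * pd (a 2) (pd (a 1) (pres v)) x)), add_zero]
    intro a
    have q0 : (a ∘ Equiv.swap 1 2) 0 = a 0 := by
      rw [comp_apply, Equiv.swap_apply_of_ne_of_ne (by decide) (by decide)]
    have q1 : (a ∘ Equiv.swap 1 2) 1 = a 2 := by simp
    have q2 : (a ∘ Equiv.swap 1 2) 2 = a 1 := by simp
    rw [q0, q1, q2, pd_pd_comm (contDiff_pres hv.1)]
  have u1 := s1.trans t1.symm
  have u3 := s3.trans t3
  have u1' : ∑ j, pd j (fun y => star h1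
      (fun a => (∑ l, b l * vel v y l) * if a 0 = j then 1 else 0) (fun _ => ug v y)) x =
      star h1 (fun a => ∑ l, ug v x l (a 0) * b l) (fun _ => ug v x) := u1
  have u3' : ∑ j, pd j (fun y => star h3 (fun a => b (a 0) *
        ((dens v y)⁻¹ * pd (a 1) (pres v) y) * if a 2 = j then 1 else 0)
        (fun _ => ug v y)) x = -star h3 (fun a => b (a 0) *
          ((dens v x)⁻¹ ^ 2 * (pd (a 1) (pres v) x * pd (a 2) (dens v) x))) (fun _ => ug v x) := u3
  rw [u1', u3']
  ring

end Odd

end GasDynamics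
end

noncomputable section

namespace GasDynamics

variable {n : ℕ}

open Function Set MeasureTheory

/-! ### Primitives of functions of state -/

/-- The segment between `a` and `b` is enlarged twice inside `J`: the cut-off is one on the smaller
neighbourhood and vanishes outside the larger one, which is compact. It makes an integrand on `J`
into a compactly supported function on the line. -/
theorem exists_contDiffBump_eq_one {J : Set ℝ} (hJ : IsOpen J) (hJ' : J.OrdConnected) {a b : ℝ}
    (ha : a ∈ J) (hb : b ∈ J) :
    ∃ (χ : ℝ → ℝ) (K : Set ℝ) (U : Set ℝ), ContDiff ℝ ∞ χ ∧ IsCompact K ∧ K ⊆ J ∧ IsOpen U ∧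
      OrdConnected U ∧ a ∈ U ∧ b ∈ U ∧ U ⊆ J ∧ (∀ s ∈ U, χ s = 1) ∧ ∀ s ∉ K, χ s = 0 := by
  have hlo : min a b ∈ J := by rcases min_choice a b with h | h <;> rw [h] <;> assumption
  have hhi : max a b ∈ J := by rcases max_choice a b with h | h <;> rw [h] <;> assumption
  obtain ⟨δ₁, hδ₁, h1⟩ := Metric.isOpen_iff.1 hJ _ hlo
  obtain ⟨δ₂, hδ₂, h2⟩ := Metric.isOpen_iff.1 hJ _ hhi
  set lo := min a b
  set hi := max a b
  have hle : lo ≤ hi := min_le_max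
  set δ := min δ₁ δ₂ / 3
  have hδ : 0 < δ := by positivity
  have hd1 : 2 * δ < δ₁ := by have := min_le_left δ₁ δ₂; simp only [δ]; linarith
  have hd2 : 2 * δ < δ₂ := by have := min_le_right δ₁ δ₂; simp only [δ]; linarith
  have hK : Icc (lo - 2 * δ) (hi + 2 * δ) ⊆ J := by
    refine hJ'.out (h1 ?_) (h2 ?_)
    · simp [abs_of_pos hδ, hd1]
    · simp [abs_of_pos hδ, hd2]
  let χ : ContDiffBump ((lo + hi) / 2) :=
    ⟨(hi - lo) / 2 + δ, (hi - lo) / 2 + 2 * δ, by linarith, by linarith⟩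
  refine ⟨χ, Icc (lo - 2 * δ) (hi + 2 * δ), Ioo (lo - δ) (hi + δ), χ.contDiff, isCompact_Icc, hK,
    isOpen_Ioo, ordConnected_Ioo, ⟨?_, ?_⟩, ⟨?_, ?_⟩, fun s hs => hK ⟨?_, ?_⟩,
    fun s hs => χ.one_of_mem_closedBall ?_, fun s hs => χ.zero_of_le_dist ?_⟩
  · have := min_le_left a b; simp only [lo]; linarith
  · have := le_max_left a b; simp only [hi]; linarith
  · have := min_le_right a b; simp only [lo]; linarith
  · have := le_max_right a b; simp only [hi]; linarith
  · linarith [hs.1]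
  · linarith [hs.2]
  · rw [Metric.mem_closedBall, Real.dist_eq, abs_le]
    constructor <;> simp only [χ] <;> linarith [hs.1, hs.2]
  · by_contra hc
    push Not at hc
    rw [Real.dist_eq, abs_lt] at hc
    simp only [χ] at hc
    exact hs ⟨by linarith [hc.1], by linarith [hc.2]⟩

/-- A smooth function on a rectangle has a smooth primitive in the second variable. -/
theorem exists_derivRho_eq {I J : Set ℝ} (hI : IsOpen I) (hJ : IsOpen J) (hJ' : J.OrdConnected)
    (hJ₀ : J.Nonempty) {g : ℝ × ℝ → ℝ} (hg : ContDiffOn ℝ ∞ g (I ×ˢ J)) :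
    ∃ B : ℝ × ℝ → ℝ, ContDiffOn ℝ ∞ B (I ×ˢ J) ∧ ∀ z ∈ I ×ˢ J, derivRho B z = g z := by
  obtain ⟨r₀, hr₀⟩ := hJ₀
  have hcont : ∀ p ∈ I, ContinuousOn (fun s => g (p, s)) J := fun p hp =>
    hg.continuousOn.comp (continuousOn_const.prodMk continuousOn_id) fun s hs => ⟨hp, hs⟩
  refine ⟨fun z => ∫ s in r₀..z.2, g (z.1, s), fun z hz => ContDiffAt.contDiffWithinAt ?_,
    fun z hz => ?_⟩
  · obtain ⟨χ, K, U, hχ, hK, hKJ, hU, hU', hr₀U, hzU, hUJ, hχ1, hχ0⟩ :=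
      exists_contDiffBump_eq_one hJ hJ' hr₀ hz.2
    -- Extended by zero, the cut-off integrand is smooth on the whole line: near a point outside the
    -- compact `K` it is identically zero.
    have hG : ContDiffOn ℝ ∞ ↿(fun p s => χ s * g (p, s)) (I ×ˢ univ) := by
      intro y hy
      refine ContDiffAt.contDiffWithinAt ?_
      by_cases hyK : y.2 ∈ K
      · exact (hχ.contDiffAt.comp y contDiffAt_snd).mul
          (hg.contDiffAt ((hI.prod hJ).mem_nhds ⟨hy.1, hKJ hyK⟩))
      · refine (contDiffAt_const (c := (0 : ℝ))).congr_of_eventuallyEq ?_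
        have : ∀ᶠ w : ℝ × ℝ in nhds y, w.2 ∉ K :=
          continuous_snd.continuousAt.eventually (hK.isClosed.isOpen_compl.mem_nhds hyK)
        filter_upwards [this] with w hw
        change χ w.2 * g (w.1, w.2) = 0
        rw [hχ0 _ hw, zero_mul]
    -- Convolution with the Heaviside function is integration from −∞. The theorem on convolutions
    -- with parameters then gives joint smoothness of the primitive in both variables; the
    -- difference of two such values is the integral from `r₀`.
    have hf : LocallyIntegrable ((Ici (0 : ℝ)).indicator fun _ => (1 : ℝ)) volume :=
      (locallyIntegrable_const 1).indicator measurableSet_Ici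
    have hconv := contDiffOn_convolution_right_with_param (μ := volume) (𝕜 := ℝ)
      (ContinuousLinearMap.mul ℝ ℝ) (g := fun p s => χ s * g (p, s)) hI hK
      (fun p s _ hs => by rw [hχ0 s hs, zero_mul]) hf hG
    have hint : ∀ p r, (convolution ((Ici (0 : ℝ)).indicator fun _ => (1 : ℝ))
        (fun s => χ s * g (p, s)) (ContinuousLinearMap.mul ℝ ℝ) volume) r =
        ∫ s in Iic r, χ s * g (p, s) := by
      intro p r
      rw [convolution_eq_swap, ← integral_indicator measurableSet_Iic]
      refine integral_congr_ae (.of_forall fun s => ?_)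
      by_cases hs : s ≤ r <;> simp [hs]
    simp only [hint] at hconv
    have hpt : ∀ r : ℝ, (z.1, r) ∈ I ×ˢ (univ : Set ℝ) := fun r => ⟨hz.1, mem_univ _⟩
    have hopen : IsOpen (I ×ˢ (univ : Set ℝ)) := hI.prod isOpen_univ
    have c1 : ContDiffAt ℝ ∞ (fun q : ℝ × ℝ => ∫ s in Iic q.2, χ s * g (q.1, s)) z :=
      hconv.contDiffAt (hopen.mem_nhds (hpt z.2))
    have c2 : ContDiffAt ℝ ∞ (fun q : ℝ × ℝ => ∫ s in Iic r₀, χ s * g (q.1, s)) z :=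
      ContDiffAt.comp z (f := fun q : ℝ × ℝ => (q.1, r₀))
        (g := fun q : ℝ × ℝ => ∫ s in Iic q.2, χ s * g (q.1, s))
        (hconv.contDiffAt (hopen.mem_nhds (hpt r₀))) (contDiffAt_fst.prodMk contDiffAt_const)
    refine (c1.sub c2).congr_of_eventuallyEq ?_
    filter_upwards [(hI.prod hU).mem_nhds ⟨hz.1, hzU⟩] with q hq
    have hcs : Integrable (fun s => χ s * g (q.1, s)) := by
      have hcg : Continuous (fun s => χ s * g (q.1, s)) := by
        rw [← continuousOn_univ]
        exact hG.continuousOn.comp (g := ↿(fun p s => χ s * g (p, s)))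
          (f := fun s : ℝ => (q.1, s)) (continuousOn_const.prodMk continuousOn_id)
          fun s _ => ⟨hq.1, mem_univ _⟩
      exact hcg.integrable_of_hasCompactSupport
        (HasCompactSupport.intro hK fun s hs => by rw [hχ0 s hs, zero_mul])
    change _ = (∫ s in Iic q.2, χ s * g (q.1, s)) - ∫ s in Iic r₀, χ s * g (q.1, s)
    rw [intervalIntegral.integral_Iic_sub_Iic hcs.integrableOn hcs.integrableOn]
    refine intervalIntegral.integral_congr fun s hs => ?_
    rw [hχ1 s (hU'.uIcc_subset hr₀U hq.2 hs), one_mul]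
  · have hc := hcont z.1 hz.1
    exact (intervalIntegral.integral_hasDerivAt_right
      ((hc.mono (hJ'.uIcc_subset hr₀ hz.2)).intervalIntegrable)
      (hc.stronglyMeasurableAtFilter hJ _ hz.2) (hc.continuousAt (hJ.mem_nhds hz.2))).deriv

/-! ### Local vectors -/

theorem isOpen_stateDomain {I J : Set ℝ} (hI : IsOpen I) (hJ : IsOpen J) :
    IsOpen (stateDomain n I J) :=
  (hJ.preimage continuous_fst).inter (hI.preimage (continuous_fst.comp continuous_snd))

section Local

variable {I J : Set ℝ}

/-- The gradient of a gas field. -/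
abbrev Grad (n : ℕ) : Type := Space n →L[ℝ] State n

theorem jet_one_zero (v : Field n) (x : Space n) : jet 1 v x 0 (fun _ => 0) = v x :=
  iteratedFDeriv_zero_apply _

theorem jet_one_one (v : Field n) (x : Space n) :
    continuousMultilinearCurryFin1 ℝ (Space n) (State n) (jet 1 v x 1) = fderiv ℝ v x := by
  ext y : 1
  exact iteratedFDeriv_one_apply _

theorem isLocalVector_of_first_order {Ψ : State n × Grad n → Space n}
    (hΨ : ContDiffOn ℝ ∞ Ψ (stateDomain n I J ×ˢ univ)) {X : ℝ → Field n → Space n → Space n}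
    (hX : ∀ t v, Admissible I J v → ∀ x, X t v x = Ψ (v x, fderiv ℝ v x)) :
    IsLocalVector I J X := by
  refine ⟨1, fun z => Ψ (z.2.2 0 (fun _ => 0),
    continuousMultilinearCurryFin1 ℝ (Space n) (State n) (z.2.2 1)), ?_, fun t v hv x => ?_⟩
  · refine hΨ.comp (ContDiff.contDiffOn ?_) fun z hz => ⟨hz, mem_univ _⟩
    refine ContDiff.prodMk ?_ ?_
    · have h1 : ContDiff ℝ ∞ fun z : ℝ × Space n × Jet n 1 => z.2.2 0 :=
        (ContinuousLinearMap.proj (R := ℝ) (φ := fun j : Fin 2 => ContinuousMultilinearMap ℝ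
          (fun _ : Fin (j : ℕ) => Space n) (State n)) 0).contDiff.comp
          (contDiff_snd.comp contDiff_snd)
      exact (ContinuousMultilinearMap.apply ℝ (fun _ : Fin ((0 : Fin 2) : ℕ) => Space n)
        (State n) (fun _ => 0)).contDiff.comp h1
    · have h1 : ContDiff ℝ ∞ fun z : ℝ × Space n × Jet n 1 => z.2.2 1 :=
        (ContinuousLinearMap.proj (R := ℝ) (φ := fun j : Fin 2 => ContinuousMultilinearMap ℝ
          (fun _ : Fin (j : ℕ) => Space n) (State n)) 1).contDiff.comp
          (contDiff_snd.comp contDiff_snd)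
      exact (continuousMultilinearCurryFin1 ℝ (Space n) (State n)).contDiff.comp h1
  · rw [hX t v hv x]
    simp only [jet_one_zero, jet_one_one]

theorem exists_jet_of_le {k l : ℕ} (hkl : k ≤ l) {Φ : ℝ × Space n × Jet n k → Space n}
    (hΦ : ContDiffOn ℝ ∞ Φ (jetDomain n k I J)) :
    ∃ Φ' : ℝ × Space n × Jet n l → Space n, ContDiffOn ℝ ∞ Φ' (jetDomain n l I J) ∧
      ∀ t v x, Φ' (t, x, jet l v x) = Φ (t, x, jet k v x) := by
  let π : Jet n l → Jet n k := fun z j => z (Fin.castLE (by omega) j)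
  have hπ : ContDiff ℝ ∞ π := by
    rw [contDiff_pi]
    intro j
    exact (ContinuousLinearMap.proj (R := ℝ) (φ := fun j : Fin (l + 1) =>
      ContinuousMultilinearMap ℝ (fun _ : Fin (j : ℕ) => Space n) (State n))
      (Fin.castLE (by omega) j)).contDiff
  refine ⟨fun z => Φ (z.1, z.2.1, π z.2.2), ?_, fun t v x => rfl⟩
  refine hΦ.comp (ContDiff.contDiffOn ?_) fun z hz => ?_
  · exact contDiff_fst.prodMk ((contDiff_fst.comp contDiff_snd).prodMk
      (hπ.comp (contDiff_snd.comp contDiff_snd)))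
  · exact hz

theorem IsLocalVector.const_smul_add {X Y : ℝ → Field n → Space n → Space n}
    (hX : IsLocalVector I J X) (hY : IsLocalVector I J Y) (c : ℝ) :
    IsLocalVector I J (fun t v x => X t v x + c • Y t v x) := by
  obtain ⟨k, Φ, hΦ, hX⟩ := hX
  obtain ⟨l, Ψ, hΨ, hY⟩ := hY
  obtain ⟨Φ', hΦ', e1⟩ := exists_jet_of_le (le_max_left k l) hΦ
  obtain ⟨Ψ', hΨ', e2⟩ := exists_jet_of_le (le_max_right k l) hΨ
  refine ⟨max k l, fun z => Φ' z + c • Ψ' z, hΦ'.add (hΨ'.const_smul c),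
    fun t v hv x => ?_⟩
  simp only [e1, e2, hX t v hv x, hY t v hv x]

theorem contDiff_jet (k : ℕ) {v : Field n} (hv : ContDiff ℝ ∞ v) : ContDiff ℝ ∞ (jet k v) := by
  rw [contDiff_pi]
  intro j
  exact hv.iteratedFDeriv_right (m := ∞) (by exact_mod_cast le_top)

/-- The properties of a local vector that matter at a fixed time. -/
theorem IsLocalVector.contDiff {X : ℝ → Field n → Space n → Space n} (hX : IsLocalVector I J X)
    (t : ℝ) {v : Field n} (hv : Admissible I J v) :
    ContDiff ℝ ∞ (X t v) := by
  obtain ⟨k, Φ, hΦ, hX⟩ := hX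
  rw [show X t v = fun x => Φ (t, x, jet k v x) from funext (hX t v hv)]
  refine hΦ.comp_contDiff (contDiff_const.prodMk (contDiff_id.prodMk (contDiff_jet k hv.1)))
    fun x => ?_
  change iteratedFDeriv ℝ 0 v x (fun _ => 0) ∈ stateDomain n I J
  rw [iteratedFDeriv_zero_apply]
  exact hv.2 x

/-- A local vector sees only derivatives at the point. Smoothness and this locality are all that the
rigidity argument uses of a flux, so its order never matters. -/
theorem IsLocalVector.congr {X : ℝ → Field n → Space n → Space n} (hX : IsLocalVector I J X)
    (t : ℝ) {v w : Field n} (hv : Admissible I J v) (hw : Admissible I J w) {x : Space n}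
    (hvw : v =ᶠ[nhds x] w) : X t v x = X t w x := by
  obtain ⟨k, Φ, hΦ, hX⟩ := hX
  rw [hX t v hv, hX t w hw]
  congr 3
  ext j : 1
  exact (hvw.iteratedFDeriv ℝ _).eq_of_nhds

theorem contDiffOn_of_apply {X : Type*} [NormedAddCommGroup X] [NormedSpace ℝ X] {s : Set X}
    {f : Fin n → X → ℝ} (hf : ∀ i, ContDiffOn ℝ ∞ (f i) s) :
    ContDiffOn ℝ ∞ (fun x => (WithLp.toLp 2 fun i => f i x : Space n)) s := by
  rw [contDiffOn_euclidean]
  exact hf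

theorem contDiff_gradPart (j : Fin n) :
    ContDiff ℝ ∞ (fun y : State n × Grad n => y.2 (EuclideanSpace.single j 1)) :=
  contDiff_snd.clm_apply contDiff_const

theorem contDiff_ugPart (i j : Fin n) :
    ContDiff ℝ ∞ (fun y : State n × Grad n => (y.2 (EuclideanSpace.single j 1)).2.2 i) :=
  (EuclideanSpace.proj (𝕜 := ℝ) i).contDiff.comp (contDiff_gradPart j).snd.snd

theorem contDiff_velPart (i : Fin n) :
    ContDiff ℝ ∞ (fun y : State n × Grad n => y.1.2.2 i) :=
  (EuclideanSpace.proj (𝕜 := ℝ) i).contDiff.comp contDiff_fst.snd.snd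

theorem contDiffOn_thermoPart {S : ℝ × ℝ → ℝ} (hS : ContDiffOn ℝ ∞ S (I ×ˢ J)) :
    ContDiffOn ℝ ∞ (fun y : State n × Grad n => S (y.1.2.1, y.1.1)) (stateDomain n I J ×ˢ univ) :=
  hS.comp (contDiff_fst.snd.fst.prodMk contDiff_fst.fst).contDiffOn
    fun _ hy => ⟨hy.1.2, hy.1.1⟩

variable {v : Field n} (hv : ContDiff ℝ ∞ v)
include hv

theorem pd_dens_eq (x : Space n) (j : Fin n) :
    pd j (dens v) x = (fderiv ℝ v x (EuclideanSpace.single j 1)).1 := by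
  have h1 := (hv.differentiable (by simp) x).hasFDerivAt
  change fderiv ℝ (fun y => (v y).1) x _ = _
  rw [h1.fst.fderiv]; rfl

theorem pd_pres_eq (x : Space n) (j : Fin n) :
    pd j (pres v) x = (fderiv ℝ v x (EuclideanSpace.single j 1)).2.1 := by
  have h1 := (hv.differentiable (by simp) x).hasFDerivAt
  change fderiv ℝ (fun y => (v y).2.1) x _ = _
  rw [h1.snd.fst.fderiv]; rfl

theorem ug_eq (x : Space n) (i j : Fin n) :
    ug v x i j = (fderiv ℝ v x (EuclideanSpace.single j 1)).2.2 i := by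
  have h1 := (hv.differentiable (by simp) x).hasFDerivAt
  have h2 := (EuclideanSpace.proj (𝕜 := ℝ) i).hasFDerivAt.comp x h1.snd.snd
  change fderiv ℝ (fun y => (v y).2.2 i) x _ = _
  exact congrArg (fun L => L (EuclideanSpace.single j 1)) h2.fderiv

end Local

/-! ### Conserved and trivial densities -/

section Conserved

variable {m : ℕ} (hm : 1 ≤ m) {I J : Set ℝ} {F S : ℝ × ℝ → ℝ} (hI : IsOpen I) (hJ' : IsOpen J)
  (hJ : ∀ r ∈ J, 0 < r)

theorem isTrivial_entropyVorticity_add (h : n = 2 * m) (hS : ContDiffOn ℝ ∞ S (I ×ˢ J)) :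
    IsTrivial I J (fun v x => entropyVorticity h S v x + circulatoryEntropy hm h S v x) := by
  have h2 : 2 + 2 * (m - 1) = n := by omega
  refine ⟨_, ?_, fun t v hv x => entropyVorticity_add_circulatoryEntropy hm h hS hv x⟩
  refine isLocalVector_of_first_order (Ψ := fun y => WithLp.toLp 2 fun j => star h2
    (fun a => S (y.1.2.1, y.1.1) * y.1.2.2 (a 0) * if a 1 = j then 1 else 0)
    (fun _ i j => (y.2 (EuclideanSpace.single j 1)).2.2 i)) ?_ ?_
  · refine contDiffOn_of_apply fun j => ?_
    exact fun y hy => contDiffWithinAt_star h2 (fun a =>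
      (((contDiffOn_thermoPart hS).mul (contDiff_velPart _).contDiffOn).mul contDiffOn_const) y hy)
      fun _ i j => (contDiff_ugPart i j).contDiffAt.contDiffWithinAt
  · intro t v hv x
    simp only [← ug_eq hv.1]
    rfl

include hI hJ' hJ hm in
theorem isConserved_entropyVorticity (h : n = 2 * m) (hJo : J.OrdConnected) (hJ₀ : J.Nonempty)
    (hF : ContDiffOn ℝ ∞ F (I ×ˢ J)) (hS : IsEntropy F I J S) :
    IsConserved F I J (entropyVorticity h S) := by
  have h0 : 0 + 2 * m = n := by omega
  have h2 : 2 + 2 * (m - 1) = n := by omega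
  -- No energy function is given here, so the flux is built from a primitive in ρ of S/ρ².
  obtain ⟨B, hB, hBS⟩ := exists_derivRho_eq hI hJ' hJo hJ₀ (g := fun z => S z * z.2⁻¹ ^ 2)
    (hS.1.mul ((contDiffOn_snd.inv fun z hz => (hJ _ hz.2).ne').pow 2))
  refine ⟨_, ?_, fun t v hv x => timeDeriv_entropyVorticity hm h hI hJ' hJ hF hS hB hBS hv x⟩
  refine isLocalVector_of_first_order (Ψ := fun y => WithLp.toLp 2 fun j =>
    star h0 (fun _ => S (y.1.2.1, y.1.1))
      (fun _ i j => (y.2 (EuclideanSpace.single j 1)).2.2 i) * y.1.2.2 j - m * star h2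
    (fun a => B (y.1.2.1, y.1.1) * (y.2 (EuclideanSpace.single (a 0) 1)).2.1 *
      if a 1 = j then 1 else 0)
    (fun _ i j => (y.2 (EuclideanSpace.single j 1)).2.2 i)) ?_ ?_
  · refine contDiffOn_of_apply fun j => ContDiffOn.sub (ContDiffOn.mul ?_
      (contDiff_velPart _).contDiffOn) (contDiffOn_const.mul ?_)
    · exact fun y hy => contDiffWithinAt_star h0 (fun a => contDiffOn_thermoPart hS.1 y hy)
        fun _ i j => (contDiff_ugPart i j).contDiffAt.contDiffWithinAt
    · exact fun y hy => contDiffWithinAt_star h2 (fun a =>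
        (((contDiffOn_thermoPart hB).mul (contDiff_gradPart _).snd.fst.contDiffOn).mul
          contDiffOn_const) y hy)
        fun _ i j => (contDiff_ugPart i j).contDiffAt.contDiffWithinAt
  · intro t v hv x
    simp only [← ug_eq hv.1, ← pd_pres_eq hv.1, entropyVorticity_eq]
    rfl

include hm in
theorem isTrivial_inner_vortVector (h : n = 2 * m + 1) (b : Space n) :
    IsTrivial I J (fun v x => inner ℝ b (vortVector h v x)) := by
  have h3 : 3 + 2 * (m - 1) = n := by omega
  refine ⟨_, ?_, fun t v hv x => inner_vortVector_eq_divergence hm h b hv.1 x⟩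
  refine isLocalVector_of_first_order (Ψ := fun y => WithLp.toLp 2 fun j => star h3
    (fun a => b (a 0) * y.1.2.2 (a 1) * if a 2 = j then 1 else 0)
    (fun _ i j => (y.2 (EuclideanSpace.single j 1)).2.2 i)) ?_ ?_
  · refine contDiffOn_of_apply fun j => ?_
    exact fun y hy => contDiffWithinAt_star h3 (fun a =>
      ((contDiff_const.mul (contDiff_velPart _)).mul contDiff_const).contDiffAt.contDiffWithinAt)
      fun _ i j => (contDiff_ugPart i j).contDiffAt.contDiffWithinAt
  · intro t v hv x
    simp only [← ug_eq hv.1]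
    rfl

include hJ hm in
theorem isConserved_inner_vortVector (h : n = 2 * m + 1) (hF : ContDiffOn ℝ ∞ F (I ×ˢ J))
    (b : Space n) : IsConserved F I J (fun v x => inner ℝ b (vortVector h v x)) := by
  have h1 : 1 + 2 * m = n := by omega
  have h3 : 3 + 2 * (m - 1) = n := by omega
  refine ⟨_, ?_, fun t v hv x => timeDeriv_inner_vortVector hm h hJ hF hv b x⟩
  refine isLocalVector_of_first_order (Ψ := fun y => WithLp.toLp 2 fun j =>
    star h1 (fun a => b (a 0)) (fun _ i j => (y.2 (EuclideanSpace.single j 1)).2.2 i) * y.1.2.2 j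
    - star h1 (fun a => (∑ l, b l * y.1.2.2 l) * if a 0 = j then 1 else 0)
      (fun _ i j => (y.2 (EuclideanSpace.single j 1)).2.2 i)
    + m * star h3 (fun a => b (a 0) * ((y.1.1)⁻¹ * (y.2 (EuclideanSpace.single (a 1) 1)).2.1) *
        if a 2 = j then 1 else 0)
      (fun _ i j => (y.2 (EuclideanSpace.single j 1)).2.2 i)) ?_ ?_
  · refine contDiffOn_of_apply fun j => ContDiffOn.add (ContDiffOn.sub (ContDiffOn.mul ?_
      (contDiff_velPart _).contDiffOn) ?_) (contDiffOn_const.mul ?_)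
    · exact fun y hy => contDiffWithinAt_star h1 (fun a => contDiffWithinAt_const)
        fun _ i j => (contDiff_ugPart i j).contDiffAt.contDiffWithinAt
    · exact fun y hy => contDiffWithinAt_star h1 (fun a => ((ContDiff.sum fun l _ =>
        contDiff_const.mul (contDiff_velPart l)).mul contDiff_const).contDiffAt.contDiffWithinAt)
        fun _ i j => (contDiff_ugPart i j).contDiffAt.contDiffWithinAt
    · refine fun y hy => contDiffWithinAt_star h3 (fun a => ContDiffWithinAt.mul
        (contDiffWithinAt_const.mul (ContDiffWithinAt.mul (ContDiffWithinAt.inv ?_ ?_) ?_))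
        contDiffWithinAt_const)
        fun _ i j => (contDiff_ugPart i j).contDiffAt.contDiffWithinAt
      · exact contDiff_fst.fst.contDiffAt.contDiffWithinAt
      · exact (hJ _ hy.1.1).ne'
      · exact (contDiff_gradPart _).snd.fst.contDiffAt.contDiffWithinAt
  · intro t v hv x
    simp only [← ug_eq hv.1, ← pd_pres_eq hv.1, inner_vortVector]
    rfl

end Conserved

end GasDynamics
end

noncomputable section

namespace GasDynamics

variable {n : ℕ} {V : Type*} [NormedAddCommGroup V] [NormedSpace ℝ V]

open Function Set MeasureTheory

/-! ### Null Lagrangians of first order -/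

/-- Smooth functions on `ℝⁿ` with values in `D`. -/
def IsSmoothInto (D : Set V) (v : Space n → V) : Prop :=
  ContDiff ℝ ∞ v ∧ ∀ x, v x ∈ D

/-- A Lagrangian `L(v, ∇v)` that is the divergence of a local vector. -/
def IsNullLagrangian (D : Set V) (L : V × (Space n →L[ℝ] V) → ℝ) : Prop :=
  ∃ Y : (Space n → V) → Space n → Space n,
    (∀ v, IsSmoothInto D v → ContDiff ℝ ∞ (Y v)) ∧
    (∀ v w, IsSmoothInto D v → IsSmoothInto D w → ∀ x, v =ᶠ[nhds x] w → Y v x = Y w x) ∧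
    ∀ v, IsSmoothInto D v → ∀ x, L (v x, fderiv ℝ v x) = divergence (Y v) x

theorem IsLocalVector.isNullLagrangian {I J : Set ℝ} {L : State n × Grad n → ℝ}
    {X : ℝ → Field n → Space n → Space n} (hX : IsLocalVector I J X) (t : ℝ)
    (hL : ∀ v, Admissible I J v → ∀ x, L (v x, fderiv ℝ v x) = divergence (X t v) x) :
    IsNullLagrangian (stateDomain n I J) L :=
  ⟨X t, fun _ hv => hX.contDiff t hv, fun _ _ hv hw _ h => hX.congr t hv hw h, hL⟩

theorem integral_pd_eq_zero {f : Space n → ℝ} (hf : ContDiff ℝ ∞ f) (hc : HasCompactSupport f)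
    (i : Fin n) : ∫ x, pd i f x = 0 := by
  have h1 : HasCompactSupport (fun x => fderiv ℝ f x (EuclideanSpace.single i 1)) :=
    hc.fderiv_apply (𝕜 := ℝ) _
  have h2 : Continuous (fun x => fderiv ℝ f x (EuclideanSpace.single i 1)) :=
    (contDiff_pd hf i).continuous
  have h3 := integral_mul_fderiv_eq_neg_fderiv_mul_of_integrable (μ := volume)
    (f := fun _ : Space n => (1 : ℝ)) (g := f) (v := EuclideanSpace.single i 1)
    (by simp) (by simpa using h2.integrable_of_hasCompactSupport h1)
    (by simpa using hf.continuous.integrable_of_hasCompactSupport hc)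
    (fun _ _ => differentiableAt_const _) (fun _ _ => hf.differentiable (by simp) _)
  simpa [pd] using h3

theorem hasFDerivAt_fderiv_comp {E X : Type*} [NormedAddCommGroup E] [NormedSpace ℝ E]
    [NormedAddCommGroup X] [NormedSpace ℝ X] {L : E → ℝ} {g : X → E} {g' : X →L[ℝ] E} {x : X}
    {z : E} (hz : g x = z) (hL : DifferentiableAt ℝ (fderiv ℝ L) z) (hg : HasFDerivAt g g' x)
    (b : E) : HasFDerivAt (fun y => fderiv ℝ L (g y) b)
      (((fderiv ℝ (fderiv ℝ L) z).comp g').flip b) x := by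
  subst hz
  have h1 := (hL.hasFDerivAt.comp x hg).clm_apply (hasFDerivAt_const b x)
  refine h1.congr_fderiv ?_
  ext1 y
  simp

theorem hasDerivAt_fderiv_comp {E : Type*} [NormedAddCommGroup E] [NormedSpace ℝ E]
    {L : E → ℝ} {g : ℝ → E} {g' : E} {t : ℝ} {z : E} (hz : g t = z)
    (hL : DifferentiableAt ℝ (fderiv ℝ L) z) (hg : HasDerivAt g g' t)
    (b : E) : HasDerivAt (fun y => fderiv ℝ L (g y) b) (fderiv ℝ (fderiv ℝ L) z g' b) t := by
  have h1 := (hasFDerivAt_fderiv_comp hz hL hg.hasFDerivAt b).hasDerivAt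
  refine h1.congr_deriv ?_
  simp

section Null

variable {D : Set V} {L : V × (Space n →L[ℝ] V) → ℝ}

theorem contDiff_apply_coord {Z : Space n → Space n} (hZ : ContDiff ℝ ∞ Z) (i : Fin n) :
    ContDiff ℝ ∞ (fun x => Z x i) := (EuclideanSpace.proj (𝕜 := ℝ) i).contDiff.comp hZ

/-- Outside `K` the two fields agree near every point, hence so do their fluxes. The difference of
Lagrangians is therefore the divergence of a compactly supported vector field. -/
theorem IsNullLagrangian.integral_sub_eq_zero (hL : IsNullLagrangian D L) {v w : (Space n → V)}
    (hv : IsSmoothInto D v) (hw : IsSmoothInto D w) {K : Set (Space n)} (hK : IsCompact K)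
    (hvw : ∀ x ∉ K, v x = w x) :
    ∫ x, (L (v x, fderiv ℝ v x) - L (w x, fderiv ℝ w x)) = 0 := by
  obtain ⟨Y, hY, hloc, hdiv⟩ := hL
  have hs : ∀ i, ContDiff ℝ ∞ (fun x => Y v x i - Y w x i) := fun i =>
    (contDiff_apply_coord (hY v hv) i).sub (contDiff_apply_coord (hY w hw) i)
  have hc : ∀ i, HasCompactSupport (fun x => Y v x i - Y w x i) := fun i => by
    refine HasCompactSupport.intro hK fun x hx => ?_
    have : v =ᶠ[nhds x] w := by
      filter_upwards [hK.isClosed.isOpen_compl.mem_nhds hx] with y hy using hvw y hy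
    rw [hloc v w hv hw x this, sub_self]
  have e : ∀ x, L (v x, fderiv ℝ v x) - L (w x, fderiv ℝ w x) =
      ∑ i, pd i (fun x => Y v x i - Y w x i) x := by
    intro x
    rw [hdiv v hv, hdiv w hw, divergence, divergence, ← Finset.sum_sub_distrib]
    refine Finset.sum_congr rfl fun i _ => ?_
    rw [pd_sub ((contDiff_apply_coord (hY v hv) i).differentiable (by simp) x)
      ((contDiff_apply_coord (hY w hw) i).differentiable (by simp) x)]
  simp only [e]
  rw [integral_finsetSum]
  · exact Finset.sum_eq_zero fun i _ => integral_pd_eq_zero (hs i) (hc i) i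
  · intro i _
    exact (contDiff_pd (hs i) i).continuous.integrable_of_hasCompactSupport
      ((hc i).fderiv_apply (𝕜 := ℝ) _)

variable (hD : IsOpen D)
include hD

theorem isOpen_gradDomain : IsOpen (D ×ˢ (univ : Set (Space n →L[ℝ] V))) :=
  (hD).prod isOpen_univ

variable (hLs : ContDiffOn ℝ ∞ L (D ×ˢ univ))
include hLs

theorem contDiffOn_fderiv_lagrangian :
    ContDiffOn ℝ ∞ (fderiv ℝ L) (D ×ˢ univ) :=
  hLs.fderiv_of_isOpen (isOpen_gradDomain hD) (by simp)

/-- The integral of the difference vanishes for all small multiples of the perturbation, so its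
derivative at zero does too. Differentiation under the integral is justified by a bound on the
compact support of the cut-off. -/
theorem IsNullLagrangian.first_variation (hL : IsNullLagrangian D L) {v : (Space n → V)}
    (hv : IsSmoothInto D v) (a : V) {χ : Space n → ℝ} (hχ : ContDiff ℝ ∞ χ)
    (hc : HasCompactSupport χ) :
    ∫ x, fderiv ℝ L (v x, fderiv ℝ v x) (χ x • a, (fderiv ℝ χ x).smulRight a) = 0 := by
  let W : ℝ × Space n → V × (Space n →L[ℝ] V) := fun z =>
    (v z.2 + z.1 • χ z.2 • a, fderiv ℝ v z.2 + z.1 • (fderiv ℝ χ z.2).smulRight a)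
  have hW : Continuous W := by
    have h1 := (hv.1.continuous_fderiv (by simp))
    have h2 := (hχ.continuous_fderiv (by simp))
    have h3 : Continuous (fun x => (fderiv ℝ χ x).smulRight a) :=
      (ContinuousLinearMap.smulRightL ℝ (Space n) (V)).continuous₂.comp
        (h2.prodMk continuous_const)
    refine Continuous.prodMk ?_ ?_
    · exact (hv.1.continuous.comp continuous_snd).add
        (continuous_fst.smul ((hχ.continuous.comp continuous_snd).smul continuous_const))
    · exact (h1.comp continuous_snd).add (continuous_fst.smul (h3.comp continuous_snd))
  -- Compactness of the support gives one interval of parameters for which the perturbed field stays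
  -- in the open set `D` everywhere.
  have hev : ∀ᶠ ε in nhds (0 : ℝ), ∀ x ∈ tsupport χ, (W (ε, x)).1 ∈ D := by
    refine IsCompact.eventually_forall_of_forall_eventually hc fun y _ => ?_
    refine (hW.fst.continuousAt (x := ((0 : ℝ), y))).eventually (hD.mem_nhds ?_)
    simpa [W] using hv.2 y
  obtain ⟨δ, hδ, hball⟩ := Metric.eventually_nhds_iff.1 hev
  have hmem : ∀ ε, |ε| < δ → ∀ x, (W (ε, x)).1 ∈ D := by
    intro ε hε x
    by_cases hx : x ∈ tsupport χ
    · exact hball (by simpa [Real.dist_eq] using hε) x hx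
    · simpa [W, image_eq_zero_of_notMem_tsupport hx] using hv.2 x
  have hadm : ∀ ε, |ε| < δ → IsSmoothInto D (fun x => v x + ε • χ x • a) := fun ε hε =>
    ⟨hv.1.add ((hχ.smul (contDiff_const (c := a))).const_smul ε), hmem ε hε⟩
  have hfd : ∀ (ε : ℝ) x, fderiv ℝ (fun x => v x + ε • χ x • a) x =
      fderiv ℝ v x + ε • (fderiv ℝ χ x).smulRight a := by
    intro ε x
    have h1 := (hv.1.differentiable (by simp) x).hasFDerivAt
    have hdχ : DifferentiableAt ℝ χ x := hχ.differentiable (by simp) x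
    have h2 := (hdχ.hasFDerivAt.smul_const a).const_smul ε
    exact (h1.add h2).fderiv
  set G : ℝ → Space n → ℝ := fun ε x => L (W (ε, x)) - L (W (0, x))
  set G' : ℝ → Space n → ℝ := fun ε x =>
    fderiv ℝ L (W (ε, x)) (χ x • a, (fderiv ℝ χ x).smulRight a)
  have hG0 : ∀ ε, |ε| < δ → ∫ x, G ε x = 0 := by
    intro ε hε
    have h1 := hL.integral_sub_eq_zero (hadm ε hε) hv hc (fun x hx => by
      simp [image_eq_zero_of_notMem_tsupport hx])
    simpa [G, W, hfd] using h1
  have hDL := contDiffOn_fderiv_lagrangian hD hLs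
  have hW' : ContinuousOn (fun z : ℝ × Space n => G' z.1 z.2) (Ioo (-δ) δ ×ˢ univ) := by
    have h1 : ContinuousOn (fun z => fderiv ℝ L (W z)) (Ioo (-δ) δ ×ˢ univ) :=
      hDL.continuousOn.comp hW.continuousOn fun z hz =>
        ⟨hmem z.1 (abs_lt.2 hz.1) z.2, mem_univ _⟩
    have h2 : Continuous (fun z : ℝ × Space n => (χ z.2 • a, (fderiv ℝ χ z.2).smulRight a)) := by
      refine Continuous.prodMk ((hχ.continuous.comp continuous_snd).smul continuous_const) ?_
      exact (ContinuousLinearMap.smulRightL ℝ (Space n) (V)).continuous₂.comp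
        (((hχ.continuous_fderiv (by simp)).comp continuous_snd).prodMk continuous_const)
    exact h1.clm_apply h2.continuousOn
  have hzero : ∀ ε, ∀ x ∉ tsupport χ, G' ε x = 0 := by
    intro ε x hx
    have h2 : fderiv ℝ χ x = 0 := by
      by_contra h
      exact hx (support_fderiv_subset ℝ h)
    change fderiv ℝ L _ (χ x • a, (fderiv ℝ χ x).smulRight a) = 0
    rw [h2, image_eq_zero_of_notMem_tsupport hx, zero_smul, ContinuousLinearMap.zero_smulRight,
      Prod.mk_zero_zero, map_zero]
  have hcomp : IsCompact (Icc (-(δ / 2)) (δ / 2) ×ˢ tsupport χ) := isCompact_Icc.prod hc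
  obtain ⟨C, hC⟩ := hcomp.exists_bound_of_continuousOn (hW'.mono (prod_mono
    (fun ε hε => ⟨by linarith [hε.1], by linarith [hε.2]⟩) (subset_univ _)))
  have habs : ∀ ε ∈ Icc (-(δ / 2)) (δ / 2), |ε| < δ := fun ε hε =>
    abs_lt.2 ⟨by linarith [hε.1], by linarith [hε.2]⟩
  have hs : Icc (-(δ / 2)) (δ / 2) ∈ nhds (0 : ℝ) := Icc_mem_nhds (by linarith) (by linarith)
  have h0 : (0 : ℝ) ∈ Icc (-(δ / 2)) (δ / 2) := ⟨by linarith, by linarith⟩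
  have hGc : ∀ ε ∈ Icc (-(δ / 2)) (δ / 2), Continuous (fun x => L (W (ε, x))) := by
    intro ε hε
    rw [← continuousOn_univ]
    exact hLs.continuousOn.comp (hW.comp (continuous_const.prodMk continuous_id)).continuousOn
      fun x _ => ⟨hmem ε (habs ε hε) x, mem_univ _⟩
  have hder := hasDerivAt_integral_of_dominated_loc_of_deriv_le (μ := volume) (F := G) (F' := G')
    (bound := (tsupport χ).indicator fun _ => C) hs
    (by filter_upwards [hs] with ε hε using
      ((hGc ε hε).sub (hGc 0 h0)).aestronglyMeasurable)
    (by simp [G])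
    (by
      have : Continuous (G' 0) := by
        rw [← continuousOn_univ]
        exact hW'.comp (f := fun x => ((0 : ℝ), x)) (continuousOn_const.prodMk continuousOn_id)
          fun x _ => ⟨⟨by linarith, by linarith⟩, mem_univ _⟩
      exact this.aestronglyMeasurable)
    (.of_forall fun x ε hε => by
      by_cases hx : x ∈ tsupport χ
      · simpa [hx] using hC (ε, x) ⟨hε, hx⟩
      · simp [hx, hzero ε x hx])
    ((integrable_indicator_iff (isClosed_tsupport χ).measurableSet).2
      (integrableOn_const hc.measure_lt_top.ne))
    (.of_forall fun x ε hε => by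
      have h1 : DifferentiableAt ℝ L (W (ε, x)) :=
        (hLs.contDiffAt ((isOpen_gradDomain hD).mem_nhds
          ⟨hmem ε (habs ε hε) x, mem_univ _⟩)).differentiableAt (by simp)
      have h2 : HasDerivAt (fun ε => W (ε, x)) (χ x • a, (fderiv ℝ χ x).smulRight a) ε := by
        refine HasDerivAt.prodMk ?_ ?_
        · simpa using ((hasDerivAt_id ε).smul_const (χ x • a)).const_add (v x)
        · simpa using ((hasDerivAt_id ε).smul_const ((fderiv ℝ χ x).smulRight a)).const_add
            (fderiv ℝ v x)
      exact (HasFDerivAt.comp_hasDerivAt ε h1.hasFDerivAt h2).sub_const _)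
  have h1 : HasDerivAt (fun ε => ∫ x, G ε x) 0 0 := by
    refine (hasDerivAt_const (0 : ℝ) (0 : ℝ)).congr_of_eventuallyEq ?_
    filter_upwards [hs] with ε hε using hG0 ε (habs ε hε)
  have h2 := hder.2.unique h1
  simpa [G', W] using h2

/-- The gradient with the single nonzero derivative `∂_k v = a`. -/
def unitGrad (k : Fin n) (a : V) : Space n →L[ℝ] V :=
  (EuclideanSpace.proj (𝕜 := ℝ) k).smulRight a

omit hD hLs in
theorem smulRight_eq_sum (f : Space n →L[ℝ] ℝ) (a : V) :
    f.smulRight a = ∑ k, f (EuclideanSpace.single k 1) • unitGrad k a := by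
  ext1 x
  simp only [ContinuousLinearMap.smulRight_apply, unitGrad, sum_apply, smul_apply,
    PiLp.proj_apply, smul_smul, ← Finset.sum_smul]
  congr 1
  conv_lhs => rw [← (EuclideanSpace.basisFun (Fin n) ℝ).sum_repr x, map_sum]
  refine Finset.sum_congr rfl fun k _ => ?_
  simp [mul_comm]

/-- Integration by parts in the first variation moves all derivatives off the test function. The
fundamental lemma gives the equation almost everywhere, and continuity gives it everywhere. -/
theorem IsNullLagrangian.euler_lagrange (hL : IsNullLagrangian D L) {v : (Space n → V)}
    (hv : IsSmoothInto D v) (a : V) (x : Space n) :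
    fderiv ℝ L (v x, fderiv ℝ v x) (a, 0) =
      ∑ k, pd k (fun y => fderiv ℝ L (v y, fderiv ℝ v y) (0, unitGrad k a)) x := by
  have hv' : ContDiff ℝ ∞ (fderiv ℝ v) := hv.1.fderiv_right (by simp)
  have hDL : ContDiff ℝ ∞ (fun y => fderiv ℝ L (v y, fderiv ℝ v y)) :=
    (contDiffOn_fderiv_lagrangian hD hLs).comp_contDiff (hv.1.prodMk hv')
      fun y => ⟨hv.2 y, mem_univ _⟩
  have hP : ContDiff ℝ ∞ (fun y => fderiv ℝ L (v y, fderiv ℝ v y) (a, 0)) :=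
    hDL.clm_apply contDiff_const
  have hQ : ∀ k, ContDiff ℝ ∞ (fun y => fderiv ℝ L (v y, fderiv ℝ v y) (0, unitGrad k a)) :=
    fun k => hDL.clm_apply contDiff_const
  have hR : Continuous (fun y => fderiv ℝ L (v y, fderiv ℝ v y) (a, 0) -
      ∑ k, pd k (fun y => fderiv ℝ L (v y, fderiv ℝ v y) (0, unitGrad k a)) y) :=
    hP.continuous.sub (continuous_finsetSum _ fun k _ => (contDiff_pd (hQ k) k).continuous)
  have key := ae_eq_zero_of_integral_contDiff_smul_eq_zero (μ := volume)
    hR.locallyIntegrable fun χ hχ hc => by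
      have h1 := hL.first_variation hD hLs hv a hχ hc
      have hχQ : ∀ k, ∫ y, pd k (fun y => χ y *
          fderiv ℝ L (v y, fderiv ℝ v y) (0, unitGrad k a)) y = 0 := fun k =>
        integral_pd_eq_zero (hχ.mul (hQ k)) hc.mul_right k
      have e : ∀ y, χ y • (fderiv ℝ L (v y, fderiv ℝ v y) (a, 0) -
          ∑ k, pd k (fun y => fderiv ℝ L (v y, fderiv ℝ v y) (0, unitGrad k a)) y) =
          fderiv ℝ L (v y, fderiv ℝ v y) (χ y • a, (fderiv ℝ χ y).smulRight a) -
          ∑ k, pd k (fun y => χ y *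
            fderiv ℝ L (v y, fderiv ℝ v y) (0, unitGrad k a)) y := by
        intro y
        have e1 : fderiv ℝ L (v y, fderiv ℝ v y) (χ y • a, (fderiv ℝ χ y).smulRight a) =
            χ y * fderiv ℝ L (v y, fderiv ℝ v y) (a, 0) +
            ∑ k, pd k χ y * fderiv ℝ L (v y, fderiv ℝ v y) (0, unitGrad k a) := by
          have : ((χ y • a, (fderiv ℝ χ y).smulRight a) : V × (Space n →L[ℝ] V)) =
              χ y • (a, 0) + ∑ k, pd k χ y • ((0, unitGrad k a) : V × (Space n →L[ℝ] V)) := by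
            rw [smulRight_eq_sum]
            ext1
            · simp [Prod.fst_sum]
            · simp [Prod.snd_sum, pd, smul_zero]
          rw [this, map_add, map_smul, map_sum]
          simp only [map_smul, smul_eq_mul]
        have e2 : ∀ k, pd k (fun y => χ y *
            fderiv ℝ L (v y, fderiv ℝ v y) (0, unitGrad k a)) y =
            χ y * pd k (fun y => fderiv ℝ L (v y, fderiv ℝ v y) (0, unitGrad k a)) y +
            fderiv ℝ L (v y, fderiv ℝ v y) (0, unitGrad k a) * pd k χ y := fun k =>
          pd_mul (hχ.differentiable (by simp) y) ((hQ k).differentiable (by simp) y) k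
        simp only [e1, e2, Finset.sum_add_distrib, smul_eq_mul, mul_sub, Finset.mul_sum,
          mul_comm (pd _ χ y)]
        ring
      have hcχ : HasCompactSupport (fun y =>
          fderiv ℝ L (v y, fderiv ℝ v y) (χ y • a, (fderiv ℝ χ y).smulRight a)) := by
        refine HasCompactSupport.intro hc fun y hy => ?_
        have h2 : fderiv ℝ χ y = 0 := by
          by_contra h
          exact hy (support_fderiv_subset ℝ h)
        rw [h2, image_eq_zero_of_notMem_tsupport hy, zero_smul,
          ContinuousLinearMap.zero_smulRight, Prod.mk_zero_zero, map_zero]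
      have hcont : Continuous (fun y =>
          fderiv ℝ L (v y, fderiv ℝ v y) (χ y • a, (fderiv ℝ χ y).smulRight a)) := by
        refine hDL.continuous.clm_apply (Continuous.prodMk (hχ.continuous.smul continuous_const) ?_)
        exact (ContinuousLinearMap.smulRightL ℝ (Space n) (V)).continuous₂.comp
          ((hχ.continuous_fderiv (by simp)).prodMk continuous_const)
      have hint : ∀ k, Integrable (pd k (fun y => χ y *
            fderiv ℝ L (v y, fderiv ℝ v y) (0, unitGrad k a))) := fun k =>
        (contDiff_pd (hχ.mul (hQ k)) k).continuous.integrable_of_hasCompactSupport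
          ((hc.mul_right (f' := fun y => fderiv ℝ L (v y, fderiv ℝ v y)
            (0, unitGrad k a))).fderiv_apply (𝕜 := ℝ) _)
      simp only [e]
      rw [integral_sub (hcont.integrable_of_hasCompactSupport hcχ)
        (integrable_finsetSum _ fun k _ => hint k), h1, integral_finsetSum _ fun k _ => hint k,
        Finset.sum_eq_zero fun k _ => hχQ k, sub_zero]
  have h1 := congrFun (Measure.eq_of_ae_eq key hR continuous_const) x
  exact sub_eq_zero.1 h1

omit hLs in
-- Polynomial test fields need not take values in `D` globally. Away from the origin they are
-- contracted to the constant `g 0` by a cut-off, so that all values remain in a ball contained in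
-- `D`.
theorem exists_isSmoothInto_eventuallyEq {g : (Space n → V)} (hg : ContDiff ℝ ∞ g)
    (h0 : g 0 ∈ D) :
    ∃ v, IsSmoothInto D v ∧ v =ᶠ[nhds 0] g := by
  obtain ⟨r, hr, hball⟩ := Metric.isOpen_iff.1 (hD) _ h0
  obtain ⟨δ, hδ, hgδ⟩ := Metric.continuousAt_iff.1 (hg.continuous.continuousAt (x := 0)) r hr
  let χ : ContDiffBump (0 : Space n) := ⟨δ / 2, δ, by linarith, by linarith⟩
  refine ⟨fun x => g 0 + χ x • (g x - g 0), ⟨contDiff_const.add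
    (χ.contDiff.smul (hg.sub contDiff_const)), fun x => hball ?_⟩, ?_⟩
  · rw [Metric.mem_ball, dist_eq_norm, add_sub_cancel_left, norm_smul]
    by_cases hx : dist x 0 < δ
    · have h1 := hgδ hx
      rw [dist_eq_norm] at h1
      have h2 : ‖χ x‖ ≤ 1 := by
        rw [Real.norm_of_nonneg χ.nonneg]; exact χ.le_one
      calc ‖χ x‖ * ‖g x - g 0‖ ≤ 1 * ‖g x - g 0‖ := by gcongr
        _ < r := by rwa [one_mul]
    · rw [χ.zero_of_le_dist (not_lt.1 hx)]
      simpa using hr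
  · filter_upwards [χ.eventuallyEq_one] with x hx
    simp [hx]

/-- The Euler-Lagrange equation at the origin of the quadratic field
`s + M x + ½ f(x)² c`. -/
theorem IsNullLagrangian.euler_lagrange_quadratic (hL : IsNullLagrangian D L) {s : V}
    (hs : s ∈ D) (M : Space n →L[ℝ] V) (f : Space n →L[ℝ] ℝ) (a c : V) :
    fderiv ℝ L (s, M) (a, 0) =
      ∑ k, fderiv ℝ (fderiv ℝ L) (s, M)
        (M (EuclideanSpace.single k 1), f (EuclideanSpace.single k 1) • f.smulRight c)
        (0, unitGrad k a) := by
  let g : (Space n → V) := fun x => s + M x + ((2 : ℝ)⁻¹ * f x ^ 2) • c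
  have hg : ContDiff ℝ ∞ g := (contDiff_const.add M.contDiff).add
    ((contDiff_const.mul (f.contDiff.pow 2)).smul contDiff_const)
  have hg' : ∀ x, fderiv ℝ g x = M + f x • f.smulRight c := by
    intro x
    have h1 : HasFDerivAt g _ x := (M.hasFDerivAt.const_add s).add
      (((f.hasFDerivAt (x := x).pow 2).const_mul (2 : ℝ)⁻¹).smul_const c)
    rw [h1.fderiv]
    congr 1
    ext1 y
    simp [smul_smul]
  obtain ⟨v, hv, hvg⟩ := exists_isSmoothInto_eventuallyEq hD hg (by simpa [g] using hs)
  have h1 := hL.euler_lagrange hD hLs hv a 0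
  have e0 : v 0 = s := by rw [hvg.eq_of_nhds]; simp [g]
  have e1 : fderiv ℝ v 0 = M := by rw [hvg.fderiv_eq, hg', map_zero, zero_smul, add_zero]
  rw [e0, e1] at h1
  rw [h1]
  refine Finset.sum_congr rfl fun k _ => ?_
  have hmem : (s, M) ∈ D ×ˢ (univ : Set (Space n →L[ℝ] V)) := ⟨hs, mem_univ _⟩
  have hd : DifferentiableAt ℝ (fderiv ℝ L) (s, M) :=
    ((contDiffOn_fderiv_lagrangian hD hLs).contDiffAt
      ((isOpen_gradDomain hD).mem_nhds hmem)).differentiableAt (by simp)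
  have ev : (fun y => fderiv ℝ L (v y, fderiv ℝ v y) (0, unitGrad k a)) =ᶠ[nhds 0]
      fun y => fderiv ℝ L (g y, M + f y • f.smulRight c) (0, unitGrad k a) := by
    filter_upwards [hvg, hvg.fderiv (𝕜 := ℝ)] with y hy hy'
    rw [hy, hy', hg']
  have h2 : HasFDerivAt (fun y => (g y, M + f y • f.smulRight c))
      (M.prod (f.smulRight (f.smulRight c))) (0 : Space n) := by
    refine HasFDerivAt.prodMk ?_ ?_
    · have := (hg.differentiable (by simp) 0).hasFDerivAt
      rwa [hg', map_zero, zero_smul, add_zero] at this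
    · have := f.hasFDerivAt (x := (0 : Space n))
      exact (this.smul_const (f.smulRight c)).const_add M
  have e2 : ((g 0, M + f 0 • f.smulRight c) : V × (Space n →L[ℝ] V)) = (s, M) := by
    rw [map_zero, zero_smul, add_zero]; simp [g]
  rw [pd, ev.fderiv_eq, (hasFDerivAt_fderiv_comp (g := fun y => (g y, M + f y • f.smulRight c)) e2 hd h2 _).fderiv]
  simp

/-- A null Lagrangian is affine in rank-one directions. -/
theorem IsNullLagrangian.rankOne_affine (hL : IsNullLagrangian D L) {s : V}
    (hs : s ∈ D) (M : Space n →L[ℝ] V) (f : Space n →L[ℝ] ℝ) (a : V) :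
    ∃ α β : ℝ, ∀ t : ℝ, L (s, M + t • f.smulRight a) = α + t * β := by
  have hmem : ∀ M, (s, M) ∈ D ×ˢ (univ : Set (Space n →L[ℝ] V)) :=
    fun M => ⟨hs, mem_univ _⟩
  have hnhds := fun M => (isOpen_gradDomain hD).mem_nhds (hmem M)
  -- The left side of the Euler-Lagrange equation depends only on the first jet. Comparing quadratic
  -- fields with `c = a` and `c = 0` isolates the terms containing second derivatives of the field,
  -- namely the second derivative of L along the rank-one direction.
  have key : ∀ M, fderiv ℝ (fderiv ℝ L) (s, M) (0, f.smulRight a) (0, f.smulRight a) = 0 := by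
    intro M
    have h1 := hL.euler_lagrange_quadratic hD hLs hs M f a a
    have h2 := hL.euler_lagrange_quadratic hD hLs hs M f a 0
    rw [h1, ← sub_eq_zero, ← Finset.sum_sub_distrib] at h2
    have e : ((0, f.smulRight a) : V × (Space n →L[ℝ] V)) =
        ∑ k, f (EuclideanSpace.single k 1) • ((0, unitGrad k a) : V × (Space n →L[ℝ] V)) := by
      conv_lhs => rw [smulRight_eq_sum]
      ext1
      · simp [Prod.fst_sum]
      · simp [Prod.snd_sum]
    rw [← h2]
    nth_rw 2 [e]
    rw [map_sum]
    refine Finset.sum_congr rfl fun k _ => ?_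
    have e2 : ((M (EuclideanSpace.single k 1), f (EuclideanSpace.single k 1) • f.smulRight a) -
        (M (EuclideanSpace.single k 1), f (EuclideanSpace.single k 1) • f.smulRight 0) :
        V × (Space n →L[ℝ] V)) = f (EuclideanSpace.single k 1) • (0, f.smulRight a) := by
      ext1 <;> simp
    rw [← _root_.sub_apply (F := V × (Space n →L[ℝ] V) →L[ℝ] ℝ), ← map_sub, e2, map_smul, map_smul,
      _root_.smul_apply]
  have hline : ∀ t : ℝ, HasDerivAt (fun t : ℝ => ((s, M + t • f.smulRight a) : V × (Space n →L[ℝ] V)))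
      (0, f.smulRight a) t := fun t => (hasDerivAt_const t s).prodMk
    (by simpa using ((hasDerivAt_id t).smul_const (f.smulRight a)).const_add M)
  have hd1 : ∀ t, HasDerivAt (fun t : ℝ => L (s, M + t • f.smulRight a))
      (fderiv ℝ L (s, M + t • f.smulRight a) (0, f.smulRight a)) t := fun t =>
    HasFDerivAt.comp_hasDerivAt t ((hLs.contDiffAt (hnhds _)).differentiableAt
      (by simp)).hasFDerivAt (hline t)
  have hd2 : ∀ t, HasDerivAt (fun t : ℝ => fderiv ℝ L (s, M + t • f.smulRight a)
      (0, f.smulRight a)) 0 t := fun t => by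
    refine (hasDerivAt_fderiv_comp rfl (((contDiffOn_fderiv_lagrangian hD hLs).contDiffAt
      (hnhds (M + t • f.smulRight a))).differentiableAt (by simp)) (hline t) _).congr_deriv ?_
    simp [key]
  have hconst : ∀ t, fderiv ℝ L (s, M + t • f.smulRight a) (0, f.smulRight a) =
      fderiv ℝ L (s, M) (0, f.smulRight a) := fun t => by
    have := is_const_of_deriv_eq_zero (fun t => (hd2 t).differentiableAt)
      (fun t => (hd2 t).deriv) t 0
    rwa [zero_smul, add_zero] at this
  refine ⟨L (s, M), fderiv ℝ L (s, M) (0, f.smulRight a), fun t => ?_⟩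
  have hd3 : ∀ t, HasDerivAt (fun t : ℝ => L (s, M + t • f.smulRight a) -
      t * fderiv ℝ L (s, M) (0, f.smulRight a)) 0 t := fun t => by
    have h1 := (hd1 t).sub ((hasDerivAt_id t).mul_const (fderiv ℝ L (s, M) (0, f.smulRight a)))
    refine h1.congr_deriv ?_
    rw [hconst]; ring
  have := is_const_of_deriv_eq_zero (fun t => (hd3 t).differentiableAt)
    (fun t => (hd3 t).deriv) t 0
  rw [zero_smul, add_zero, zero_mul, sub_zero] at this
  linarith

/-- The Euler-Lagrange equation for an affine field. -/
theorem IsNullLagrangian.euler_lagrange_affine (hL : IsNullLagrangian D L) {s : V}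
    (hs : s ∈ D) (M : Space n →L[ℝ] V) (a : V) :
    deriv (fun τ : ℝ => L (s + τ • a, M)) 0 =
      ∑ k, deriv (fun τ : ℝ => deriv (fun θ : ℝ =>
        L (s + τ • M (EuclideanSpace.single k 1), M + θ • unitGrad k a)) 0) 0 := by
  have hmem : ∀ z ∈ D, (z, M) ∈ D ×ˢ (univ : Set (Space n →L[ℝ] V)) := fun z hz =>
    ⟨hz, mem_univ _⟩
  have hd1 : ∀ z ∈ D, DifferentiableAt ℝ L (z, M) := fun z hz =>
    (hLs.contDiffAt ((isOpen_gradDomain hD).mem_nhds (hmem z hz))).differentiableAt (by simp)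
  have hd : DifferentiableAt ℝ (fderiv ℝ L) (s, M) :=
    ((contDiffOn_fderiv_lagrangian hD hLs).contDiffAt
      ((isOpen_gradDomain hD).mem_nhds (hmem s hs))).differentiableAt (by simp)
  have hline : ∀ b : V, HasDerivAt (fun τ : ℝ => s + τ • b) b 0 := fun b => by
    simpa using ((hasDerivAt_id (0 : ℝ)).smul_const b).const_add s
  have e0 : deriv (fun τ : ℝ => L (s + τ • a, M)) 0 = fderiv ℝ L (s, M) (a, 0) := by
    have h2 : HasDerivAt (fun τ : ℝ => (s + τ • a, M)) (a, 0) 0 :=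
      (hline a).prodMk (hasDerivAt_const _ _)
    exact (HasFDerivAt.comp_hasDerivAt_of_eq (0 : ℝ) (hd1 s hs).hasFDerivAt h2 (by simp)).deriv
  -- The covector zero makes the test field affine.
  rw [e0, hL.euler_lagrange_quadratic hD hLs hs M 0 a 0]
  refine Finset.sum_congr rfl fun k _ => ?_
  have h2 : HasDerivAt (fun τ : ℝ => (s + τ • M (EuclideanSpace.single k 1), M))
      (M (EuclideanSpace.single k 1), 0) 0 := (hline _).prodMk (hasDerivAt_const _ _)
  have e1 : (fun τ : ℝ => deriv (fun θ : ℝ =>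
      L (s + τ • M (EuclideanSpace.single k 1), M + θ • unitGrad k a)) 0) =ᶠ[nhds 0]
      fun τ => fderiv ℝ L (s + τ • M (EuclideanSpace.single k 1), M) (0, unitGrad k a) := by
    have hc : ContinuousAt (fun τ : ℝ => s + τ • M (EuclideanSpace.single k 1)) 0 :=
      (hline _).continuousAt
    filter_upwards [hc.eventually (hD.mem_nhds (by simpa using hs))] with τ hτ
    have h3 : HasDerivAt (fun θ : ℝ => (s + τ • M (EuclideanSpace.single k 1),
        M + θ • unitGrad k a)) (0, unitGrad k a) 0 := (hasDerivAt_const _ _).prodMk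
      (by simpa using ((hasDerivAt_id (0 : ℝ)).smul_const (unitGrad k a)).const_add M)
    exact (HasFDerivAt.comp_hasDerivAt_of_eq (0 : ℝ) (hd1 _ hτ).hasFDerivAt h3 (by simp)).deriv
  rw [e1.deriv_eq, (hasDerivAt_fderiv_comp (by simp) hd h2 _).deriv]
  simp

end Null

end GasDynamics
end

noncomputable section

namespace GasDynamics

variable {n : ℕ}

open Equiv Function

/-! ### Hodge duals of sums of simple two-forms -/

theorem prod_pos' {q r : ℕ} (h : q + 2 * r = n) (g : Fin n → ℝ) :
    ∏ x, g x = (∏ l, g (freePos h l)) * ∏ k, (g (fstPos h k) * g (sndPos h k)) := by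
  let e : Fin q ⊕ (Fin r ⊕ Fin r) → Fin n :=
    Sum.elim (freePos h) (Sum.elim (fstPos h) (sndPos h))
  have he : Bijective e := by
    refine (Fintype.bijective_iff_surjective_and_card e).2 ⟨fun x => ?_, ?_⟩
    · rcases pos_cases h x with ⟨l, rfl⟩ | ⟨k, rfl⟩ | ⟨k, rfl⟩
      · exact ⟨.inl l, rfl⟩
      · exact ⟨.inr (.inl k), rfl⟩
      · exact ⟨.inr (.inr k), rfl⟩
    · simp; omega
  rw [← he.prod_comp g, Fintype.prod_sum_type, Fintype.prod_sum_type, Finset.prod_mul_distrib]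
  rfl

section RankOne

variable {q r : ℕ} (h : q + 2 * r = n)

/-- Two factors share the same one-form α, so exchanging their first indices leaves the tensor
unchanged. -/
theorem star_rankOne_eq_zero (b : (Fin q → Fin n) → ℝ) (α β : Fin r → Fin n → ℝ)
    {φ : Fin r → Fin r} (hφ : ¬Injective φ) :
    star h b (fun k i j => α (φ k) i * β (φ k) j) = 0 := by
  obtain ⟨k, l, hkl, hne⟩ : ∃ k l, φ k = φ l ∧ k ≠ l := by
    simpa [Injective] using hφ
  refine alt_eq_zero_of_symm (p := fstPos h k) (r := fstPos h l)
    (by rwa [ne_eq, fstPos_inj]) fun s => ?_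
  have h1 : ∀ j, swap (fstPos h k) (fstPos h l) (freePos h j) = freePos h j := fun j =>
    swap_apply_of_ne_of_ne (freePos_ne_fstPos h _ _) (freePos_ne_fstPos h _ _)
  have h2 : ∀ j, swap (fstPos h k) (fstPos h l) (sndPos h j) = sndPos h j := fun j =>
    swap_apply_of_ne_of_ne (fstPos_ne_sndPos h _ _).symm (fstPos_ne_sndPos h _ _).symm
  have h3 : ∀ j, swap (fstPos h k) (fstPos h l) (fstPos h j) = fstPos h (swap k l j) := by
    intro j
    simp only [swap_apply_def, fstPos_inj]
    split_ifs <;> rfl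
  have h4 : ∀ j, φ (swap k l j) = φ j := by
    intro j
    simp only [swap_apply_def]
    split_ifs with h5 h5
    · rw [h5, hkl]
    · rw [h5, hkl]
    · rfl
  simp only [tens, comp_apply, h1, h2, h3, Finset.prod_mul_distrib]
  congr 2
  refine (Equiv.prod_comp (swap k l) _).symm.trans ?_
  refine Finset.prod_congr rfl fun j _ => ?_
  rw [h4, ← trans_apply, swap_swap, refl_apply]

/-- Expanding the product gives one term for each choice of summand in every slot. Repeated choices
vanish, and the r! bijective ones agree because two-forms commute. -/
theorem star_sum_rankOne (b : (Fin q → Fin n) → ℝ) (α β : Fin r → Fin n → ℝ) :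
    star h b (fun _ i j => ∑ c, α c i * β c j) =
      (r.factorial : ℝ) * star h b (fun k i j => α k i * β k j) := by
  classical
  have h1 : star h b (fun _ i j => ∑ c, α c i * β c j) =
      ∑ φ : Fin r → Fin r, star h b (fun k i j => α (φ k) i * β (φ k) j) := by
    simp only [star, ← alt_sum]
    congr 1
    funext s
    simp only [tens]
    rw [Finset.prod_univ_sum, Finset.mul_sum, Fintype.piFinset_univ]
  rw [h1]
  have h2 : ∑ φ : Fin r → Fin r, star h b (fun k i j => α (φ k) i * β (φ k) j) =
      ∑ τ : Perm (Fin r), star h b (fun k i j => α (τ k) i * β (τ k) j) := by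
    symm
    refine Finset.sum_of_injOn (fun τ : Perm (Fin r) => (τ : Fin r → Fin r))
      (fun _ _ _ _ h => DFunLike.coe_injective h) (by simp) (fun φ _ hφ => ?_) (fun _ _ => rfl)
    refine star_rankOne_eq_zero h b α β fun hinj => hφ ?_
    exact ⟨Equiv.ofBijective φ (Finite.injective_iff_bijective.1 hinj), by simp, rfl⟩
  rw [h2, Finset.sum_congr rfl fun τ _ =>
    star_perm_slots h b (fun k i j => α k i * β k j) τ]
  simp [Fintype.card_perm]

/-- The bilinear form `∑ k, e_{π (fst k)} ⊗ e_{π (snd k)}`. -/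
def permForm (π : Perm (Fin n)) (i j : Fin n) : ℝ :=
  ∑ k : Fin r, (if i = π (fstPos h k) then 1 else 0) * if j = π (sndPos h k) then 1 else 0

/-- These forms are the standard test gradients: after the expansion every slot except `c` and `d`
is pinned to its value under `π`, so only `π` and its product with one transposition contribute to
the contraction. -/
theorem star_permForm (π : Perm (Fin n)) {c d : Fin q} (hcd : c ≠ d) (z x : Fin n → ℝ)
    {b : (Fin q → Fin n) → ℝ} (hb : ∀ a, b a = open Classical in
      if ∀ l, l ≠ c → l ≠ d → a l = π (freePos h l) then z (a c) * x (a d) else 0) :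
    star h b (fun _ => permForm h π) = (r.factorial : ℝ) * (((Perm.sign π : ℤ) : ℝ) *
      (z (π (freePos h c)) * x (π (freePos h d)) - z (π (freePos h d)) * x (π (freePos h c)))) := by
  classical
  have hcd' : freePos h c ≠ freePos h d := by rwa [ne_eq, freePos_inj]
  have h1 := star_sum_rankOne h b (fun k i => if i = π (fstPos h k) then 1 else 0)
    (fun k i => if i = π (sndPos h k) then 1 else 0)
  refine h1.trans ?_
  congr 1
  rw [← alt_ite_two π hcd', star]
  congr 1
  funext s
  simp only [tens, hb]
  have h2 : (∏ k, (if s (fstPos h k) = π (fstPos h k) then (1 : ℝ) else 0) *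
      if s (sndPos h k) = π (sndPos h k) then 1 else 0) =
      if ∀ k, s (fstPos h k) = π (fstPos h k) ∧ s (sndPos h k) = π (sndPos h k) then 1 else 0 := by
    simp only [← ite_and, mul_ite, mul_one, mul_zero]
    rw [Finset.prod_ite_zero]
    simp [and_comm]
  rw [h2, mul_ite, mul_one, mul_zero, ← ite_and]
  refine if_congr ⟨fun hs k hk hk' => ?_, fun hs => ⟨fun k => ⟨?_, ?_⟩, fun l hl hl' => ?_⟩⟩ rfl rfl
  · rcases pos_cases h k with ⟨l, rfl⟩ | ⟨l, rfl⟩ | ⟨l, rfl⟩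
    · exact hs.2 l (fun e => hk (by rw [e])) (fun e => hk' (by rw [e]))
    · exact (hs.1 l).1
    · exact (hs.1 l).2
  · exact hs _ (freePos_ne_fstPos h _ _).symm (freePos_ne_fstPos h _ _).symm
  · exact hs _ (freePos_ne_sndPos h _ _).symm (freePos_ne_sndPos h _ _).symm
  · exact hs _ (by rwa [ne_eq, freePos_inj]) (by rwa [ne_eq, freePos_inj])

/-! ### Hodge duals along rank-one lines -/

/-- The covector ξ occurs twice, in the free slot `c` and in the second index of the replaced
factor, and ξ ∧ ξ = 0. -/
theorem star_update_rankOne_eq_zero {c : Fin q} {ξ : Fin n → ℝ} {b b' : (Fin q → Fin n) → ℝ}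
    (hb : ∀ a, b a = ξ (a c) * b' a) (hb' : ∀ a l, b' (update a c l) = b' a) (a : Fin n → ℝ)
    (N : Fin r → Fin n → Fin n → ℝ) (k : Fin r) :
    star h b (update N k fun i j => a i * ξ j) = 0 := by
  refine alt_eq_zero_of_symm (p := freePos h c) (r := sndPos h k) (freePos_ne_sndPos h c k)
    fun s => ?_
  simp only [tens_update, hb, comp_apply, swap_apply_left, swap_apply_right]
  rw [swap_apply_of_ne_of_ne (freePos_ne_fstPos h c k).symm (fstPos_ne_sndPos h k k)]
  have h1 : b' (fun l => s (swap (freePos h c) (sndPos h k) (freePos h l))) =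
      b' (fun l => s (freePos h l)) := by
    rw [← hb' (fun l => s (freePos h l)) (s (sndPos h k))]
    congr 1
    funext l
    rcases eq_or_ne l c with rfl | hl
    · simp
    · rw [update_of_ne hl, swap_apply_of_ne_of_ne (by rwa [ne_eq, freePos_inj])
        (freePos_ne_sndPos h l k)]
  have h2 : ∏ j ∈ Finset.univ.erase k, N j (s (swap (freePos h c) (sndPos h k) (fstPos h j)))
      (s (swap (freePos h c) (sndPos h k) (sndPos h j))) =
      ∏ j ∈ Finset.univ.erase k, N j (s (fstPos h j)) (s (sndPos h j)) := by
    refine Finset.prod_congr rfl fun j hj => ?_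
    rw [swap_apply_of_ne_of_ne (freePos_ne_fstPos h c j).symm (fstPos_ne_sndPos h j k),
      swap_apply_of_ne_of_ne (freePos_ne_sndPos h c j).symm
        (by rw [ne_eq, sndPos_inj]; exact Finset.ne_of_mem_erase hj)]
  rw [h1, h2]
  ring

theorem hasDerivAt_rankOne (N : Fin n → Fin n → ℝ) (a ξ : Fin n → ℝ) (t : ℝ) (i j : Fin n) :
    HasDerivAt (fun s : ℝ => N i j + s * (a i * ξ j)) (a i * ξ j) t := by
  simpa using ((hasDerivAt_id t).mul_const (a i * ξ j)).const_add (N i j)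

theorem star_add_rankOne_of_factor {c : Fin q} {ξ : Fin n → ℝ} {b b' : (Fin q → Fin n) → ℝ}
    (hb : ∀ a, b a = ξ (a c) * b' a) (hb' : ∀ a l, b' (update a c l) = b' a) (a : Fin n → ℝ)
    (N : Fin n → Fin n → ℝ) (t : ℝ) :
    star h b (fun _ i j => N i j + t * (a i * ξ j)) = star h b (fun _ => N) := by
  have h1 : ∀ t : ℝ, HasDerivAt (fun t : ℝ => star h b (fun _ i j => N i j + t * (a i * ξ j)))
      0 t := fun t => by
    refine (hasDerivAt_star h (fun a => hasDerivAt_const t (b a))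
      (hasDerivAt_rankOne N a ξ t)).congr_deriv ?_
    rw [Finset.sum_eq_zero fun k _ => star_update_rankOne_eq_zero h hb hb' a _ k,
      star_zero_left h (fun _ => rfl), add_zero]
  have h2 := is_const_of_deriv_eq_zero (fun t => (h1 t).differentiableAt)
    (fun t => (h1 t).deriv) t 0
  simpa using h2

/-- The derivative in `t` already carries a factor a ⊗ ξ, so by `star_add_rankOne_of_factor` it does
not depend on `t`. Powers of the vorticity are thus affine along rank-one lines. -/
theorem star_add_rankOne (hr : 1 ≤ r) (h' : (q + 2) + 2 * (r - 1) = n)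
    (b : (Fin q → Fin n) → ℝ) (N : Fin n → Fin n → ℝ) (a ξ : Fin n → ℝ) (t : ℝ) :
    star h b (fun _ i j => N i j + t * (a i * ξ j)) = star h b (fun _ => N) +
      t * (r * star h' (fun e => b (fun l => e (Fin.castAdd 2 l)) *
        (a (e (Fin.natAdd q 0)) * ξ (e (Fin.natAdd q 1)))) (fun _ => N)) := by
  set K := star h' (fun e => b (fun l => e (Fin.castAdd 2 l)) *
        (a (e (Fin.natAdd q 0)) * ξ (e (Fin.natAdd q 1)))) (fun _ => N)
  have h1 : ∀ t : ℝ, HasDerivAt (fun t : ℝ => star h b (fun _ i j => N i j + t * (a i * ξ j)) -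
      t * (r * K)) 0 t := fun t => by
    refine ((hasDerivAt_star h (fun a => hasDerivAt_const t (b a))
      (hasDerivAt_rankOne N a ξ t)).sub ((hasDerivAt_id t).mul_const (r * K))).congr_deriv ?_
    rw [sum_star_update' h hr h', star_zero_left h (fun _ => rfl), zero_add,
      star_add_rankOne_of_factor h' (c := Fin.natAdd q 1) (ξ := ξ)
        (b' := fun e => b (fun l => e (Fin.castAdd 2 l)) * a (e (Fin.natAdd q 0)))
        (fun e => by ring) (fun e l => ?_)]
    · simp [K]
    · rw [update_of_ne (by simp [Fin.ext_iff])]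
      congr 2
      funext l
      rw [update_of_ne (by simp only [ne_eq, Fin.ext_iff, Fin.val_castAdd, Fin.val_natAdd]; omega)]
  have h2 := is_const_of_deriv_eq_zero (fun t => (h1 t).differentiableAt)
    (fun t => (h1 t).deriv) t 0
  simp only [zero_mul, add_zero, sub_zero] at h2
  linarith

end RankOne

/-! ### Vorticity vectors and adjugate matrices -/

theorem alt_prod_eq_det (B : Matrix (Fin n) (Fin n) ℝ) : alt (fun s => ∏ p, B p (s p)) = B.det := by
  rw [← Matrix.det_transpose, Matrix.det_apply']
  rfl

/-- After the multinomial expansion the contraction runs over a product of one entry from each row,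
which is a determinant. In this way vorticity vectors become cofactors and can be prescribed. -/
theorem star_one_rows {r : ℕ} (h : 1 + 2 * r = n) (A : Matrix (Fin n) (Fin n) ℝ) (x : Fin n → ℝ) :
    star h (fun a => x (a 0)) (fun _ i j => ∑ k, A (fstPos h k) i * A (sndPos h k) j) =
      (r.factorial : ℝ) * (A.updateRow (freePos h 0) x).det := by
  rw [star_sum_rankOne h _ (fun k => A (fstPos h k)) (fun k => A (sndPos h k)), ← alt_prod_eq_det]
  congr 1
  rw [star]
  congr 1
  funext s
  rw [prod_pos' h, tens]
  simp [Matrix.updateRow_ne (freePos_ne_fstPos h 0 _).symm,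
    Matrix.updateRow_ne (freePos_ne_sndPos h 0 _).symm]

end GasDynamics
end

noncomputable section

namespace GasDynamics

variable {n : ℕ} {Y : Type*} [NormedAddCommGroup Y] [NormedSpace ℝ Y]

open Function Set

/-! ### The Lagrangian of a density formed from the gas variables and the velocity gradient -/

/-- The velocity gradient `∂_j u_i`. -/
def gradMat (M : Grad n) (i j : Fin n) : ℝ := (M (EuclideanSpace.single j 1)).2.2 i

/-- The gradient with `∂_k ρ = ζ_k`, `∂_k p = π_k` and `∂_k u_i = N_ik`. -/
def mkGrad (ζ π : Fin n → ℝ) (N : Fin n → Fin n → ℝ) : Grad n :=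
  ∑ k, unitGrad k ((ζ k, π k, WithLp.toLp 2 fun i => N i k) : State n)

theorem unitGrad_single {V : Type*} [NormedAddCommGroup V] [NormedSpace ℝ V] (k j : Fin n)
    (a : V) : unitGrad k a (EuclideanSpace.single j 1) = if k = j then a else 0 := by
  simp [unitGrad]

theorem mkGrad_single (ζ π : Fin n → ℝ) (N : Fin n → Fin n → ℝ) (j : Fin n) :
    mkGrad ζ π N (EuclideanSpace.single j 1) = (ζ j, π j, WithLp.toLp 2 fun i => N i j) := by
  simp [mkGrad, unitGrad_single]

theorem gradMat_mkGrad (ζ π : Fin n → ℝ) (N : Fin n → Fin n → ℝ) :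
    gradMat (mkGrad ζ π N) = N := by
  funext i j
  simp [gradMat, mkGrad_single]

theorem grad_ext {M M' : Grad n}
    (h : ∀ j, M (EuclideanSpace.single j 1) = M' (EuclideanSpace.single j 1)) : M = M' :=
  ContinuousLinearMap.coe_injective
    ((EuclideanSpace.basisFun (Fin n) ℝ).toBasis.ext (by simpa using h))

theorem ug_eq_gradMat {v : Field n} (hv : ContDiff ℝ ∞ v) (x : Space n) :
    ug v x = gradMat (fderiv ℝ v x) := by
  funext i j
  exact ug_eq hv x i j

/-- The Lagrangian `D_t T + D_x · (T u)` of a density `T(v, y(∇v))`, where `D_t y + D_x · (y u)`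
equals `R`. -/
def convectiveLagrangian (F : ℝ × ℝ → ℝ) (T : State n × Y → ℝ) (y : Grad n → Y)
    (R : State n × Grad n → Y) (z : State n × Grad n) : ℝ :=
  fderiv ℝ T (z.1, y z.2)
    ((-(z.1.1 * ∑ i, gradMat z.2 i i), -(F (z.1.2.1, z.1.1) * ∑ i, gradMat z.2 i i),
      WithLp.toLp 2 fun i => -(z.1.1⁻¹ * (z.2 (EuclideanSpace.single i 1)).2.1)),
      R z - (∑ i, gradMat z.2 i i) • y z.2) +
  T (z.1, y z.2) * ∑ i, gradMat z.2 i i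

section Conserved

variable {F : ℝ × ℝ → ℝ} {I J : Set ℝ}

/-- The material derivative of the gas variables. -/
theorem evolution_add_sum {v : Field n} (hv : ContDiff ℝ ∞ v) (x : Space n) :
    evolution F v x + ∑ j, vel v x j • fderiv ℝ v x (EuclideanSpace.single j 1) =
      (-((v x).1 * ∑ i, gradMat (fderiv ℝ v x) i i),
        -(F ((v x).2.1, (v x).1) * ∑ i, gradMat (fderiv ℝ v x) i i),
        WithLp.toLp 2 fun i => -((v x).1⁻¹ *
          (fderiv ℝ v x (EuclideanSpace.single i 1)).2.1)) := by
  refine Prod.ext ?_ (Prod.ext ?_ ?_)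
  · rw [Prod.fst_add, evolution_dens hv, Prod.fst_sum]
    simp only [Prod.smul_fst, ← pd_dens_eq hv, ug_eq_gradMat hv, smul_eq_mul]
    rw [dens]; ring
  · rw [Prod.snd_add, Prod.fst_add, evolution_pres, Prod.snd_sum, Prod.fst_sum]
    simp only [Prod.smul_snd, Prod.smul_fst, ← pd_pres_eq hv, ug_eq_gradMat hv, smul_eq_mul]
    rw [thermo, pres, dens]; ring
  · ext i
    rw [Prod.snd_add, Prod.snd_add, PiLp.add_apply, evolution_vel, Prod.snd_sum, Prod.snd_sum]
    simp only [Prod.smul_snd, ← pd_pres_eq hv, WithLp.ofLp_sum, WithLp.ofLp_smul,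
      Finset.sum_apply, Pi.smul_apply, ← ug_eq hv, smul_eq_mul]
    rw [dens]; ring

variable (hI : IsOpen I) (hJo : IsOpen J) (hJ : ∀ r ∈ J, 0 < r) (hF : ContDiffOn ℝ ∞ F (I ×ˢ J))
  {T : State n × Y → ℝ} (hT : ContDiffOn ℝ ∞ T (stateDomain n I J ×ˢ univ))

include hI hJo hT in
theorem hasFDerivAt_density {s : State n} (hs : s ∈ stateDomain n I J) (η : Y) :
    HasFDerivAt T (fderiv ℝ T (s, η)) (s, η) :=
  ((hT.contDiffAt (((isOpen_stateDomain hI hJo).prod isOpen_univ).mem_nhds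
    (show (s, η) ∈ stateDomain n I J ×ˢ (univ : Set Y) from ⟨hs, mem_univ _⟩))).differentiableAt
    (by simp)).hasFDerivAt

include hI hJo hT in
theorem hasDerivAt_density_evolution {v : Field n} (hv : Admissible I J v) {x : Space n}
    {η : ℝ → Y} {η' : Y} (hη : HasDerivAt η η' 0) :
    HasDerivAt (fun ε : ℝ => T (v x + ε • evolution F v x, η ε))
      (fderiv ℝ T (v x, η 0) (evolution F v x, η')) 0 := by
  have h1 : HasDerivAt (fun ε : ℝ => v x + ε • evolution F v x) (evolution F v x) 0 := by
    simpa using ((hasDerivAt_id (0 : ℝ)).smul_const (evolution F v x)).const_add (v x)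
  exact HasFDerivAt.comp_hasDerivAt_of_eq (0 : ℝ) (hasFDerivAt_density hI hJo hT (hv.2 x) (η 0))
    (h1.prodMk hη) (by simp)

include hI hJo hJ hF hT in
-- Adding div(Tu) to D_tT completes the material derivative: the transport of the state cancels, and
-- by `hR` the second derivatives hidden in the evolution of `y` cancel as well. What is left
-- depends on the first jet only, whatever the order of the flux.
theorem IsConserved.isNullLagrangian {𝒯 : Density n} {y : Grad n → Y} (hy : ContDiff ℝ ∞ y)
    {R : State n × Grad n → Y}
    (hR : ∀ v, Admissible I J v → ∀ x, HasDerivAt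
      (fun ε : ℝ => y (fderiv ℝ (fun z => v z + ε • evolution F v z) x))
      (R (v x, fderiv ℝ v x) - ∑ j, fderiv ℝ (fun z => vel v z j • y (fderiv ℝ v z)) x
        (EuclideanSpace.single j 1)) 0)
    (h𝒯 : ∀ v, ContDiff ℝ ∞ v → ∀ x, 𝒯 v x = T (v x, y (fderiv ℝ v x)))
    (hc : IsConserved F I J 𝒯) :
    IsNullLagrangian (stateDomain n I J) (convectiveLagrangian F T y R) := by
  obtain ⟨X, hX, hcont⟩ := hc
  have hy' : ∀ v, Admissible I J v → ContDiff ℝ ∞ (fun x => y (fderiv ℝ v x)) := fun v hv =>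
    hy.comp (hv.1.fderiv_right (by simp))
  have hTv : ∀ v, Admissible I J v → ContDiff ℝ ∞ (fun x => T (v x, y (fderiv ℝ v x))) :=
    fun v hv => hT.comp_contDiff (hv.1.prodMk (hy' v hv)) fun x => ⟨hv.2 x, mem_univ _⟩
  -- The vector is Tu − X, with the flux taken at time 0; any fixed time would serve.
  refine ⟨fun v x => T (v x, y (fderiv ℝ v x)) • vel v x - X 0 v x, fun v hv => ?_,
    fun v w hv hw x hvw => ?_, fun v hv x => ?_⟩
  · exact ((hTv v hv).smul (contDiff_vel hv.1)).sub (hX.contDiff 0 hv)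
  · simp only [vel]
    rw [hX.congr 0 hv hw hvw, hvw.eq_of_nhds, (hvw.fderiv (𝕜 := ℝ)).eq_of_nhds]
  have hv : Admissible I J v := hv
  have hev := hv.contDiff_evolution hJ hF
  show _ = divergence (fun x => T (v x, y (fderiv ℝ v x)) • vel v x - X 0 v x) x
  have hTd := hTv v hv
  have hyd : DifferentiableAt ℝ (fun x => y (fderiv ℝ v x)) x :=
    (hy' v hv).differentiable (by simp) x
  have h1 : divergence (fun x => T (v x, y (fderiv ℝ v x)) • vel v x - X 0 v x) x =
      ∑ j, pd j (fun x => T (v x, y (fderiv ℝ v x)) * vel v x j) x - divergence (X 0 v) x := by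
    rw [divergence, divergence, ← Finset.sum_sub_distrib]
    refine Finset.sum_congr rfl fun j _ => ?_
    exact pd_sub ((hTd.mul (contDiff_vel_apply hv.1 j)).differentiable (by simp) x)
      ((contDiff_apply_coord (hX.contDiff 0 hv) j).differentiable (by simp) x) j
  rw [h1, sum_pd_mul_vel hv.1 hTd, ug_eq_gradMat hv.1]
  have h2 := hcont 0 v hv x
  have h3 : timeDeriv F 𝒯 v x = fderiv ℝ T (v x, y (fderiv ℝ v x)) (evolution F v x,
      R (v x, fderiv ℝ v x) - ∑ j, fderiv ℝ (fun z => vel v z j • y (fderiv ℝ v z)) x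
        (EuclideanSpace.single j 1)) := by
    have e : (fun ε : ℝ => 𝒯 (fun y => v y + ε • evolution F v y) x) = fun ε =>
        T (v x + ε • evolution F v x, y (fderiv ℝ (fun z => v z + ε • evolution F v z) x)) := by
      funext ε
      exact h𝒯 _ (hv.1.add (hev.const_smul ε)) x
    rw [timeDeriv, e, (hasDerivAt_density_evolution hI hJo hT hv (hR v hv x)).deriv]
    simp
  have h4 : ∀ j, fderiv ℝ (fun z => vel v z j • y (fderiv ℝ v z)) x (EuclideanSpace.single j 1) =
      vel v x j • fderiv ℝ (fun z => y (fderiv ℝ v z)) x (EuclideanSpace.single j 1) +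
        gradMat (fderiv ℝ v x) j j • y (fderiv ℝ v x) := by
    intro j
    have := (((contDiff_vel_apply hv.1 j).differentiable (by simp) x).hasFDerivAt.smul
      hyd.hasFDerivAt).fderiv
    rw [show (fun z => vel v z j • y (fderiv ℝ v z)) = (fun z => vel v z j) • fun z =>
      y (fderiv ℝ v z) from rfl, this, ← ug_eq_gradMat hv.1]
    rfl
  have h5 : ∀ j, pd j (fun x => T (v x, y (fderiv ℝ v x))) x =
      fderiv ℝ T (v x, y (fderiv ℝ v x)) (fderiv ℝ v x (EuclideanSpace.single j 1),
        fderiv ℝ (fun z => y (fderiv ℝ v z)) x (EuclideanSpace.single j 1)) := by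
    intro j
    have h6 : HasFDerivAt (fun x => (v x, y (fderiv ℝ v x))) _ x :=
      (hv.1.differentiable (by simp) x).hasFDerivAt.prodMk hyd.hasFDerivAt
    have h7 := (hasFDerivAt_density hI hJo hT (hv.2 x) (y (fderiv ℝ v x))).comp x h6
    rw [pd, show (fun x => T (v x, y (fderiv ℝ v x))) = T ∘ fun x => (v x, y (fderiv ℝ v x))
      from rfl, h7.fderiv]
    rfl
  have h8 : ∑ j, vel v x j * pd j (fun x => T (v x, y (fderiv ℝ v x))) x =
      fderiv ℝ T (v x, y (fderiv ℝ v x)) (∑ j, vel v x j • fderiv ℝ v x (EuclideanSpace.single j 1),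
        ∑ j, vel v x j • fderiv ℝ (fun z => y (fderiv ℝ v z)) x (EuclideanSpace.single j 1)) := by
    have e : ((∑ j, vel v x j • fderiv ℝ v x (EuclideanSpace.single j 1),
        ∑ j, vel v x j • fderiv ℝ (fun z => y (fderiv ℝ v z)) x (EuclideanSpace.single j 1)) :
        State n × Y) = ∑ j, vel v x j • (fderiv ℝ v x (EuclideanSpace.single j 1),
          fderiv ℝ (fun z => y (fderiv ℝ v z)) x (EuclideanSpace.single j 1)) := by
      ext1
      · simp [Prod.fst_sum]
      · simp [Prod.snd_sum]
    rw [e, map_sum]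
    refine Finset.sum_congr rfl fun j _ => ?_
    rw [h5, map_smul, smul_eq_mul]
  rw [convectiveLagrangian, ← evolution_add_sum hv.1, h8]
  have h9 : fderiv ℝ T (v x, y (fderiv ℝ v x)) (evolution F v x +
        ∑ j, vel v x j • fderiv ℝ v x (EuclideanSpace.single j 1),
        R (v x, fderiv ℝ v x) - (∑ i, gradMat (fderiv ℝ v x) i i) • y (fderiv ℝ v x)) =
      timeDeriv F 𝒯 v x + fderiv ℝ T (v x, y (fderiv ℝ v x))
        (∑ j, vel v x j • fderiv ℝ v x (EuclideanSpace.single j 1),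
        ∑ j, vel v x j • fderiv ℝ (fun z => y (fderiv ℝ v z)) x (EuclideanSpace.single j 1)) := by
    rw [h3, ← map_add]
    congr 1
    rw [Prod.mk_add_mk]
    congr 1
    simp only [h4, Finset.sum_add_distrib, Finset.sum_smul]
    abel
  rw [h9]
  linear_combination h2

/-- Conserved densities form a linear space. -/
theorem IsConserved.of_eq_add {𝒯 𝒯₁ 𝒯₂ : Density n} {c : ℝ} (h₁ : IsConserved F I J 𝒯₁)
    (h₂ : IsConserved F I J 𝒯₂)
    (hd₁ : ∀ v, Admissible I J v → ∀ x, DifferentiableAt ℝ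
      (fun ε : ℝ => 𝒯₁ (fun z => v z + ε • evolution F v z) x) 0)
    (hd₂ : ∀ v, Admissible I J v → ∀ x, DifferentiableAt ℝ
      (fun ε : ℝ => 𝒯₂ (fun z => v z + ε • evolution F v z) x) 0)
    (heq : ∀ v, Admissible I J v → ∀ x, ∀ᶠ ε : ℝ in nhds 0,
      𝒯 (fun z => v z + ε • evolution F v z) x =
        𝒯₁ (fun z => v z + ε • evolution F v z) x +
          c * 𝒯₂ (fun z => v z + ε • evolution F v z) x) : IsConserved F I J 𝒯 := by
  obtain ⟨X₁, hX₁, hc₁⟩ := h₁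
  obtain ⟨X₂, hX₂, hc₂⟩ := h₂
  refine ⟨_, hX₁.const_smul_add hX₂ c, fun t v hv x => ?_⟩
  have h1 : timeDeriv F 𝒯 v x = timeDeriv F 𝒯₁ v x + c * timeDeriv F 𝒯₂ v x := by
    rw [timeDeriv, Filter.EventuallyEq.deriv_eq (heq v hv x)]
    exact ((hd₁ v hv x).hasDerivAt.add ((hd₂ v hv x).hasDerivAt.const_mul c)).deriv
  have h2 : divergence (fun x => X₁ t v x + c • X₂ t v x) x =
      divergence (X₁ t v) x + c * divergence (X₂ t v) x := by
    simp only [divergence, Finset.mul_sum, ← Finset.sum_add_distrib]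
    refine Finset.sum_congr rfl fun i _ => ?_
    have d1 := (contDiff_apply_coord (hX₁.contDiff t hv) i).differentiable (by simp) x
    have d2 := (contDiff_apply_coord (hX₂.contDiff t hv) i).differentiable (by simp) x
    rw [← pd_const_mul d2, ← pd_add d1 (d2.const_mul c)]
    rfl
  rw [h1, h2]
  linear_combination hc₁ t v hv x + c * hc₂ t v hv x

include hI hJo in
theorem eventually_mem_stateDomain {v : Field n} (hv : Admissible I J v) (x : Space n) :
    ∀ᶠ ε : ℝ in nhds 0, v x + ε • evolution F v x ∈ stateDomain n I J := by
  have h1 : Continuous (fun ε : ℝ => v x + ε • evolution F v x) := by fun_prop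
  exact h1.continuousAt.eventually ((isOpen_stateDomain hI hJo).mem_nhds (by simpa using hv.2 x))

end Conserved

/-! ### Rank-one lines and pressure variations in explicit coordinates -/

section TestGradients

variable {I J : Set ℝ} {L : State n × Grad n → ℝ} (hI : IsOpen I) (hJ : IsOpen J)
  (hLs : ContDiffOn ℝ ∞ L (stateDomain n I J ×ˢ univ))
  (hL : IsNullLagrangian (stateDomain n I J) L) {s : State n} (hs : s ∈ stateDomain n I J)
include hI hJ hLs hL hs

/-- The rank-one direction has covector ξ and amplitude `(0, c, a)`: the density gradient stays
fixed, and `c` switches a pressure gradient parallel to ξ on or off. -/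
theorem rankOne_affine_mkGrad (ζ π : Fin n → ℝ) (N : Fin n → Fin n → ℝ) (c : ℝ)
    (a ξ : Fin n → ℝ) :
    ∃ α β : ℝ, ∀ t : ℝ, L (s, mkGrad ζ (fun k => π k + t * (c * ξ k))
      (fun i j => N i j + t * (a i * ξ j))) = α + t * β := by
  obtain ⟨α, β, h⟩ := hL.rankOne_affine (isOpen_stateDomain hI hJ) hLs hs (mkGrad ζ π N)
    (∑ k, ξ k • EuclideanSpace.proj (𝕜 := ℝ) k) (0, c, WithLp.toLp 2 a)
  refine ⟨α, β, fun t => ?_⟩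
  rw [← h]
  congr 2
  refine grad_ext fun j => ?_
  have e : (∑ k, ξ k • EuclideanSpace.proj (𝕜 := ℝ) k : Space n →L[ℝ] ℝ)
      (EuclideanSpace.single j 1) = ξ j := by
    simp
  rw [mkGrad_single]
  change _ = mkGrad ζ π N (EuclideanSpace.single j 1) +
    t • ((∑ k, ξ k • EuclideanSpace.proj (𝕜 := ℝ) k : Space n →L[ℝ] ℝ)
      (EuclideanSpace.single j 1) • ((0, c, WithLp.toLp 2 a) : State n))
  rw [mkGrad_single, e]
  refine Prod.ext ?_ (Prod.ext ?_ ?_)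
  · simp
  · simp [mul_comm]
  · ext i
    simp [mul_comm]

theorem euler_lagrange_mkGrad_pres (ζ π : Fin n → ℝ) (N : Fin n → Fin n → ℝ) :
    deriv (fun τ : ℝ => L (s + τ • ((0, 1, 0) : State n), mkGrad ζ π N)) 0 =
      ∑ k, deriv (fun τ : ℝ => deriv (fun θ : ℝ =>
        L (s + τ • ((ζ k, π k, WithLp.toLp 2 fun i => N i k) : State n),
          mkGrad ζ (fun l => π l + θ * if k = l then 1 else 0) N)) 0) 0 := by
  rw [hL.euler_lagrange_affine (isOpen_stateDomain hI hJ) hLs hs]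
  refine Finset.sum_congr rfl fun k _ => ?_
  congr 1
  funext τ
  congr 1
  funext θ
  rw [mkGrad_single]
  congr 2
  refine grad_ext fun j => ?_
  rw [mkGrad_single]
  change mkGrad ζ π N (EuclideanSpace.single j 1) +
    θ • unitGrad k ((0, 1, 0) : State n) (EuclideanSpace.single j 1) = _
  rw [mkGrad_single, unitGrad_single]
  split_ifs
  · refine Prod.ext ?_ (Prod.ext ?_ ?_) <;> simp
  · refine Prod.ext ?_ (Prod.ext ?_ ?_) <;> simp

end TestGradients

theorem contDiffOn_convectiveLagrangian {I J : Set ℝ} {F : ℝ × ℝ → ℝ} (hI : IsOpen I)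
    (hJo : IsOpen J) (hJ : ∀ r ∈ J, 0 < r) (hF : ContDiffOn ℝ ∞ F (I ×ˢ J))
    {T : State n × Y → ℝ} (hT : ContDiffOn ℝ ∞ T (stateDomain n I J ×ˢ univ)) {y : Grad n → Y}
    (hy : ContDiff ℝ ∞ y) {R : State n × Grad n → Y}
    (hR : ContDiffOn ℝ ∞ R (stateDomain n I J ×ˢ univ)) :
    ContDiffOn ℝ ∞ (convectiveLagrangian F T y R) (stateDomain n I J ×ˢ univ) := by
  have hd : ContDiff ℝ ∞ (fun z : State n × Grad n => ∑ i, gradMat z.2 i i) :=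
    ContDiff.sum fun i _ => contDiff_ugPart i i
  have hyz : ContDiff ℝ ∞ (fun z : State n × Grad n => y z.2) := hy.comp contDiff_snd
  have hD : IsOpen (stateDomain n I J ×ˢ (univ : Set Y)) :=
    (isOpen_stateDomain hI hJo).prod isOpen_univ
  have hg : ContDiffOn ℝ ∞ (fun z : State n × Grad n => (z.1, y z.2))
      (stateDomain n I J ×ˢ univ) := (contDiff_fst.prodMk hyz).contDiffOn
  have hm : MapsTo (fun z : State n × Grad n => (z.1, y z.2)) (stateDomain n I J ×ˢ univ)
      (stateDomain n I J ×ˢ univ) := fun z hz => ⟨hz.1, mem_univ _⟩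
  have hρ : ContDiff ℝ ∞ (fun z : State n × Grad n => z.1.1) := contDiff_fst.fst
  refine ContDiffOn.add (ContDiffOn.clm_apply ((hT.fderiv_of_isOpen hD (by simp)).comp hg hm)
    (ContDiffOn.prodMk (ContDiffOn.prodMk (hρ.mul hd).neg.contDiffOn (ContDiffOn.prodMk
      ((contDiffOn_thermoPart hF).mul hd.contDiffOn).neg (contDiffOn_of_apply fun i => ?_)))
      (hR.sub (hd.smul hyz).contDiffOn))) ((hT.comp hg hm).mul hd.contDiffOn)
  exact ((hρ.contDiffOn.inv fun z hz => (hJ _ hz.1.1).ne').mul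
    (contDiff_gradPart i).snd.fst.contDiffOn).neg

/-- The evolution of the velocity along a pressure gradient enters the Lagrangian of a conserved
density only through a directional derivative that is constant along the lines of vorticities
that are swept out by rank-one changes of the velocity gradient. -/
theorem fderiv_eq_of_isNullLagrangian {I J : Set ℝ} {F : ℝ × ℝ → ℝ} (hI : IsOpen I)
    (hJo : IsOpen J) (hJ : ∀ r ∈ J, 0 < r) (hF : ContDiffOn ℝ ∞ F (I ×ˢ J))
    {T : State n × Y → ℝ} (hT : ContDiffOn ℝ ∞ T (stateDomain n I J ×ˢ univ)) {y : Grad n → Y}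
    (hy : ContDiff ℝ ∞ y) {R : State n × Grad n → Y}
    (hR : ContDiffOn ℝ ∞ R (stateDomain n I J ×ˢ univ))
    (hL : IsNullLagrangian (stateDomain n I J) (convectiveLagrangian F T y R)) {s : State n}
    (hs : s ∈ stateDomain n I J) {ζ a ξ : Fin n → ℝ} {N : Fin n → Fin n → ℝ} {η κ W : Y}
    {R₀ : ℝ → Y}
    (hy0 : ∀ π t, y (mkGrad ζ π fun i j => N i j + t * (a i * ξ j)) = η + t • κ)
    (hR0 : ∀ c t, R (s, mkGrad ζ (fun k => 0 + t * (c * ξ k)) fun i j =>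
      N i j + t * (a i * ξ j)) = R₀ t + (t * c) • W) (t : ℝ) :
    fderiv ℝ T (s, η + t • κ) ((0, 0, WithLp.toLp 2 fun i => -(s.1⁻¹ * ξ i)), W) =
      fderiv ℝ T (s, η) ((0, 0, WithLp.toLp 2 fun i => -(s.1⁻¹ * ξ i)), W) := by
  have hLs := contDiffOn_convectiveLagrangian hI hJo hJ hF hT hy hR
  obtain ⟨α, β, h0⟩ := rankOne_affine_mkGrad hI hJo hLs hL hs ζ 0 N 0 a ξ
  obtain ⟨α', β', h1⟩ := rankOne_affine_mkGrad hI hJo hLs hL hs ζ 0 N 1 a ξ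
  set z : ℝ → ℝ := fun t =>
    fderiv ℝ T (s, η + t • κ) ((0, 0, WithLp.toLp 2 fun i => -(s.1⁻¹ * ξ i)), W) with hz
  -- The lines with `c = 1` and `c = 0` differ only by a pressure gradient `t ξ`, which enters the
  -- argument of the derivative of T linearly. Their difference is `t * z t`, and it is affine in
  -- `t`.
  have key : ∀ t, t * z t = (α' - α) + t * (β' - β) := by
    intro t
    have e0 := h0 t
    have e1 := h1 t
    simp only [Pi.zero_apply, convectiveLagrangian, hy0, hR0, gradMat_mkGrad, mkGrad_single]
      at e0 e1
    have e2 : t * z t = fderiv ℝ T (s, η + t • κ)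
        (t • ((0, 0, WithLp.toLp 2 fun i => -(s.1⁻¹ * ξ i)), W)) := by
      rw [map_smul, smul_eq_mul]
    have e3 : α' - α + t * (β' - β) = (α' + t * β') - (α + t * β) := by ring
    rw [e2, e3, ← e0, ← e1, add_sub_add_right_eq_sub, ← map_sub]
    congr 1
    refine Prod.ext (Prod.ext ?_ (Prod.ext ?_ ?_)) ?_
    · simp
    · simp
    · ext i
      simp only [Prod.fst_sub, Prod.snd_sub, Prod.smul_fst, Prod.smul_snd, PiLp.sub_apply,
        PiLp.smul_apply, smul_eq_mul]
      ring
    · simp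
  have hzc : Continuous z := by
    have hD : IsOpen (stateDomain n I J ×ˢ (univ : Set Y)) :=
      (isOpen_stateDomain hI hJo).prod isOpen_univ
    have h2 : Continuous (fun t : ℝ => fderiv ℝ T (s, η + t • κ)) := by
      rw [← continuousOn_univ]
      exact (hT.fderiv_of_isOpen (m := ∞) hD (by simp)).continuousOn.comp
        (by fun_prop) fun t _ => ⟨hs, mem_univ _⟩
    exact h2.clm_apply continuous_const
  have hα : α' - α = 0 := by simpa using (key 0).symm
  have hzβ : z = fun _ => β' - β := by
    -- The affine function vanishes at 0, so `z` is constant off 0 and, by continuity, everywhere.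
    refine Continuous.ext_on (dense_compl_singleton (0 : ℝ)) hzc continuous_const fun t ht => ?_
    have := key t
    rw [hα, zero_add] at this
    exact mul_left_cancel₀ ht this
  have h3 : z t = z 0 := by rw [hzβ]
  simpa [hz] using h3

end GasDynamics
end

noncomputable section

namespace GasDynamics

variable {n : ℕ}

open Function Set

/-! ### Conserved densities of vorticity form in even dimensions -/

section Even

variable {m : ℕ} (hm : 1 ≤ m) (h : n = 2 * m)

/-- The vorticity scalar as a function of the gradient of the gas variables. -/
def gradVortScalar (M : Grad n) : ℝ :=
  star (q := 0) (r := m) (by omega) (fun _ => 1) (fun _ => gradMat M)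

/-- The baroclinic source of the vorticity scalar. -/
def baroclinicScalar (z : State n × Grad n) : ℝ :=
  m * star (q := 2) (r := m - 1) (by omega) (fun a => (z.1.1)⁻¹ ^ 2 *
    ((z.2 (EuclideanSpace.single (a 0) 1)).2.1 * (z.2 (EuclideanSpace.single (a 1) 1)).1))
    (fun _ => gradMat z.2)

theorem vortScalar_eq_gradVortScalar {v : Field n} (hv : ContDiff ℝ ∞ v) (x : Space n) :
    vortScalar h v x = gradVortScalar h (fderiv ℝ v x) := by
  rw [vortScalar_eq, gradVortScalar, ug_eq_gradMat hv]

theorem contDiff_gradVortScalar : ContDiff ℝ ∞ (gradVortScalar h) := by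
  refine contDiff_star _ (fun _ => contDiff_const) fun _ i j => ?_
  exact (contDiff_ugPart i j).comp (contDiff_prodMk_right (0 : State n))

variable {I J : Set ℝ} {F : ℝ × ℝ → ℝ} (hI : IsOpen I) (hJo : IsOpen J)
  (hJ : ∀ r ∈ J, 0 < r) (hF : ContDiffOn ℝ ∞ F (I ×ˢ J))

include hJ in
theorem contDiffOn_baroclinicScalar :
    ContDiffOn ℝ ∞ (baroclinicScalar hm h) (stateDomain n I J ×ˢ univ) := by
  intro z hz
  refine contDiffWithinAt_const.mul (contDiffWithinAt_star _ (fun a => ?_) fun _ i j => ?_)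
  · refine ContDiffWithinAt.mul (ContDiffWithinAt.pow ?_ 2)
      ((contDiff_gradPart (a 0)).snd.fst.mul (contDiff_gradPart (a 1)).fst).contDiffWithinAt
    exact contDiff_fst.fst.contDiffWithinAt.inv (hJ _ hz.1.1).ne'
  · exact (contDiff_ugPart i j).contDiffWithinAt

include hJ hF in
theorem hasDerivAt_gradVortScalar {v : Field n} (hv : Admissible I J v) (x : Space n) :
    HasDerivAt (fun ε : ℝ => gradVortScalar h (fderiv ℝ (fun z => v z + ε • evolution F v z) x))
      (baroclinicScalar hm h (v x, fderiv ℝ v x) - ∑ j, fderiv ℝ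
        (fun z => vel v z j • gradVortScalar h (fderiv ℝ v z)) x (EuclideanSpace.single j 1)) 0 := by
  have h0 : 0 + 2 * m = n := by omega
  have h1 := hasDerivAt_star_evolution hJ hF hv h0 x
    (B := fun _ _ => 1) (β := fun _ _ => 1) (β' := fun _ => 0) rfl
    (fun _ => hasDerivAt_const _ _) (fun _ => contDiff_const)
  have hev := hv.contDiff_evolution hJ hF
  have e1 : ∀ ε : ℝ, ug (fun y => v y + ε • evolution F v y) x =
      gradMat (fderiv ℝ (fun z => v z + ε • evolution F v z) x) := fun ε =>
    ug_eq_gradMat (hv.1.add (hev.const_smul ε)) x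
  simp only [e1] at h1
  refine h1.congr_deriv ?_
  rw [star_zero_left, sum_star_update' h0 hm (by omega), zero_add, baroclinicScalar,
    ug_eq_gradMat hv.1]
  · congr 1
    · congr 2
      funext a
      simp only [pd_dens_eq hv.1, pd_pres_eq hv.1, one_mul]
      rfl
    · refine Finset.sum_congr rfl fun j _ => ?_
      rw [pd]
      congr 2
      funext y
      rw [ug_eq_gradMat hv.1, smul_eq_mul, mul_comm]
      rfl
  · intro a
    simp [pd_const]

theorem gradVortScalar_mkGrad (ζ π : Fin n → ℝ) (N : Fin n → Fin n → ℝ) (a ξ : Fin n → ℝ) (t : ℝ) :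
    gradVortScalar h (mkGrad ζ π fun i j => N i j + t * (a i * ξ j)) =
      star (q := 0) (r := m) (by omega) (fun _ => 1) (fun _ => N) +
      t • (m * star (q := 2) (r := m - 1) (by omega) (fun e => a (e 0) * ξ (e 1))
        (fun _ => N)) := by
  have h0 : 0 + 2 * m = n := by omega
  rw [gradVortScalar, gradMat_mkGrad, star_add_rankOne h0 hm (by omega), smul_eq_mul]
  simp only [one_mul]
  rfl

/-- The pressure gradient is parallel to ξ, so the rank-one change of the velocity gradient is
invisible in the source, which is then linear in `t * c`. -/
theorem baroclinicScalar_mkGrad (s : State n) (ζ : Fin n → ℝ) (N : Fin n → Fin n → ℝ)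
    (a ξ : Fin n → ℝ) (c t : ℝ) :
    baroclinicScalar hm h (s, mkGrad ζ (fun k => 0 + t * (c * ξ k))
        fun i j => N i j + t * (a i * ξ j)) =
      0 + (t * c) • (m * ((s.1)⁻¹ ^ 2 * star (q := 2) (r := m - 1) (by omega)
        (fun e => ξ (e 0) * ζ (e 1)) (fun _ => N))) := by
  have h2 : 2 + 2 * (m - 1) = n := by omega
  rw [baroclinicScalar, gradMat_mkGrad]
  simp only [mkGrad_single]
  have e : ∀ e : Fin 2 → Fin n, s.1⁻¹ ^ 2 * ((0 + t * (c * ξ (e 0))) * ζ (e 1)) =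
      (t * c) * (s.1⁻¹ ^ 2 * (ξ (e 0) * ζ (e 1))) := fun e => by ring
  simp only [e]
  rw [star_const_mul_left, star_const_mul_left,
    star_add_rankOne_of_factor h2 (c := 0) (b' := fun e => ζ (e 1)) (fun _ => rfl)
      (fun e l => by simp), smul_eq_mul]
  ring

theorem star_two_permForm (h2 : 2 + 2 * (m - 1) = n) (π : Equiv.Perm (Fin n)) (z x : Fin n → ℝ) :
    star h2 (fun e => z (e 0) * x (e 1)) (fun _ => permForm h2 π) =
      ((m - 1).factorial : ℝ) * (((Equiv.Perm.sign π : ℤ) : ℝ) *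
      (z (π (freePos h2 0)) * x (π (freePos h2 1)) -
        z (π (freePos h2 1)) * x (π (freePos h2 0)))) := by
  refine star_permForm h2 π (c := 0) (d := 1) (by decide) z x fun a => ?_
  rw [if_pos]
  intro l h0 h1
  fin_cases l <;> simp at h0 h1

include hm h in
-- If ϖ vanished for all gradients, its slope along every rank-one line would vanish; for a standard
-- test gradient this slope is m times (m−1)!.
theorem exists_star_zero_ne_zero (h0 : 0 + 2 * m = n) :
    ∃ N : Fin n → Fin n → ℝ, star h0 (fun _ => 1) (fun _ => N) ≠ 0 := by
  have h2 : 2 + 2 * (m - 1) = n := by omega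
  by_contra! hc
  have h1 := gradVortScalar_mkGrad hm h 0 0 (permForm h2 1) (Pi.single (freePos h2 0) 1)
    (Pi.single (freePos h2 1) 1) 1
  rw [gradVortScalar, hc, hc, star_two_permForm h2] at h1
  have h3 : freePos h2 0 ≠ freePos h2 1 := by rw [ne_eq, freePos_inj]; decide
  have h4 : (m : ℝ) ≠ 0 := Nat.cast_ne_zero.2 (by omega)
  simp [h3, h3.symm, Nat.factorial_ne_zero, h4] at h1

variable {T : State n × ℝ → ℝ} (hT : ContDiffOn ℝ ∞ T (stateDomain n I J ×ˢ univ))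
  (hc : IsConserved F I J (evenDensity h T))
include hm hI hJo hJ hF hT hc

theorem isNullLagrangian_evenDensity :
    IsNullLagrangian (stateDomain n I J)
      (convectiveLagrangian F T (gradVortScalar h) (baroclinicScalar hm h)) :=
  hc.isNullLagrangian hI hJo hJ hF hT (contDiff_gradVortScalar h)
    (fun _ hv x => hasDerivAt_gradVortScalar hm h hJ hF hv x)
    (fun v hv x => by rw [evenDensity, vortScalar_eq_gradVortScalar h hv])

/-- For the test gradient of a permutation and a = e_p₀, ξ = e_p₁ the slope of ϖ is nonzero, so the
line passes through every value of ϖ. The constant directional derivative is then independent of ϖ,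
and the choice of ∇ρ separates its velocity part from its vorticity part. -/
theorem fderiv_evenDensity_eq {s : State n} (hs : s ∈ stateDomain n I J) (η : ℝ) :
    fderiv ℝ T (s, η) (0, 1) = fderiv ℝ T (s, 0) (0, 1) ∧
      ∀ i, fderiv ℝ T (s, η) ((0, 0, EuclideanSpace.single i 1), 0) =
        fderiv ℝ T (s, 0) ((0, 0, EuclideanSpace.single i 1), 0) := by
  have h2 : 2 + 2 * (m - 1) = n := by omega
  have hL := isNullLagrangian_evenDensity hm h hI hJo hJ hF hT hc
  have hs0 : s.1 ≠ 0 := (hJ _ hs.1).ne'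
  have hm0 : (m : ℝ) ≠ 0 := Nat.cast_ne_zero.2 (by omega)
  have hf : ((m - 1).factorial : ℝ) ≠ 0 := by positivity
  have h01 : freePos h2 0 ≠ freePos h2 1 := by rw [ne_eq, freePos_inj]; decide
  have key : ∀ π : Equiv.Perm (Fin n), ∀ η : ℝ,
      fderiv ℝ T (s, η) (0, 1) = fderiv ℝ T (s, 0) (0, 1) ∧
      fderiv ℝ T (s, η) ((0, 0, EuclideanSpace.single (π (freePos h2 1)) 1), 0) =
        fderiv ℝ T (s, 0) ((0, 0, EuclideanSpace.single (π (freePos h2 1)) 1), 0) := by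
    intro π
    have hsg : (((Equiv.Perm.sign π : ℤ) : ℝ)) ≠ 0 := by simp
    set p0 := π (freePos h2 0) with hp0
    set p1 := π (freePos h2 1) with hp1
    have hp : p0 ≠ p1 := fun e => h01 (π.injective e)
    have main := fun ζ : Fin n → ℝ => fderiv_eq_of_isNullLagrangian hI hJo hJ hF hT
      (contDiff_gradVortScalar h) (contDiffOn_baroclinicScalar hm h hJ) hL hs
      (gradVortScalar_mkGrad hm h ζ · (permForm h2 π) (Pi.single p0 1) (Pi.single p1 1) ·)
      (baroclinicScalar_mkGrad hm h s ζ (permForm h2 π) (Pi.single p0 1) (Pi.single p1 1) · ·)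
    simp only [star_two_permForm h2, ← hp0, ← hp1] at main
    set y0 := star (n := n) (q := 0) (r := m) (by omega) (fun _ => 1) (fun _ => permForm h2 π)
    set κ : ℝ := m * (((m - 1).factorial : ℝ) * (((Equiv.Perm.sign π : ℤ) : ℝ) *
      ((Pi.single p0 1 : Fin n → ℝ) p0 * (Pi.single p1 1 : Fin n → ℝ) p1 -
        (Pi.single p0 1 : Fin n → ℝ) p1 * (Pi.single p1 1 : Fin n → ℝ) p0))) with hκ
    have hκ0 : κ ≠ 0 := by simp [hκ, hp, hp.symm, hm0, hf, hsg]
    have hline : ∀ η : ℝ, y0 + ((η - y0) / κ) • κ = η := fun η => by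
      rw [smul_eq_mul, div_mul_cancel₀ _ hκ0]; ring
    -- With ∇ρ = 0 there is no baroclinic source, and only the velocity derivative in the direction
    -- e_p₁ is seen.
    have hu : ∀ η : ℝ, fderiv ℝ T (s, η) ((0, 0, EuclideanSpace.single p1 1), 0) =
        fderiv ℝ T (s, y0) ((0, 0, EuclideanSpace.single p1 1), 0) := by
      intro η
      have h3 := main 0 ((η - y0) / κ)
      rw [hline] at h3
      have e : (((0, 0, WithLp.toLp 2 fun i => -(s.1⁻¹ * (Pi.single p1 1 : Fin n → ℝ) i)),
          m * (s.1⁻¹ ^ 2 * (((m - 1).factorial : ℝ) * (((Equiv.Perm.sign π : ℤ) : ℝ) *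
            ((Pi.single p1 1 : Fin n → ℝ) p0 * (0 : Fin n → ℝ) p1 -
              (Pi.single p1 1 : Fin n → ℝ) p1 * (0 : Fin n → ℝ) p0))))) : State n × ℝ) =
          (-s.1⁻¹) • ((0, 0, EuclideanSpace.single p1 1), 0) := by
        refine Prod.ext (Prod.ext ?_ (Prod.ext ?_ ?_)) ?_
        · simp
        · simp
        · ext i
          simp [Pi.single_apply]
        · simp
      rw [e, map_smul, map_smul] at h3
      exact smul_right_injective ℝ (neg_ne_zero.2 (inv_ne_zero hs0)) h3
    -- With ∇ρ = e_p₀ the source is nonzero; subtracting the velocity part that is already known to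
    -- be constant leaves the derivative in ϖ.
    have hy : ∀ η : ℝ, fderiv ℝ T (s, η) (0, 1) = fderiv ℝ T (s, y0) (0, 1) := by
      intro η
      have h3 := main (Pi.single p0 1) ((η - y0) / κ)
      rw [hline] at h3
      set W : ℝ := m * (s.1⁻¹ ^ 2 * (((m - 1).factorial : ℝ) * (((Equiv.Perm.sign π : ℤ) : ℝ) *
            ((Pi.single p1 1 : Fin n → ℝ) p0 * (Pi.single p0 1 : Fin n → ℝ) p1 -
              (Pi.single p1 1 : Fin n → ℝ) p1 * (Pi.single p0 1 : Fin n → ℝ) p0)))) with hW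
      have hW0 : W ≠ 0 := by simp [hW, hp, hp.symm, hm0, hf, hsg, hs0]
      have e : (((0, 0, WithLp.toLp 2 fun i => -(s.1⁻¹ * (Pi.single p1 1 : Fin n → ℝ) i)),
          W) : State n × ℝ) =
          (-s.1⁻¹) • ((0, 0, EuclideanSpace.single p1 1), 0) + W • (0, 1) := by
        refine Prod.ext (Prod.ext ?_ (Prod.ext ?_ ?_)) ?_
        · simp
        · simp
        · ext i
          simp [Pi.single_apply]
        · simp
      rw [e, map_add, map_add, map_smul, map_smul, map_smul, map_smul, hu η] at h3
      exact smul_right_injective ℝ hW0 (add_left_cancel h3)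
    exact fun η => ⟨(hy η).trans (hy 0).symm, (hu η).trans (hu 0).symm⟩
  refine ⟨(key 1 η).1, fun i => ?_⟩
  have := (key (Equiv.swap (freePos h2 1) i) η).2
  rwa [Equiv.swap_apply_left] at this

end Even

end GasDynamics
end

/-! ### Even dimensions: the entropy equation, triviality, and the classification -/

noncomputable section

namespace GasDynamics

variable {n : ℕ}

open Function Set

section Even

variable {m : ℕ} (hm : 1 ≤ m) (h : n = 2 * m)
variable {I J : Set ℝ} {F : ℝ × ℝ → ℝ} (hI : IsOpen I) (hJo : IsOpen J)
  (hJ : ∀ r ∈ J, 0 < r) (hF : ContDiffOn ℝ ∞ F (I ×ˢ J))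
variable {T : State n × ℝ → ℝ} (hT : ContDiffOn ℝ ∞ T (stateDomain n I J ×ˢ univ))

section Necessity

variable (hc : IsConserved F I J (evenDensity h T))
include hm h hI hJo hJ hF hT hc

theorem evenDensity_affine {s : State n} (hs : s ∈ stateDomain n I J) (η : ℝ) :
    T (s, η) = (T (s, 1) - T (s, 0)) * η + T (s, 0) := by
  have h1 : ∀ η, HasDerivAt (fun η => T (s, η)) (fderiv ℝ T (s, 0) (0, 1)) η := by
    intro η
    rw [← (fderiv_evenDensity_eq hm h hI hJo hJ hF hT hc hs η).1]
    exact HasFDerivAt.comp_hasDerivAt η (hasFDerivAt_density hI hJo hT hs η)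
      ((hasDerivAt_const η s).prodMk (hasDerivAt_id η))
  set K := fderiv ℝ T (s, 0) (0, 1)
  have h2 : ∀ η, HasDerivAt (fun η => T (s, η) - η * K) 0 η := by
    intro η
    exact ((h1 η).sub ((hasDerivAt_id η).mul_const K)).congr_deriv (by ring)
  have h3 : ∀ η, T (s, η) - η * K = T (s, 0) := fun η => by
    simpa using is_const_of_deriv_eq_zero (fun t => (h2 t).differentiableAt)
      (fun t => (h2 t).deriv) η 0
  linear_combination h3 η - η * h3 1

/-- The velocity derivatives of T are the same at ϖ = 1 and ϖ = 0, so the coefficient of ϖ has zero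
gradient in `u`. -/
theorem evenDensity_coeff_eq {r p : ℝ} (hr : r ∈ J) (hp : p ∈ I) (u : Space n) :
    T ((r, p, u), 1) - T ((r, p, u), 0) = T ((r, p, 0), 1) - T ((r, p, 0), 0) := by
  let ι : Space n →L[ℝ] State n × ℝ := (ContinuousLinearMap.inl ℝ (State n) ℝ).comp
    ((ContinuousLinearMap.inr ℝ ℝ (ℝ × Space n)).comp (ContinuousLinearMap.inr ℝ ℝ (Space n)))
  have h1 : ∀ η u, HasFDerivAt (fun u => T ((r, p, u), η))
      ((fderiv ℝ T ((r, p, u), η)).comp ι) u := by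
    intro η u
    have h2 : HasFDerivAt (fun u : Space n => (((r, p, u), η) : State n × ℝ)) ι u := by
      have := ι.hasFDerivAt (x := u)
      refine (this.add_const (((r, p, 0), η) : State n × ℝ)).congr_of_eventuallyEq
        (.of_forall fun w => ?_)
      simp [ι]
    exact (hasFDerivAt_density hI hJo hT ⟨hr, hp⟩ η).comp u h2
  refine is_const_of_fderiv_eq_zero (𝕜 := ℝ) (f := fun u => T ((r, p, u), 1) - T ((r, p, u), 0))
    (fun u => ((h1 1 u).sub (h1 0 u)).differentiableAt) (fun u => ?_) u 0
  refine (((h1 1 u).sub (h1 0 u)).fderiv).trans ?_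
  rw [sub_eq_zero]
  refine ContinuousLinearMap.coe_injective
    ((EuclideanSpace.basisFun (Fin n) ℝ).toBasis.ext fun i => ?_)
  have h3 := (fderiv_evenDensity_eq hm h hI hJo hJ hF hT hc
    (s := (r, p, u)) ⟨hr, hp⟩ 1).2 i
  simpa [ι] using h3

/-- A conserved density of vorticity form is an entropy times the vorticity scalar, up to a
kinematic density. -/
theorem exists_isEntropy_of_isConserved : ∃ S : ℝ × ℝ → ℝ, IsEntropy F I J S ∧
    ∀ s ∈ stateDomain n I J, ∀ η : ℝ, T (s, η) = S (s.2.1, s.1) * η + T (s, 0) := by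
  set S : ℝ × ℝ → ℝ := fun z => T ((z.2, z.1, 0), 1) - T ((z.2, z.1, 0), 0) with hSdef
  have hTS : ∀ s ∈ stateDomain n I J, ∀ η : ℝ, T (s, η) = S (s.2.1, s.1) * η + T (s, 0) := by
    rintro ⟨r, p, u⟩ hs η
    rw [evenDensity_affine hm h hI hJo hJ hF hT hc hs,
      evenDensity_coeff_eq hm h hI hJo hJ hF hT hc hs.1 hs.2]
  have hS : ContDiffOn ℝ ∞ S (I ×ˢ J) := by
    have h1 : ∀ η : ℝ, ContDiffOn ℝ ∞ (fun z : ℝ × ℝ => T ((z.2, z.1, (0 : Space n)), η))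
        (I ×ˢ J) := fun η => hT.comp (f := fun z : ℝ × ℝ => ((z.2, z.1, (0 : Space n)), η))
      ((contDiff_snd.prodMk (contDiff_fst.prodMk contDiff_const)).prodMk
        contDiff_const).contDiffOn fun z hz => ⟨⟨hz.2, hz.1⟩, mem_univ _⟩
    exact (h1 1).sub (h1 0)
  refine ⟨S, ⟨hS, ?_⟩, hTS⟩
  rintro ⟨p, r⟩ hz
  have hs : ((r, p, 0) : State n) ∈ stateDomain n I J := ⟨hz.2, hz.1⟩
  set s : State n := (r, p, 0) with hsdef
  set f := F (p, r) with hfdef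
  set σ := r * derivRho S (p, r) + f * derivP S (p, r) with hσ
  have h1 : ∀ η, fderiv ℝ T (s, η) ((r, f, 0), 0) =
      σ * η + fderiv ℝ T (s, 0) ((r, f, 0), 0) := by
    intro η
    have hline : ∀ η : ℝ, HasDerivAt (fun τ : ℝ => T (s + τ • ((r, f, 0) : State n), η))
        (fderiv ℝ T (s, η) ((r, f, 0), 0)) 0 := fun η => by
      have h2 : HasDerivAt (fun τ : ℝ => (s + τ • ((r, f, 0) : State n), η))
          ((r, f, 0), 0) 0 := HasDerivAt.prodMk (by
        simpa using ((hasDerivAt_id (0 : ℝ)).smul_const ((r, f, 0) : State n)).const_add s)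
        (hasDerivAt_const _ _)
      exact HasFDerivAt.comp_hasDerivAt_of_eq (0 : ℝ) (hasFDerivAt_density hI hJo hT hs η) h2
        (by simp)
    have hS' : HasDerivAt (fun τ : ℝ => S (p + τ * f, r + τ * r)) σ 0 := by
      have h3 : HasDerivAt (fun τ : ℝ => (p + τ * f, r + τ * r)) (f, r) 0 := HasDerivAt.prodMk
        (by simpa using ((hasDerivAt_id (0 : ℝ)).mul_const f).const_add p)
        (by simpa using ((hasDerivAt_id (0 : ℝ)).mul_const r).const_add r)
      have hd := differentiableAt_of_mem hI hJo hS hz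
      refine (HasFDerivAt.comp_hasDerivAt_of_eq (0 : ℝ) hd.hasFDerivAt h3 (by simp)).congr_deriv ?_
      rw [fderiv_apply_eq hd]
      ring
    have hcont : Continuous (fun τ : ℝ => s + τ • ((r, f, 0) : State n)) := by fun_prop
    have hev : ∀ᶠ τ : ℝ in nhds 0, s + τ • ((r, f, 0) : State n) ∈ stateDomain n I J :=
      hcont.continuousAt.eventually ((isOpen_stateDomain hI hJo).mem_nhds (by simpa using hs))
    refine (hline η).unique (((hS'.mul_const η).add (hline 0)).congr_of_eventuallyEq ?_)
    filter_upwards [hev] with τ hτ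
    rw [hTS _ hτ]
    rfl
  have h2 : 2 + 2 * (m - 1) = n := by omega
  have hm0 : (m : ℝ) ≠ 0 := Nat.cast_ne_zero.2 (by omega)
  have hf : ((m - 1).factorial : ℝ) ≠ 0 := by positivity
  have h01 : freePos h2 0 ≠ freePos h2 1 := by rw [ne_eq, freePos_inj]; decide
  have hL := isNullLagrangian_evenDensity hm h hI hJo hJ hF hT hc
  set ξ : Fin n → ℝ := Pi.single (freePos h2 1) 1 with hξ
  -- Adding ξ to e_p₀ does not affect a ∧ ξ but makes a · ξ = 1, so that along the line both the
  -- divergence of the velocity and ϖ have nonzero slope.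
  set a : Fin n → ℝ := fun i => (Pi.single (freePos h2 0) 1 : Fin n → ℝ) i + ξ i with ha
  set N : Fin n → Fin n → ℝ := permForm h2 1 with hN
  obtain ⟨α, β, hαβ⟩ := rankOne_affine_mkGrad hI hJo (contDiffOn_convectiveLagrangian hI hJo hJ hF
    hT (contDiff_gradVortScalar h) (contDiffOn_baroclinicScalar hm h hJ)) hL hs 0 0 N 0 a ξ
  set κ : ℝ := m * star h2 (fun e => a (e 0) * ξ (e 1)) (fun _ => N) with hκ
  have hκ0 : κ ≠ 0 := by
    rw [hκ, hN, star_two_permForm h2]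
    simp [ha, hξ, h01, h01.symm, hm0, hf]
  set y0 := star (n := n) (q := 0) (r := m) (by omega) (fun _ => 1) (fun _ => N)
  set d := ∑ i, N i i
  have haξ : ∑ i, a i * ξ i = 1 := by
    simp [ha, hξ, Pi.single_apply, h01.symm]
  set C := fderiv ℝ T (s, 0) ((r, f, 0), 0) - T (s, 0) with hC
  -- With ∇ρ = ∇p = 0 the Lagrangian is minus the divergence of the velocity times an affine
  -- function of ϖ with slope σ. The product is quadratic in `t`, yet L is affine on the line.
  have hval : ∀ t : ℝ, -(d + t) * (σ * (y0 + t * κ) + C) = α + t * β := by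
    intro t
    rw [← hαβ t]
    have hy := gradVortScalar_mkGrad hm h (0 : Fin n → ℝ) (fun k => 0 + t * (0 * ξ k)) N a ξ t
    have hR := baroclinicScalar_mkGrad hm h s (0 : Fin n → ℝ) N a ξ 0 t
    rw [mul_zero, zero_smul, add_zero] at hR
    simp only [Pi.zero_apply, convectiveLagrangian, hy, hR, gradMat_mkGrad, mkGrad_single,
      Finset.sum_add_distrib, ← Finset.mul_sum, haξ]
    change _ = fderiv ℝ T (s, y0 + t • κ) _ + _
    rw [smul_eq_mul]
    set η := y0 + t * κ
    have e : (((-(s.1 * (d + t * 1)), -(F (s.2.1, s.1) * (d + t * 1)),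
        WithLp.toLp 2 fun i => -(s.1⁻¹ * (0 + t * (0 * ξ i)))), 0 - (d + t * 1) • η) :
        State n × ℝ) = (-(d + t)) • ((r, f, 0), 0) + (-(d + t) * η) • (0, 1) := by
      refine Prod.ext (Prod.ext ?_ (Prod.ext ?_ ?_)) ?_
      · simp [hsdef]; ring
      · simp [hsdef, hfdef]; ring
      · ext i; simp
      · simp; ring
    have h3 : fderiv ℝ T (s, η) (0, 1) = S (p, r) := by
      have h4 : HasDerivAt (fun η => T (s, η)) (fderiv ℝ T (s, η) (0, 1)) η :=
        HasFDerivAt.comp_hasDerivAt η (hasFDerivAt_density hI hJo hT hs η)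
          ((hasDerivAt_const η s).prodMk (hasDerivAt_id η))
      refine h4.unique ?_
      have h5 : (fun η => T (s, η)) = fun η => S (p, r) * η + T (s, 0) := by
        funext η; exact hTS s hs η
      rw [h5]
      simpa using ((hasDerivAt_id η).const_mul (S (p, r))).add_const (T (s, 0))
    rw [e, map_add, map_smul, map_smul, h1, h3, hTS s hs η, hC]
    simp only [smul_eq_mul, hsdef]
    ring
  -- A second difference extracts the coefficient of t².
  have h5 : σ * κ = 0 := by
    have e1 := hval 1
    have e2 := hval (-1)
    have e0 := hval 0
    linear_combination (e0 - (e1 + e2) / 2)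
  exact (mul_eq_zero.1 h5).resolve_right hκ0

end Necessity

include hm hI hJo in
-- A trivial Sϖ is a null Lagrangian. On an affine field with constant ρ and p and nonzero
-- vorticity, variations of ∇ρ and ∇p do not change ϖ, so the Euler-Lagrange equation says that
-- every derivative of S times ϖ vanishes. The rectangle is connected.
theorem eq_const_of_isTrivial (hIc : I.OrdConnected) (hJc : J.OrdConnected) {S : ℝ × ℝ → ℝ}
    (hS : ContDiffOn ℝ ∞ S (I ×ˢ J)) (ht : IsTrivial I J (entropyVorticity h S)) :
    ∃ k : ℝ, ∀ z ∈ I ×ˢ J, S z = k := by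
  obtain ⟨Θ, hΘ, hdiv⟩ := ht
  set L : State n × Grad n → ℝ := fun z => S (z.1.2.1, z.1.1) * gradVortScalar h z.2
  have hL : IsNullLagrangian (stateDomain n I J) L := hΘ.isNullLagrangian 0 fun v hv x => by
    rw [← hdiv 0 v hv x, entropyVorticity, vortScalar_eq_gradVortScalar h hv.1]
    rfl
  have hLs : ContDiffOn ℝ ∞ L (stateDomain n I J ×ˢ univ) :=
    (contDiffOn_thermoPart hS).mul ((contDiff_gradVortScalar h).comp contDiff_snd).contDiffOn
  obtain ⟨N, hN⟩ := exists_star_zero_ne_zero hm h (by omega)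
  refine (hI.prod hJo).exists_is_const_of_fderiv_eq_zero (𝕜 := ℝ)
    (hIc.isPreconnected.prod hJc.isPreconnected)
    (fun z hz => (differentiableAt_of_mem hI hJo hS hz).differentiableWithinAt) fun z hz => ?_
  have hd := differentiableAt_of_mem hI hJo hS hz
  refine ContinuousLinearMap.ext fun w => ?_
  obtain ⟨b, a⟩ := w
  have h1 := hL.euler_lagrange_affine (isOpen_stateDomain hI hJo) hLs
    (s := (z.2, z.1, 0)) ⟨hz.2, hz.1⟩ (mkGrad 0 0 N) (a, b, 0)
  have h2 : ∀ k (θ : ℝ), gradVortScalar h (mkGrad 0 0 N + θ • unitGrad k ((a, b, 0) : State n)) =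
      star (q := 0) (r := m) (by omega) (fun _ => 1) (fun _ => N) := by
    intro k θ
    rw [gradVortScalar]
    congr 1
    funext _ i j
    change (mkGrad 0 0 N (EuclideanSpace.single j 1) +
      θ • unitGrad k ((a, b, 0) : State n) (EuclideanSpace.single j 1)).2.2 i = _
    rw [mkGrad_single, unitGrad_single]
    split_ifs <;> simp
  have h3 : gradVortScalar h (mkGrad 0 0 N) =
      star (q := 0) (r := m) (by omega) (fun _ => 1) (fun _ => N) := by
    rw [gradVortScalar, gradMat_mkGrad]
  simp only [L, h2, h3, deriv_const, Finset.sum_const_zero] at h1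
  rw [deriv_mul_const_field] at h1
  have h4 := (mul_eq_zero.1 h1).resolve_right hN
  have h5 : HasDerivAt (fun τ : ℝ => (z.1 + τ * b, z.2 + τ * a)) (b, a) 0 := HasDerivAt.prodMk
    (by simpa using ((hasDerivAt_id (0 : ℝ)).mul_const b).const_add z.1)
    (by simpa using ((hasDerivAt_id (0 : ℝ)).mul_const a).const_add z.2)
  exact (HasFDerivAt.comp_hasDerivAt_of_eq (0 : ℝ) hd.hasFDerivAt h5 (by simp)).deriv.symm.trans h4

include hm in
-- Constancy of S makes ∇S vanish, and with it the circulatory part of the trivial density already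
-- found.
theorem isTrivial_of_eq_const {S : ℝ × ℝ → ℝ}
    (hS : ContDiffOn ℝ ∞ S (I ×ˢ J)) {k : ℝ} (hk : ∀ z ∈ I ×ˢ J, S z = k) :
    IsTrivial I J (entropyVorticity h S) := by
  obtain ⟨Θ, hΘ, hdiv⟩ := isTrivial_entropyVorticity_add hm h hS
  refine ⟨Θ, hΘ, fun t v hv x => ?_⟩
  rw [← hdiv t v hv x]
  have h1 : ∀ j, pd j (fun y => S (thermo v y)) x = 0 := fun j => by
    rw [show (fun y => S (thermo v y)) = fun _ => k from funext fun y => hk _ (hv.thermo_mem y),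
      pd_const]
  simp [circulatoryEntropy, h1]

include hI hJo hJ hF hm in
theorem isConserved_evenDensity_iff (hJc : J.OrdConnected) (hJ₀ : J.Nonempty)
    (hT : ContDiffOn ℝ ∞ T (stateDomain n I J ×ˢ univ)) :
    IsConserved F I J (evenDensity h T) ↔
      ∃ (S : ℝ × ℝ → ℝ) (c : State n → ℝ), IsEntropy F I J S ∧
        ContDiffOn ℝ ∞ c (stateDomain n I J) ∧ IsConserved F I J (kinematicDensity c) ∧
        ∀ s ∈ stateDomain n I J, ∀ ϖ : ℝ, T (s, ϖ) = S (s.2.1, s.1) * ϖ + c s := by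
  have hϖ : ∀ v, Admissible I J v → ∀ x, ∃ η', HasDerivAt (fun ε : ℝ =>
      vortScalar h (fun z => v z + ε • evolution F v z) x) η' 0 := fun v hv x => by
    have hev := hv.contDiff_evolution hJ hF
    refine ⟨_, (hasDerivAt_gradVortScalar hm h hJ hF hv x).congr_of_eventuallyEq
      (.of_forall fun ε => ?_)⟩
    exact vortScalar_eq_gradVortScalar h (hv.1.add (hev.const_smul ε)) x
  have hdT : ∀ T : State n × ℝ → ℝ, ContDiffOn ℝ ∞ T (stateDomain n I J ×ˢ univ) →
      ∀ v, Admissible I J v → ∀ x, DifferentiableAt ℝ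
        (fun ε : ℝ => evenDensity h T (fun z => v z + ε • evolution F v z) x) 0 :=
    fun T hT v hv x => by
      obtain ⟨η', hη⟩ := hϖ v hv x
      exact (hasDerivAt_density_evolution hI hJo hT hv hη).differentiableAt
  constructor
  · intro hc
    obtain ⟨S, hS, hTS⟩ := exists_isEntropy_of_isConserved hm h hI hJo hJ hF hT hc
    have hSsm : ContDiffOn ℝ ∞ (fun z : State n × ℝ => S (z.1.2.1, z.1.1) * z.2)
        (stateDomain n I J ×ˢ univ) := ContDiffOn.mul
      (hS.1.comp (f := fun z : State n × ℝ => (z.1.2.1, z.1.1))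
        (contDiff_fst.snd.fst.prodMk contDiff_fst.fst).contDiffOn fun z hz => ⟨hz.1.2, hz.1.1⟩)
      contDiff_snd.contDiffOn
    refine ⟨S, fun s => T (s, 0), hS, ?_, ?_, hTS⟩
    · exact hT.comp (f := fun s => (s, 0)) (contDiff_id.prodMk contDiff_const).contDiffOn
        fun s hs => ⟨hs, mem_univ _⟩
    · refine hc.of_eq_add (c := -1) (isConserved_entropyVorticity hm hI hJo hJ h hJc hJ₀ hF hS)
        (hdT T hT) (hdT _ hSsm) fun v hv x => ?_
      filter_upwards [eventually_mem_stateDomain hI hJo hv x] with ε hε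
      have := hTS _ hε (vortScalar h (fun z => v z + ε • evolution F v z) x)
      rw [kinematicDensity, evenDensity, this, entropyVorticity]
      simp only [thermo, pres, dens]
      ring
  · rintro ⟨S, c, hS, hcs, hcc, hTS⟩
    have hSsm : ContDiffOn ℝ ∞ (fun z : State n × ℝ => S (z.1.2.1, z.1.1) * z.2)
        (stateDomain n I J ×ˢ univ) := ContDiffOn.mul
      (hS.1.comp (f := fun z : State n × ℝ => (z.1.2.1, z.1.1))
        (contDiff_fst.snd.fst.prodMk contDiff_fst.fst).contDiffOn fun z hz => ⟨hz.1.2, hz.1.1⟩)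
      contDiff_snd.contDiffOn
    refine (isConserved_entropyVorticity hm hI hJo hJ h hJc hJ₀ hF hS).of_eq_add (c := 1) hcc
      (hdT _ hSsm) (hdT (fun z => c z.1) (hcs.comp contDiff_fst.contDiffOn fun z hz => hz.1))
      fun v hv x => ?_
    filter_upwards [eventually_mem_stateDomain hI hJo hv x] with ε hε
    have := hTS _ hε (vortScalar h (fun z => v z + ε • evolution F v z) x)
    rw [kinematicDensity, evenDensity, this, entropyVorticity]
    simp only [thermo, pres, dens]
    ring

end Even

end GasDynamics
end

noncomputable section

namespace GasDynamics

variable {n : ℕ}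

open Function Set

/-! ### Conserved densities of vorticity form in odd dimensions -/

/-- The vector with components `*(e_i ∧ x ∧ y ∧ N^r)`. -/
def starCross {r : ℕ} (h : 3 + 2 * r = n) (N : Fin n → Fin n → ℝ) (x y : Fin n → ℝ) : Space n :=
  WithLp.toLp 2 fun i => star h
    (fun e => (Pi.single i 1 : Fin n → ℝ) (e 0) * (x (e 1) * y (e 2))) (fun _ => N)

/-- The vector with components `*(e_i ∧ N^r)`. -/
def starVec {r : ℕ} (h : 1 + 2 * r = n) (N : Fin n → Fin n → ℝ) : Space n :=
  WithLp.toLp 2 fun i => star h (fun e => (Pi.single i 1 : Fin n → ℝ) (e 0)) (fun _ => N)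

theorem sum_mul_starVec {r : ℕ} (h : 1 + 2 * r = n) (N : Fin n → Fin n → ℝ) (z : Fin n → ℝ) :
    ∑ i, z i * starVec h N i = star h (fun e => z (e 0)) (fun _ => N) := by
  simp only [starVec, ← star_const_mul_left, ← star_sum_left]
  congr 1; funext e
  simp [Pi.single_apply]

theorem sum_mul_starCross {r : ℕ} (h : 3 + 2 * r = n) (N : Fin n → Fin n → ℝ)
    (z x y : Fin n → ℝ) :
    ∑ i, z i * starCross h N x y i =
      star h (fun e => z (e 0) * (x (e 1) * y (e 2))) (fun _ => N) := by
  simp only [starCross, ← star_const_mul_left, ← star_sum_left]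
  congr 1; funext e
  rw [Finset.sum_eq_single (e 0)]
  · simp
  · intro i _ hi
    simp [hi.symm]
  · simp

theorem starCross_zero_right {r : ℕ} (h : 3 + 2 * r = n) (N : Fin n → Fin n → ℝ)
    (x : Fin n → ℝ) : starCross h N x 0 = 0 := by
  ext i
  exact star_zero_left h (fun e => by simp) _

theorem starCross_swap {r : ℕ} (h : 3 + 2 * r = n) (N : Fin n → Fin n → ℝ) (x y : Fin n → ℝ) :
    starCross h N y x = -starCross h N x y := by
  ext i
  simp only [starCross, PiLp.neg_apply]
  rw [← star_swap_left h (c := 1) (d := 2) (by decide)]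
  congr 1; funext e
  simp [mul_comm, Equiv.swap_apply_of_ne_of_ne]

theorem starVec_add_rankOne {r : ℕ} (h : 1 + 2 * r = n) (hr : 1 ≤ r)
    (h' : 3 + 2 * (r - 1) = n) (N : Fin n → Fin n → ℝ) (a ξ : Fin n → ℝ) (t : ℝ) :
    starVec h (fun i j => N i j + t * (a i * ξ j)) =
      starVec h N + t • ((r : ℝ) • starCross h' N a ξ) := by
  ext i
  simp only [starVec, starCross, PiLp.add_apply, PiLp.smul_apply, smul_eq_mul]
  rw [star_add_rankOne h hr (by omega)]
  rfl

theorem starCross_add_rankOne {r : ℕ} (h : 3 + 2 * r = n) (N : Fin n → Fin n → ℝ)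
    (a ξ ζ : Fin n → ℝ) (t : ℝ) :
    starCross h (fun i j => N i j + t * (a i * ξ j)) ξ ζ = starCross h N ξ ζ := by
  ext i
  simp only [starCross]
  exact star_add_rankOne_of_factor h (c := 1)
    (b' := fun e => (Pi.single i 1 : Fin n → ℝ) (e 0) * ζ (e 2)) (fun e => by ring)
    (fun e l => by simp) a N t

section Odd

variable {m : ℕ} (hm : 1 ≤ m) (h : n = 2 * m + 1)

/-- The vorticity vector as a function of the gradient of the gas variables. -/
def gradVortVector (M : Grad n) : Space n :=
  starVec (r := m) (by omega) (gradMat M)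

/-- The source of the vorticity vector, due to vortex stretching and to baroclinicity. -/
def vorticitySource (z : State n × Grad n) : Space n :=
  (WithLp.toLp 2 fun i => star (q := 1) (r := m) (by omega) (fun e => gradMat z.2 i (e 0))
    (fun _ => gradMat z.2)) +
  (m * z.1.1⁻¹ ^ 2 : ℝ) • starCross (r := m - 1) (by omega) (gradMat z.2)
    (fun k => (z.2 (EuclideanSpace.single k 1)).2.1) (fun k => (z.2 (EuclideanSpace.single k 1)).1)

theorem vortVector_eq_gradVortVector {v : Field n} (hv : ContDiff ℝ ∞ v) (x : Space n) :
    vortVector h v x = gradVortVector h (fderiv ℝ v x) := by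
  ext i
  have := inner_vortVector h (EuclideanSpace.single i 1) v x
  simp only [ug_eq_gradMat hv] at this
  rw [EuclideanSpace.inner_single_left, map_one, one_mul] at this
  exact this

theorem contDiff_starVec_gradMat {r : ℕ} (h : 1 + 2 * r = n) :
    ContDiff ℝ ∞ (fun M : Grad n => starVec h (gradMat M)) := by
  rw [← contDiffOn_univ]
  refine contDiffOn_of_apply fun k => ContDiff.contDiffOn ?_
  refine contDiff_star _ (fun _ => contDiff_const) fun _ i j => ?_
  exact (contDiff_ugPart i j).comp (contDiff_prodMk_right (0 : State n))

theorem contDiff_gradVortVector : ContDiff ℝ ∞ (gradVortVector h) :=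
  contDiff_starVec_gradMat _

variable {I J : Set ℝ} {F : ℝ × ℝ → ℝ} (hI : IsOpen I) (hJo : IsOpen J)
  (hJ : ∀ r ∈ J, 0 < r) (hF : ContDiffOn ℝ ∞ F (I ×ˢ J))

include hJ in
theorem contDiffOn_vorticitySource :
    ContDiffOn ℝ ∞ (vorticitySource hm h) (stateDomain n I J ×ˢ univ) := by
  have h1 : ContDiffOn ℝ ∞ (fun z : State n × Grad n => (WithLp.toLp 2 fun i =>
      star (q := 1) (r := m) (by omega) (fun e => gradMat z.2 i (e 0)) (fun _ => gradMat z.2) :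
      Space n)) (stateDomain n I J ×ˢ univ) := contDiffOn_of_apply fun k =>
    (contDiff_star _ (fun e => contDiff_ugPart k (e 0)) fun _ i j => contDiff_ugPart i j).contDiffOn
  have h2 : ContDiffOn ℝ ∞ (fun z : State n × Grad n => (m * z.1.1⁻¹ ^ 2 : ℝ))
      (stateDomain n I J ×ˢ univ) := contDiffOn_const.mul ((contDiff_fst.fst.contDiffOn.inv
      fun z hz => (hJ _ hz.1.1).ne').pow 2)
  have h3 : ContDiffOn ℝ ∞ (fun z : State n × Grad n => starCross (r := m - 1) (by omega)
      (gradMat z.2) (fun k => (z.2 (EuclideanSpace.single k 1)).2.1)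
      (fun k => (z.2 (EuclideanSpace.single k 1)).1)) (stateDomain n I J ×ˢ univ) :=
    contDiffOn_of_apply fun k => (contDiff_star _ (fun e => contDiff_const.mul
      ((contDiff_gradPart (e 1)).snd.fst.mul (contDiff_gradPart (e 2)).fst))
      fun _ i j => contDiff_ugPart i j).contDiffOn
  exact h1.add (h2.smul h3)

theorem pd_apply_coord {Z : Space n → Space n} (hZ : ContDiff ℝ ∞ Z) (x : Space n) (i j : Fin n) :
    pd j (fun y => Z y i) x = fderiv ℝ Z x (EuclideanSpace.single j 1) i := by
  have h1 := (EuclideanSpace.proj (𝕜 := ℝ) i).hasFDerivAt.comp x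
    (hZ.differentiable (by simp) x).hasFDerivAt
  rw [pd, show (fun y => Z y i) = (EuclideanSpace.proj (𝕜 := ℝ) i : Space n →L[ℝ] ℝ) ∘ Z from rfl,
    h1.fderiv]
  rfl

theorem hasDerivAt_of_apply {f : ℝ → Space n} {f' : Space n} {t : ℝ}
    (hf : ∀ i, HasDerivAt (fun s => f s i) (f' i) t) : HasDerivAt f f' t := by
  have h1 := hasDerivAt_pi.2 hf
  exact (PiLp.continuousLinearEquiv 2 ℝ (fun _ : Fin n => ℝ)).symm.hasFDerivAt.comp_hasDerivAt t h1

include hJ hF in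
theorem hasDerivAt_gradVortVector {v : Field n} (hv : Admissible I J v) (x : Space n) :
    HasDerivAt (fun ε : ℝ => gradVortVector h (fderiv ℝ (fun z => v z + ε • evolution F v z) x))
      (vorticitySource hm h (v x, fderiv ℝ v x) - ∑ j, fderiv ℝ
        (fun z => vel v z j • gradVortVector h (fderiv ℝ v z)) x (EuclideanSpace.single j 1)) 0 := by
  have h0 : 1 + 2 * m = n := by omega
  have hev := hv.contDiff_evolution hJ hF
  have e1 : ∀ ε : ℝ, ug (fun y => v y + ε • evolution F v y) x =
      gradMat (fderiv ℝ (fun z => v z + ε • evolution F v z) x) := fun ε =>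
    ug_eq_gradMat (hv.1.add (hev.const_smul ε)) x
  refine hasDerivAt_of_apply fun i => ?_
  have h1 := hasDerivAt_star_evolution hJ hF hv h0 x
    (B := fun _ e => (Pi.single i 1 : Fin n → ℝ) (e 0))
    (β := fun _ e => (Pi.single i 1 : Fin n → ℝ) (e 0)) (β' := fun _ => 0) rfl
    (fun _ => hasDerivAt_const _ _) (fun _ => contDiff_const)
  simp only [e1] at h1
  refine h1.congr_deriv ?_
  have hsm : ContDiff ℝ ∞ (fun z => gradVortVector h (fderiv ℝ v z)) :=
    (contDiff_gradVortVector h).comp (hv.1.fderiv_right (by simp))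
  rw [sum_star_update' h0 hm (by omega), PiLp.sub_apply, WithLp.ofLp_sum, Finset.sum_apply]
  congr 1
  · rw [vorticitySource, PiLp.add_apply, PiLp.smul_apply, ug_eq_gradMat hv.1, starCross]
    congr 1
    · congr 1
      funext e
      simp [pd_const, Pi.single_apply]
    · simp only [smul_eq_mul]
      rw [mul_assoc]
      refine congrArg _ ?_
      rw [← star_const_mul_left]
      congr 1
      funext e
      simp only [pd_dens_eq hv.1, pd_pres_eq hv.1]
      change _ * ((v x).1⁻¹ ^ 2 * _) = (v x).1⁻¹ ^ 2 * _
      have e2 : ((fun l => e (Fin.castAdd 2 l)) : Fin 1 → Fin n) 0 = e 0 := rfl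
      have e3 : (Fin.natAdd 1 (0 : Fin 2)) = (1 : Fin 3) := rfl
      have e4 : (Fin.natAdd 1 (1 : Fin 2)) = (2 : Fin 3) := rfl
      rw [e3, e4]
      change (Pi.single i 1 : Fin n → ℝ) (e 0) * _ = _
      ring
  · refine Finset.sum_congr rfl fun j _ => ?_
    have hsm' : ContDiff ℝ ∞ (fun z => vel v z j • gradVortVector h (fderiv ℝ v z)) :=
      (contDiff_vel_apply hv.1 j).smul hsm
    rw [← pd_apply_coord hsm']
    congr 1
    funext y
    rw [ug_eq_gradMat hv.1, PiLp.smul_apply, smul_eq_mul, mul_comm]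
    rfl

include hm in
theorem gradVortVector_mkGrad (ζ π : Fin n → ℝ) (N : Fin n → Fin n → ℝ)
    (a ξ : Fin n → ℝ) (t : ℝ) :
    gradVortVector h (mkGrad ζ π fun i j => N i j + t * (a i * ξ j)) =
      starVec (r := m) (by omega) N +
        t • ((m : ℝ) • starCross (r := m - 1) (by omega) N a ξ) := by
  rw [gradVortVector, gradMat_mkGrad, starVec_add_rankOne _ hm (by omega)]

theorem vorticitySource_mkGrad (s : State n) (ζ : Fin n → ℝ) (N : Fin n → Fin n → ℝ)
    (a ξ : Fin n → ℝ) (c t : ℝ) :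
    vorticitySource hm h (s, mkGrad ζ (fun k => 0 + t * (c * ξ k))
        fun i j => N i j + t * (a i * ξ j)) =
      (WithLp.toLp 2 fun i => star (q := 1) (r := m) (by omega)
        (fun e => N i (e 0) + t * (a i * ξ (e 0)))
        (fun _ i j => N i j + t * (a i * ξ j))) +
      (t * c) • ((m * s.1⁻¹ ^ 2 : ℝ) • starCross (r := m - 1) (by omega) N ξ ζ) := by
  rw [vorticitySource, gradMat_mkGrad]
  simp only [mkGrad_single]
  congr 1
  rw [← starCross_add_rankOne _ N a ξ ζ t, smul_comm (t * c)]
  congr 1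
  ext i
  simp only [starCross, PiLp.smul_apply, smul_eq_mul]
  rw [← star_const_mul_left]
  congr 1; funext e
  ring

variable {T : State n × Space n → ℝ} (hT : ContDiffOn ℝ ∞ T (stateDomain n I J ×ˢ univ))
  (hc : IsConserved F I J (oddDensity h T))
include hm hI hJo hJ hF hT hc

theorem isNullLagrangian_oddDensity :
    IsNullLagrangian (stateDomain n I J)
      (convectiveLagrangian F T (gradVortVector h) (vorticitySource hm h)) :=
  hc.isNullLagrangian hI hJo hJ hF hT (contDiff_gradVortVector h)
    (fun _ hv x => hasDerivAt_gradVortVector hm h hJ hF hv x)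
    (fun v hv x => by rw [oddDensity, vortVector_eq_gradVortVector h hv])

/-- With ∇ρ = 0 the baroclinic source vanishes, so the constancy along the line concerns the
velocity derivative alone. -/
theorem fderiv_oddDensity_vel {s : State n} (hs : s ∈ stateDomain n I J)
    (h1 : 1 + 2 * m = n) (h3 : 3 + 2 * (m - 1) = n) (N : Fin n → Fin n → ℝ) (a ξ : Fin n → ℝ)
    (t : ℝ) :
    fderiv ℝ T (s, starVec h1 N + t • ((m : ℝ) • starCross h3 N a ξ))
        ((0, 0, WithLp.toLp 2 ξ), 0) =
      fderiv ℝ T (s, starVec h1 N) ((0, 0, WithLp.toLp 2 ξ), 0) := by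
  have hs0 : s.1 ≠ 0 := (hJ _ hs.1).ne'
  have key := fderiv_eq_of_isNullLagrangian hI hJo hJ hF hT
      (contDiff_gradVortVector h) (contDiffOn_vorticitySource hm h hJ)
      (isNullLagrangian_oddDensity hm h hI hJo hJ hF hT hc) hs
      (gradVortVector_mkGrad hm h 0 · N a ξ ·) (vorticitySource_mkGrad hm h s 0 N a ξ · ·) t
  rw [starCross_zero_right, smul_zero] at key
  have e : (((0, 0, WithLp.toLp 2 fun i => -(s.1⁻¹ * ξ i)), 0) : State n × Space n) =
      (-s.1⁻¹) • ((0, 0, WithLp.toLp 2 ξ), 0) := by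
    refine Prod.ext (Prod.ext ?_ (Prod.ext ?_ ?_)) ?_
    · simp
    · simp
    · ext i; simp
    · simp
  rw [e, map_smul, map_smul] at key
  exact smul_right_injective ℝ (neg_ne_zero.2 (inv_ne_zero hs0)) key

/-- With ∇ρ = a the baroclinic source is parallel to the direction in which the vorticity moves
along the line. The velocity part is constant by `fderiv_oddDensity_vel` and is subtracted. -/
theorem fderiv_oddDensity_vort {s : State n} (hs : s ∈ stateDomain n I J)
    (h1 : 1 + 2 * m = n) (h3 : 3 + 2 * (m - 1) = n) (N : Fin n → Fin n → ℝ) (a ξ : Fin n → ℝ)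
    (t : ℝ) :
    fderiv ℝ T (s, starVec h1 N + t • ((m : ℝ) • starCross h3 N a ξ))
        (0, (m : ℝ) • starCross h3 N a ξ) =
      fderiv ℝ T (s, starVec h1 N) (0, (m : ℝ) • starCross h3 N a ξ) := by
  have hs0 : s.1 ≠ 0 := (hJ _ hs.1).ne'
  have hu := fderiv_oddDensity_vel hm h hI hJo hJ hF hT hc hs h1 h3 N a ξ t
  have key := fderiv_eq_of_isNullLagrangian hI hJo hJ hF hT
      (contDiff_gradVortVector h) (contDiffOn_vorticitySource hm h hJ)
      (isNullLagrangian_oddDensity hm h hI hJo hJ hF hT hc) hs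
      (gradVortVector_mkGrad hm h a · N a ξ ·) (vorticitySource_mkGrad hm h s a N a ξ · ·) t
  rw [starCross_swap _ N a ξ] at key
  have e : (((0, 0, WithLp.toLp 2 fun i => -(s.1⁻¹ * ξ i)),
      (m * s.1⁻¹ ^ 2 : ℝ) • -starCross h3 N a ξ) : State n × Space n) =
      (-s.1⁻¹) • ((0, 0, WithLp.toLp 2 ξ), 0) +
        (-s.1⁻¹ ^ 2) • (0, (m : ℝ) • starCross h3 N a ξ) := by
    refine Prod.ext (Prod.ext ?_ (Prod.ext ?_ ?_)) ?_
    · simp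
    · simp
    · ext i; simp
    · ext i; simp; ring
  rw [e, map_add, map_add, map_smul, map_smul, map_smul, map_smul, hu] at key
  exact smul_right_injective ℝ (neg_ne_zero.2 (pow_ne_zero 2 (inv_ne_zero hs0)))
    (add_left_cancel key)

end Odd

end GasDynamics
end

noncomputable section

namespace GasDynamics

variable {n : ℕ}

open Function Set

/-! ### Vorticity vectors of bilinear forms with prescribed rows -/

/-- The bilinear form `∑ k, A_{fst k} ⊗ A_{snd k}` built from the rows of a matrix. -/
def rowForm {r : ℕ} (h : 1 + 2 * r = n) (A : Matrix (Fin n) (Fin n) ℝ) (i j : Fin n) : ℝ :=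
  ∑ k, A (fstPos h k) i * A (sndPos h k) j

theorem starVec_rowForm {r : ℕ} (h : 1 + 2 * r = n) (A : Matrix (Fin n) (Fin n) ℝ) (i : Fin n) :
    starVec h (rowForm h A) i = r.factorial * A.adjugate i (freePos h 0) := by
  rw [Matrix.adjugate_apply]
  exact star_one_rows h A _

theorem rowForm_updateRow {r : ℕ} (h : 1 + 2 * r = n) (A : Matrix (Fin n) (Fin n) ℝ) (k : Fin r)
    (x : Fin n → ℝ) (i j : Fin n) :
    rowForm h (A.updateRow (fstPos h k) (A (fstPos h k) + x)) i j =
      rowForm h A i j + x i * A (sndPos h k) j := by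
  have h1 : ∀ l, A.updateRow (fstPos h k) (A (fstPos h k) + x) (fstPos h l) i *
      A.updateRow (fstPos h k) (A (fstPos h k) + x) (sndPos h l) j =
      A (fstPos h l) i * A (sndPos h l) j + if l = k then x i * A (sndPos h k) j else 0 := by
    intro l
    rw [Matrix.updateRow_ne (fstPos_ne_sndPos h k l).symm]
    split_ifs with hl
    · subst hl
      rw [Matrix.updateRow_self, Pi.add_apply]
      ring
    · rw [Matrix.updateRow_ne (by rwa [ne_eq, fstPos_inj]), add_zero]
  simp only [rowForm, h1, Finset.sum_add_distrib]
  simp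

/-- Adding the free row to the row `fstPos h k` is a rank-one change of the form. The direction of
the vorticity is thus the change of a cofactor; by linearity in the altered row and an exchange of
two rows it is minus another cofactor. -/
theorem starCross_rowForm {r : ℕ} (h : 1 + 2 * r = n) (hr : 1 ≤ r) (h' : 3 + 2 * (r - 1) = n)
    (A : Matrix (Fin n) (Fin n) ℝ) (k : Fin r) (i : Fin n) :
    r * starCross h' (rowForm h A) (A (freePos h 0)) (A (sndPos h k)) i =
      -(r.factorial * A.adjugate i (fstPos h k)) := by
  have h1 := congrFun (congrArg WithLp.ofLp (starVec_add_rankOne h hr h' (rowForm h A)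
    (A (freePos h 0)) (A (sndPos h k)) 1)) i
  simp only [one_mul, one_smul] at h1
  rw [PiLp.add_apply, PiLp.smul_apply, smul_eq_mul, ← funext₂ (rowForm_updateRow h A k _),
    starVec_rowForm, starVec_rowForm] at h1
  have hne := (freePos_ne_fstPos h 0 k)
  have h2 : (A.updateRow (fstPos h k) (A (fstPos h k) + A (freePos h 0))).adjugate i (freePos h 0) =
      A.adjugate i (freePos h 0) - A.adjugate i (fstPos h k) := by
    simp only [Matrix.adjugate_apply]
    rw [Matrix.updateRow_comm _ hne.symm, Matrix.det_updateRow_add, Matrix.updateRow_comm _ hne,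
      Matrix.updateRow_eq_self, sub_eq_add_neg]
    congr 1
    have h3 := Matrix.det_permute (Equiv.swap (freePos h 0) (fstPos h k))
      (A.updateRow (fstPos h k) (Pi.single i 1))
    rw [Equiv.Perm.sign_swap hne] at h3
    simp only [Units.val_neg, Units.val_one, Int.cast_neg, Int.cast_one, neg_mul, one_mul] at h3
    rw [← h3]
    congr 1
    ext a b
    rw [Matrix.submatrix_apply]
    rcases eq_or_ne a (freePos h 0) with rfl | ha
    · rw [Matrix.updateRow_ne hne]
      simp
    rcases eq_or_ne a (fstPos h k) with rfl | hb
    · simp [Matrix.updateRow_ne hne]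
    · simp [Equiv.swap_apply_of_ne_of_ne ha hb, Matrix.updateRow_ne ha, Matrix.updateRow_ne hb]
  rw [h2] at h1
  linear_combination -h1

section Odd

variable {m : ℕ} (hm : 1 ≤ m) (h : n = 2 * m + 1)
variable {I J : Set ℝ} {F : ℝ × ℝ → ℝ} (hI : IsOpen I) (hJo : IsOpen J)
  (hJ : ∀ r ∈ J, 0 < r) (hF : ContDiffOn ℝ ∞ F (I ×ˢ J))
variable {T : State n × Space n → ℝ} (hT : ContDiffOn ℝ ∞ T (stateDomain n I J ×ˢ univ))
  (hc : IsConserved F I J (oddDensity h T))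
include hm h hI hJo hJ hF hT hc

/-- The rows of an inverse matrix give a form whose vorticity and rank-one direction are two
prescribed columns, up to factorials. This realizes a base point and a direction that are
independent vectors. -/
theorem fderiv_oddDensity_col {s : State n} (hs : s ∈ stateDomain n I J) (h1 : 1 + 2 * m = n)
    {Q : Matrix (Fin n) (Fin n) ℝ} (hQ : Q.det ≠ 0) (k : Fin m) (t : ℝ) :
    fderiv ℝ T (s, WithLp.toLp 2 ((m.factorial : ℝ) • Q.col (freePos h1 0)) +
        t • WithLp.toLp 2 (Q.col (fstPos h1 k))) (0, WithLp.toLp 2 (Q.col (fstPos h1 k))) =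
      fderiv ℝ T (s, WithLp.toLp 2 ((m.factorial : ℝ) • Q.col (freePos h1 0)))
        (0, WithLp.toLp 2 (Q.col (fstPos h1 k))) := by
  have hf0 : (m.factorial : ℝ) ≠ 0 := by positivity
  -- Only two columns of Q matter. A third one is rescaled to make the determinant 1, so that the
  -- adjugate of P⁻¹ is P itself.
  set P := Q.updateCol (sndPos h1 k) (Q.det⁻¹ • Q.col (sndPos h1 k)) with hP
  have hdet : P.det = 1 := by
    rw [hP, Matrix.det_updateCol_smul]
    have : Q.updateCol (sndPos h1 k) (Q.col (sndPos h1 k)) = Q := Matrix.updateCol_eq_self _ _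
    rw [this, inv_mul_cancel₀ hQ]
  have hunit : IsUnit P.det := by rw [hdet]; exact isUnit_one
  have hadj : P⁻¹.adjugate = P := by
    have h2 := Matrix.mul_adjugate P⁻¹
    rw [Matrix.det_nonsing_inv, hdet, Ring.inverse_one, one_smul] at h2
    calc P⁻¹.adjugate = P * (P⁻¹ * P⁻¹.adjugate) := by
          rw [← mul_assoc, Matrix.mul_nonsing_inv _ hunit, one_mul]
      _ = P := by rw [h2, mul_one]
  have hPf : ∀ i, P i (freePos h1 0) = Q i (freePos h1 0) := fun i =>
    Matrix.updateCol_ne (freePos_ne_sndPos h1 0 k)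
  have hPk : ∀ i, P i (fstPos h1 k) = Q i (fstPos h1 k) := fun i =>
    Matrix.updateCol_ne (fstPos_ne_sndPos h1 k k)
  have h3 : 3 + 2 * (m - 1) = n := by omega
  have e1 : starVec h1 (rowForm h1 P⁻¹) =
      WithLp.toLp 2 ((m.factorial : ℝ) • Q.col (freePos h1 0)) := by
    ext i
    rw [starVec_rowForm, hadj, hPf]
    rfl
  have e2 : (m : ℝ) • starCross h3 (rowForm h1 P⁻¹) (P⁻¹ (freePos h1 0)) (P⁻¹ (sndPos h1 k)) =
      (-(m.factorial : ℝ)) • WithLp.toLp 2 (Q.col (fstPos h1 k)) := by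
    ext i
    rw [PiLp.smul_apply, smul_eq_mul, starCross_rowForm h1 hm, hadj, hPk, ← neg_mul]
    rfl
  have key := fderiv_oddDensity_vort hm h hI hJo hJ hF hT hc hs h1 h3 (rowForm h1 P⁻¹)
    (P⁻¹ (freePos h1 0)) (P⁻¹ (sndPos h1 k)) (-(t / m.factorial))
  rw [e1, e2, smul_smul, neg_mul_neg, div_mul_cancel₀ _ hf0] at key
  set K : Space n := WithLp.toLp 2 (Q.col (fstPos h1 k))
  have e3 : ((0, (-(m.factorial : ℝ)) • K) : State n × Space n) =
      (-(m.factorial : ℝ)) • (0, K) := Prod.ext (by simp) rfl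
  rw [e3, map_smul, map_smul] at key
  exact smul_right_injective ℝ (neg_ne_zero.2 hf0) key

/-- The base point 0 and the direction `y` are not columns of an invertible matrix, but they are
limits of such columns. Shifting a matrix whose only possibly nonzero column is `y` by multiples of
the identity gives these approximations, and continuity of the derivative of T passes to the limit.
-/
theorem fderiv_oddDensity_ray {s : State n} (hs : s ∈ stateDomain n I J) (y : Space n) (t : ℝ) :
    fderiv ℝ T (s, t • y) (0, y) = fderiv ℝ T (s, 0) (0, y) := by
  have h1 : 1 + 2 * m = n := by omega
  set P : Matrix (Fin n) (Fin n) ℝ :=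
    (0 : Matrix (Fin n) (Fin n) ℝ).updateCol (fstPos h1 ⟨0, hm⟩) y with hP
  set Q : ℝ → Matrix (Fin n) (Fin n) ℝ := fun ε => P + ε • 1 with hQ
  have hQc : Continuous Q := by fun_prop
  have hcol : ∀ j, Continuous fun ε => (WithLp.toLp 2 ((Q ε).col j) : Space n) := fun j =>
    (PiLp.continuous_toLp 2 _).comp (continuous_pi fun i => by
      have := hQc.matrix_elem i j
      exact this)
  have hdense : Dense {ε : ℝ | (Q ε).det ≠ 0} := by
    -- The determinant of the shifted matrix is the characteristic polynomial of `-P` at ε, so it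
    -- has finitely many zeros.
    have hfin : {ε : ℝ | (Q ε).det = 0}.Finite := by
      refine (Polynomial.finite_setOfPred_isRoot ((-P).charpoly_monic.ne_zero)).subset fun ε hε => ?_
      rw [mem_ofPred_eq, Polynomial.IsRoot, Matrix.eval_charpoly, ← hε, hQ]
      congr 1
      rw [sub_neg_eq_add, add_comm, Matrix.scalar_apply, ← Matrix.smul_one_eq_diagonal]
    exact hfin.countable.dense_compl ℝ
  have hD : IsOpen (stateDomain n I J ×ˢ (univ : Set (Space n))) :=
    (isOpen_stateDomain hI hJo).prod isOpen_univ
  have hT' : ∀ η : ℝ → Space n, Continuous η → Continuous fun ε => fderiv ℝ T (s, η ε) := by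
    intro η hη
    rw [← continuousOn_univ]
    exact (hT.fderiv_of_isOpen (m := ∞) hD (by simp)).continuousOn.comp
      (by fun_prop) fun t _ => ⟨hs, mem_univ _⟩
  set b : ℝ → Space n := fun ε =>
    WithLp.toLp 2 ((m.factorial : ℝ) • (Q ε).col (freePos h1 0)) with hb
  set k : ℝ → Space n := fun ε => WithLp.toLp 2 ((Q ε).col (fstPos h1 ⟨0, hm⟩)) with hk
  have hbc : Continuous b := (hcol (freePos h1 0)).const_smul (m.factorial : ℝ)
  have hkc : Continuous k := hcol _
  have hfun := Continuous.ext_on hdense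
    (f := fun ε => fderiv ℝ T (s, b ε + t • k ε) (0, k ε))
    (g := fun ε => fderiv ℝ T (s, b ε) (0, k ε))
    ((hT' _ (hbc.add (hkc.const_smul t))).clm_apply (by fun_prop))
    ((hT' _ hbc).clm_apply (by fun_prop))
    fun ε hε => fderiv_oddDensity_col hm h hI hJo hJ hF hT hc hs h1 hε _ t
  have h0 := congrFun hfun 0
  have eb : b 0 = 0 := by
    ext i
    simp [hb, hQ, hP, Matrix.updateCol_ne (freePos_ne_fstPos h1 0 _)]
  have ek : k 0 = y := by
    ext i
    simp [hk, hQ, hP]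
  simpa only [eb, ek, zero_add] using h0

/-- A conserved density of vorticity form is affine in the vorticity vector. -/
theorem oddDensity_affine {s : State n} (hs : s ∈ stateDomain n I J) (y : Space n) :
    T (s, y) = T (s, 0) + fderiv ℝ T (s, 0) (0, y) := by
  set K := fderiv ℝ T (s, 0) (0, y)
  have h1 : ∀ t : ℝ, HasDerivAt (fun t : ℝ => T (s, t • y)) K t := by
    intro t
    have h2 : HasDerivAt (fun t : ℝ => (s, t • y)) (0, y) t := (hasDerivAt_const t s).prodMk
      (by simpa using (hasDerivAt_id t).smul_const y)
    refine (HasFDerivAt.comp_hasDerivAt t (hasFDerivAt_density hI hJo hT hs (t • y))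
      h2).congr_deriv ?_
    exact fderiv_oddDensity_ray hm h hI hJo hJ hF hT hc hs y t
  have h3 : ∀ t, HasDerivAt (fun t : ℝ => T (s, t • y) - t * K) 0 t := fun t =>
    ((h1 t).sub ((hasDerivAt_id t).mul_const K)).congr_deriv (by ring)
  have h4 := is_const_of_deriv_eq_zero (fun t => (h3 t).differentiableAt)
    (fun t => (h3 t).deriv) 1 0
  simp only [one_smul, zero_smul, one_mul, zero_mul, sub_zero] at h4
  linarith

end Odd

end GasDynamics
end

/-! ### Odd dimensions: dependence of the vorticity coefficients on the velocity -/

noncomputable section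

namespace GasDynamics

variable {n : ℕ}

open Function Set

theorem exists_perm_apply_eq {a b c d : Fin n} (hab : a ≠ b) (hcd : c ≠ d) :
    ∃ π : Equiv.Perm (Fin n), π a = c ∧ π b = d := by
  refine ⟨Equiv.swap (Equiv.swap a c b) d * Equiv.swap a c, ?_, by simp⟩
  rw [Equiv.Perm.mul_apply, Equiv.swap_apply_left]
  exact Equiv.swap_apply_of_ne_of_ne (fun e => hab ((Equiv.swap a c).injective
    ((Equiv.swap_apply_left a c).trans e))) hcd

theorem sum_mul_starCross_permForm {r : ℕ} (h : 3 + 2 * r = n) (π : Equiv.Perm (Fin n))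
    (z ξ : Fin n → ℝ) :
    ∑ i, z i * starCross h (permForm h π) (Pi.single (π (freePos h 1)) 1) ξ i =
      (r.factorial : ℝ) * (((Equiv.Perm.sign π : ℤ) : ℝ) *
        (z (π (freePos h 0)) * ξ (π (freePos h 2)) - z (π (freePos h 2)) * ξ (π (freePos h 0)))) := by
  rw [sum_mul_starCross]
  refine star_permForm h π (c := 0) (d := 2) (by decide) z ξ fun a => ?_
  have h1 : (∀ l, l ≠ 0 → l ≠ 2 → a l = π (freePos h l)) ↔ a 1 = π (freePos h 1) :=
    ⟨fun h => h 1 (by decide) (by decide), fun h l h0 h2 => by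
      fin_cases l
      · exact absurd rfl h0
      · exact h
      · exact absurd rfl h2⟩
  simp only [h1, Pi.single_apply]
  split_ifs <;> simp

theorem starVec_zero {r : ℕ} (h : 1 + 2 * r = n) (hr : 1 ≤ r) : starVec h (fun _ _ => 0) = 0 := by
  ext i
  have : Nontrivial (Fin n) := Fin.nontrivial_iff_two_le.2 (by omega)
  have h1 := starVec_rowForm h 0 i
  have h2 : rowForm h 0 = fun _ _ => (0 : ℝ) := by
    funext a b; simp [rowForm]
  rw [h2, Matrix.adjugate_zero] at h1
  simpa using h1

theorem starCross_self {r : ℕ} (h : 3 + 2 * r = n) (N : Fin n → Fin n → ℝ) (x : Fin n → ℝ) :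
    starCross h N x x = 0 := by
  ext i
  have h1 := congrArg (fun v : Space n => v i) (starCross_swap h N x x)
  simp only [PiLp.neg_apply] at h1
  rw [PiLp.zero_apply]
  linarith

theorem starVec_add_symm {r : ℕ} (h : 1 + 2 * r = n) (hr : 1 ≤ r) (N : Fin n → Fin n → ℝ)
    (x : Fin n → ℝ) : starVec h (fun i j => N i j + x i * x j) = starVec h N := by
  have := starVec_add_rankOne h hr (by omega) N x x 1
  simpa [starCross_self] using this

/-- The sum over `k` reinserts a factor N in the first two free slots. Moving ζ from the last slot
to the first is a cyclic permutation of three indices, which is even. -/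
theorem sum_sum_mul_starCross {r : ℕ} (h : 1 + 2 * r = n) (hr : 1 ≤ r)
    (h' : 3 + 2 * (r - 1) = n) (N : Fin n → Fin n → ℝ) (ζ : Fin n → ℝ) :
    ∑ k, ∑ i, N i k * starCross h' N (Pi.single k 1) ζ i = ∑ i, ζ i * starVec h N i := by
  rw [sum_mul_starVec, star_peel h hr (by omega : 1 + 2 + 2 * (r - 1) = n)]
  have h1 : ∀ k, ∑ i, N i k * starCross h' N (Pi.single k 1) ζ i =
      star h' (fun e => N (e 0) k * ((Pi.single k 1 : Fin n → ℝ) (e 1) * ζ (e 2))) fun _ => N :=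
    fun k => sum_mul_starCross h' N (N · k) _ _
  simp only [h1, ← star_sum_left]
  have h2 : (fun e : Fin 3 → Fin n => ∑ k, N (e 0) k *
      ((Pi.single k 1 : Fin n → ℝ) (e 1) * ζ (e 2))) = fun e => N (e 0) (e 1) * ζ (e 2) := by
    funext e
    rw [Finset.sum_eq_single (e 1)]
    · simp
    · intro k _ hk
      simp [hk.symm]
    · simp
  rw [h2]
  have h3 := star_swap_left h' (c := 0) (d := 2) (by decide)
    (fun e => N (e 0) (e 1) * ζ (e 2)) (fun _ => N)
  have h4 := star_swap_left h' (c := 1) (d := 2) (by decide)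
    (fun e => N (e 2) (e 1) * ζ (e 0)) (fun _ => N)
  have e3 : (fun a : Fin 3 → Fin n => N ((a ∘ Equiv.swap 0 2) 0) ((a ∘ Equiv.swap 0 2) 1) *
      ζ ((a ∘ Equiv.swap 0 2) 2)) = fun e => N (e 2) (e 1) * ζ (e 0) := by
    funext a
    simp [Equiv.swap_apply_of_ne_of_ne]
  have e4 : (fun a : Fin 3 → Fin n => N ((a ∘ Equiv.swap 1 2) 2) ((a ∘ Equiv.swap 1 2) 1) *
      ζ ((a ∘ Equiv.swap 1 2) 0)) = fun e => ζ (e 0) * N (e 1) (e 2) := by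
    funext a
    simp [Equiv.swap_apply_of_ne_of_ne, mul_comm]
  rw [e3] at h3
  rw [e4] at h4
  rw [h3, neg_neg] at h4
  exact h4.symm

theorem sum_mul_starCross_right {r : ℕ} (h : 3 + 2 * r = n) (N : Fin n → Fin n → ℝ)
    (x y : Fin n → ℝ) : ∑ i, y i * starCross h N x y i = 0 := by
  rw [sum_mul_starCross]
  exact star_eq_zero_of_symm h (c := 0) (d := 2) (by decide) _ fun a => by
    simp [Equiv.swap_apply_of_ne_of_ne]; ring

theorem sum_mul_starCross_single {r : ℕ} (h : 3 + 2 * r = n) (N : Fin n → Fin n → ℝ)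
    (ζ : Fin n → ℝ) (i : Fin n) : ∑ k, ζ k * starCross h N (Pi.single k 1) ζ i = 0 := by
  simp only [starCross, ← star_const_mul_left, ← star_sum_left]
  refine star_eq_zero_of_symm h (c := 1) (d := 2) (by decide) _ fun a => ?_
  have h1 : ∀ x y z : Fin n, ∑ k, ζ k * ((Pi.single i 1 : Fin n → ℝ) x *
      ((Pi.single k 1 : Fin n → ℝ) y * ζ z)) = (Pi.single i 1 : Fin n → ℝ) x * (ζ y * ζ z) := by
    intro x y z
    rw [Finset.sum_eq_single y]
    · simp; ring
    · intro k _ hk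
      simp [hk.symm]
    · simp
  simp only [h1]
  simp [Equiv.swap_apply_of_ne_of_ne, mul_comm]

theorem state_vel_eq_sum (w : Fin n → ℝ) : ((0, 0, WithLp.toLp 2 w) : State n) =
    ∑ k, w k • (0, 0, EuclideanSpace.single k 1) := by
  refine Prod.ext ?_ (Prod.ext ?_ ?_)
  · simp [Prod.fst_sum]
  · simp [Prod.fst_sum, Prod.snd_sum]
  · ext i
    simp [Prod.snd_sum, Pi.single_apply]

section Odd

variable {m : ℕ} (hm : 1 ≤ m) (h : n = 2 * m + 1)
variable {I J : Set ℝ} {F : ℝ × ℝ → ℝ} (hI : IsOpen I) (hJo : IsOpen J)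
  (hJ : ∀ r ∈ J, 0 < r) (hF : ContDiffOn ℝ ∞ F (I ×ˢ J))
variable {T : State n × Space n → ℝ} (hT : ContDiffOn ℝ ∞ T (stateDomain n I J ×ˢ univ))

theorem line_mem_stateDomain (hI : IsOpen I) (hJo : IsOpen J) {s : State n}
    (hs : s ∈ stateDomain n I J) (σ : State n) :
    ∀ᶠ τ : ℝ in nhds 0, s + τ • σ ∈ stateDomain n I J := by
  have hcont : Continuous (fun τ : ℝ => s + τ • σ) := by fun_prop
  exact hcont.continuousAt.eventually ((isOpen_stateDomain hI hJo).mem_nhds (by simpa using hs))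

theorem hasDerivAt_state_line {g : State n → ℝ} (hI : IsOpen I) (hJo : IsOpen J)
    (hg : ContDiffOn ℝ ∞ g (stateDomain n I J)) {s : State n} (hs : s ∈ stateDomain n I J)
    (σ : State n) : HasDerivAt (fun τ : ℝ => g (s + τ • σ)) (fderiv ℝ g s σ) 0 := by
  have h2 : HasDerivAt (fun τ : ℝ => s + τ • σ) σ 0 := by
    simpa using ((hasDerivAt_id (0 : ℝ)).smul_const σ).const_add s
  exact HasFDerivAt.comp_hasDerivAt_of_eq (0 : ℝ) ((hg.contDiffAt
    ((isOpen_stateDomain hI hJo).mem_nhds hs)).differentiableAt (by simp)).hasFDerivAt h2 (by simp)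

section Affine

variable {c : State n → ℝ} {B : Fin n → State n → ℝ}
  (hcs : ContDiffOn ℝ ∞ c (stateDomain n I J))
  (hB : ∀ i, ContDiffOn ℝ ∞ (B i) (stateDomain n I J))
  (hTB : ∀ s ∈ stateDomain n I J, ∀ y : Space n, T (s, y) = c s + ∑ i, B i s * y i)

include hI hJo hT hcs hB hTB in
theorem fderiv_affine {s : State n} (hs : s ∈ stateDomain n I J) (y : Space n) (σ : State n)
    (κ : Space n) : fderiv ℝ T (s, y) (σ, κ) =
      fderiv ℝ c s σ + ∑ i, (fderiv ℝ (B i) s σ * y i + B i s * κ i) := by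
  have h1 : HasDerivAt (fun τ : ℝ => T (s + τ • σ, y + τ • κ)) (fderiv ℝ T (s, y) (σ, κ)) 0 := by
    have h2 : HasDerivAt (fun τ : ℝ => (s + τ • σ, y + τ • κ)) (σ, κ) 0 := HasDerivAt.prodMk
      (by simpa using ((hasDerivAt_id (0 : ℝ)).smul_const σ).const_add s)
      (by simpa using ((hasDerivAt_id (0 : ℝ)).smul_const κ).const_add y)
    exact HasFDerivAt.comp_hasDerivAt_of_eq (0 : ℝ) (hasFDerivAt_density hI hJo hT hs y) h2
      (by simp)
  have h3 : HasDerivAt (fun τ : ℝ => c (s + τ • σ) + ∑ i, B i (s + τ • σ) * (y i + τ * κ i))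
      (fderiv ℝ c s σ + ∑ i, (fderiv ℝ (B i) s σ * y i + B i s * κ i)) 0 := by
    refine (hasDerivAt_state_line hI hJo hcs hs σ).add (HasDerivAt.fun_sum fun i _ => ?_)
    have h4 : HasDerivAt (fun τ : ℝ => y i + τ * κ i) (κ i) 0 := by
      simpa using ((hasDerivAt_id (0 : ℝ)).mul_const (κ i)).const_add (y i)
    refine ((hasDerivAt_state_line hI hJo (hB i) hs σ).mul h4).congr_deriv ?_
    simp
  refine h1.unique (h3.congr_of_eventuallyEq ?_)
  filter_upwards [line_mem_stateDomain hI hJo hs σ] with τ hτ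
  exact hTB _ hτ _

variable (hc : IsConserved F I J (oddDensity h T))
include hm h hI hJo hJ hF hT hc hcs hB hTB

/-- Along the rank-one line the u-derivative of B·ϖ in the direction ξ is constant, so the
derivative of B along ξ is orthogonal to ∗(a ∧ ξ ∧ N^(m−1)). Standard test gradients reduce this to
two coordinates: the derivative is parallel to ξ. -/
theorem fderiv_coeff_vel_mul {s : State n} (hs : s ∈ stateDomain n I J) (ξ : Fin n → ℝ)
    {p q : Fin n} (hpq : p ≠ q) :
    fderiv ℝ (B p) s (0, 0, WithLp.toLp 2 ξ) * ξ q =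
      fderiv ℝ (B q) s (0, 0, WithLp.toLp 2 ξ) * ξ p := by
  have h1 : 1 + 2 * m = n := by omega
  have h3 : 3 + 2 * (m - 1) = n := by omega
  obtain ⟨π, h0, h2⟩ := exists_perm_apply_eq (a := freePos h3 0) (b := freePos h3 2)
    ((freePos_inj h3).not.2 (by decide)) hpq
  have key := fderiv_oddDensity_vel hm h hI hJo hJ hF hT hc hs h1 h3 (permForm h3 π)
    (Pi.single (π (freePos h3 1)) 1) ξ 1
  rw [fderiv_affine hI hJo hT hcs hB hTB hs, fderiv_affine hI hJo hT hcs hB hTB hs] at key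
  have hsum := sum_mul_starCross_permForm h3 π
    (fun i => fderiv ℝ (B i) s (0, 0, WithLp.toLp 2 ξ)) ξ
  rw [h0, h2] at hsum
  have hm0 : (m : ℝ) ≠ 0 := Nat.cast_ne_zero.2 (by omega)
  have hf : ((m - 1).factorial : ℝ) ≠ 0 := by positivity
  have hsg : ((Equiv.Perm.sign π : ℤ) : ℝ) ≠ 0 := by simp
  have h4 : (m : ℝ) * ∑ i, fderiv ℝ (B i) s (0, 0, WithLp.toLp 2 ξ) *
      starCross h3 (permForm h3 π) (Pi.single (π (freePos h3 1)) 1) ξ i = 0 := by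
    simp only [PiLp.add_apply, PiLp.smul_apply, one_smul, PiLp.zero_apply, mul_zero, add_zero,
      smul_eq_mul, mul_add, Finset.sum_add_distrib] at key
    rw [Finset.mul_sum]
    have e : ∀ i, (m : ℝ) * (fderiv ℝ (B i) s (0, 0, WithLp.toLp 2 ξ) *
      starCross h3 (permForm h3 π) (Pi.single (π (freePos h3 1)) 1) ξ i) =
      fderiv ℝ (B i) s (0, 0, WithLp.toLp 2 ξ) * (m *
      starCross h3 (permForm h3 π) (Pi.single (π (freePos h3 1)) 1) ξ i) := fun i => by ring
    simp only [e]
    linarith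
  rw [hsum] at h4
  have h5 := (mul_eq_zero.1 ((mul_eq_zero.1 ((mul_eq_zero.1 h4).resolve_left hm0)).resolve_left
    hf)).resolve_left hsg
  linarith

/-- Every ξ is an eigenvector of the velocity Jacobian of B, so the Jacobian is a multiple of the
identity: coordinate vectors kill the off-diagonal entries, and sums of two of them equate the
diagonal ones. -/
theorem fderiv_coeff_vel {s : State n} (hs : s ∈ stateDomain n I J) (w : Fin n → ℝ)
    (i j : Fin n) :
    fderiv ℝ (B i) s (0, 0, WithLp.toLp 2 w) =
      fderiv ℝ (B j) s (0, 0, EuclideanSpace.single j 1) * w i := by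
  have hz := fun ξ {p q : Fin n} (hpq : p ≠ q) =>
    fderiv_coeff_vel_mul hm h hI hJo hJ hF hT hcs hB hTB hc hs ξ hpq
  have hoff : ∀ p q, p ≠ q → fderiv ℝ (B p) s (0, 0, EuclideanSpace.single q 1) = 0 := by
    intro p q hpq
    have := hz (Pi.single q 1) hpq
    simpa [hpq] using this
  have hdiag : ∀ p, fderiv ℝ (B p) s (0, 0, EuclideanSpace.single p 1) =
      fderiv ℝ (B j) s (0, 0, EuclideanSpace.single j 1) := by
    intro p
    rcases eq_or_ne p j with rfl | hpj
    · rfl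
    have := hz (Pi.single p 1 + Pi.single j 1) hpj
    have e : ((0, 0, WithLp.toLp 2 (Pi.single p 1 + Pi.single j 1)) : State n) =
        (0, 0, EuclideanSpace.single p 1) + (0, 0, EuclideanSpace.single j 1) := by
      refine Prod.ext ?_ (Prod.ext ?_ ?_)
      · simp
      · simp
      · ext i; simp [Pi.single_apply]
    rw [e, map_add, map_add, hoff p j hpj, hoff j p hpj.symm] at this
    simpa [hpj, hpj.symm] using this
  rw [state_vel_eq_sum, map_sum, Finset.sum_eq_single i]
  · rw [map_smul, smul_eq_mul, hdiag, mul_comm]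
  · intro k _ hk
    rw [map_smul, hoff i k hk.symm, smul_zero]
  · simp


end Affine

end Odd

end GasDynamics
end

/-! ### Odd dimensions: the coefficients are advected like entropies -/

noncomputable section

namespace GasDynamics

variable {n : ℕ}

open Function Set

section Odd

variable {m : ℕ} (hm : 1 ≤ m) (h : n = 2 * m + 1)
variable {I J : Set ℝ} {F : ℝ × ℝ → ℝ} (hI : IsOpen I) (hJo : IsOpen J)
  (hJ : ∀ r ∈ J, 0 < r) (hF : ContDiffOn ℝ ∞ F (I ×ˢ J))
variable {T : State n × Space n → ℝ} (hT : ContDiffOn ℝ ∞ T (stateDomain n I J ×ˢ univ))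
variable {c : State n → ℝ} {B : Fin n → State n → ℝ}
  (hcs : ContDiffOn ℝ ∞ c (stateDomain n I J))
  (hB : ∀ i, ContDiffOn ℝ ∞ (B i) (stateDomain n I J))
  (hTB : ∀ s ∈ stateDomain n I J, ∀ y : Space n, T (s, y) = c s + ∑ i, B i s * y i)

include hI hJo hT hcs hB hTB in
-- For the part linear in ϖ, the trace term of the convective flux cancels against the one in the
-- evolution of the vorticity; only stretching and the baroclinic source remain.
theorem convectiveLagrangian_affine {s : State n} (hs : s ∈ stateDomain n I J)
    (h1 : 1 + 2 * m = n) (h3 : 3 + 2 * (m - 1) = n) (ζ π : Fin n → ℝ) (N : Fin n → Fin n → ℝ) :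
    convectiveLagrangian F T (gradVortVector h) (vorticitySource hm h) (s, mkGrad ζ π N) =
      fderiv ℝ c s (-(s.1 * ∑ i, N i i), -(F (s.2.1, s.1) * ∑ i, N i i),
          WithLp.toLp 2 fun i => -(s.1⁻¹ * π i)) + c s * ∑ i, N i i +
        ∑ i, fderiv ℝ (B i) s (-(s.1 * ∑ i, N i i), -(F (s.2.1, s.1) * ∑ i, N i i),
          WithLp.toLp 2 fun i => -(s.1⁻¹ * π i)) * starVec h1 N i +
        ∑ i, B i s * (∑ k, N i k * starVec h1 N k + m * s.1⁻¹ ^ 2 * starCross h3 N π ζ i) := by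
  have e1 : gradVortVector h (mkGrad ζ π N) = starVec h1 N := by
    rw [gradVortVector, gradMat_mkGrad]
  have e2 : ∀ i, vorticitySource hm h (s, mkGrad ζ π N) i =
      ∑ k, N i k * starVec h1 N k + m * s.1⁻¹ ^ 2 * starCross h3 N π ζ i := by
    intro i
    rw [vorticitySource, gradMat_mkGrad, PiLp.add_apply, PiLp.smul_apply, smul_eq_mul,
      sum_mul_starVec h1 N (N i)]
    simp only [mkGrad_single]
  rw [convectiveLagrangian]
  simp only [e1, gradMat_mkGrad, mkGrad_single]
  rw [fderiv_affine hI hJo hT hcs hB hTB hs, hTB s hs]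
  simp only [PiLp.sub_apply, PiLp.smul_apply, smul_eq_mul, e2]
  have e3 : ∀ D R : Fin n → ℝ,
      ∑ i, (D i * starVec h1 N i + B i s * (R i - (∑ i, N i i) * starVec h1 N i)) =
        ∑ i, D i * starVec h1 N i + ∑ i, B i s * R i -
          (∑ i, B i s * starVec h1 N i) * ∑ i, N i i := by
    intro D R
    rw [Finset.sum_mul, ← Finset.sum_add_distrib, ← Finset.sum_sub_distrib]
    exact Finset.sum_congr rfl fun i _ => by ring
  rw [e3]
  ring

variable (hc : IsConserved F I J (oddDensity h T))
include hm h hI hJo hJ hF hT hc hcs hB hTB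

/-- With ∇ρ = ∇p = 0, the coefficient of t² in L on a rank-one line comes only from the divergence
of the velocity multiplying the change of ϖ, because the direction κ of the vorticity is orthogonal
to ξ and stretching has no t² part. This coefficient must vanish, and κ is chosen so that it singles
out the component `q`. -/
theorem fderiv_coeff_thermo {s : State n} (hs : s ∈ stateDomain n I J) (q : Fin n) :
    fderiv ℝ (B q) s (s.1, F (s.2.1, s.1), 0) = 0 := by
  have h1 : 1 + 2 * m = n := by omega
  have h3 : 3 + 2 * (m - 1) = n := by omega
  have hL := isNullLagrangian_oddDensity hm h hI hJo hJ hF hT hc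
  have hLs := contDiffOn_convectiveLagrangian hI hJo hJ hF hT
    (contDiff_gradVortVector h) (contDiffOn_vorticitySource hm h hJ)
  have : Nontrivial (Fin n) := Fin.nontrivial_iff_two_le.2 (by omega)
  obtain ⟨p, hp⟩ := exists_ne q
  obtain ⟨π, h0, h1'⟩ := exists_perm_apply_eq (a := freePos h3 0) (b := freePos h3 1)
    ((freePos_inj h3).not.2 (by decide)) hp.symm
  set l := π (freePos h3 2) with hl
  have hlq : l ≠ q := by
    rw [hl, ← h0]
    exact π.injective.ne ((freePos_inj h3).not.2 (by decide))
  have hlp : l ≠ p := by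
    rw [hl, ← h1']
    exact π.injective.ne ((freePos_inj h3).not.2 (by decide))
  set N : Fin n → Fin n → ℝ := permForm h3 π
  set a : Fin n → ℝ := Pi.single p 1 with ha
  -- The part e_l of ξ gives a nonzero κ along e_q; the part e_p, parallel to `a`, does not affect κ
  -- but makes a · ξ = 1.
  set ξ : Fin n → ℝ := Pi.single l 1 + Pi.single p 1 with hξ
  have haξ : ∑ i, a i * ξ i = 1 := by
    simp [ha, hξ, Pi.single_apply, hlp.symm]
  set w : State n := (s.1, F (s.2.1, s.1), 0) with hw
  set σ : Fin n → ℝ := fun i => fderiv ℝ (B i) s w with hσ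
  set y := starVec h1 N
  set κ := starCross h3 N a ξ with hκ
  have hσκ : ∑ i, σ i * κ i = ((m - 1).factorial : ℝ) * (((Equiv.Perm.sign π : ℤ) : ℝ) * σ q) := by
    have := sum_mul_starCross_permForm h3 π σ ξ
    rw [h1', h0, ← hl] at this
    rw [hκ, this]
    simp [hξ, hlp, hlq.symm, hp.symm]
  have hξκ : ∑ k, ξ k * κ k = 0 := sum_mul_starCross_right h3 N a ξ
  obtain ⟨α, β, hαβ⟩ := rankOne_affine_mkGrad hI hJo hLs hL hs 0 0 N 0 a ξ
  set d := ∑ i, N i i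
  have hval : ∀ t : ℝ, (d + t) * (c s - fderiv ℝ c s w) -
      (d + t) * (∑ i, σ i * y i + t * (m * ∑ i, σ i * κ i)) +
      ∑ i, B i s * (∑ k, N i k * y k + t * (m * ∑ k, N i k * κ k) +
        t * (a i * ∑ k, ξ k * y k)) = α + t * β := by
    intro t
    rw [← hαβ t, convectiveLagrangian_affine hm h hI hJo hT hcs hB hTB hs h1 h3,
      starVec_add_rankOne h1 hm h3]
    have e1 : ∑ i, (N i i + t * (a i * ξ i)) = d + t := by
      rw [Finset.sum_add_distrib, ← Finset.mul_sum, haξ, mul_one]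
    rw [e1]
    have e2 : ((-(s.1 * (d + t)), -(F (s.2.1, s.1) * (d + t)), WithLp.toLp 2 fun i =>
        -(s.1⁻¹ * ((0 : Fin n → ℝ) i + t * (0 * ξ i)))) : State n) = (-(d + t)) • w := by
      refine Prod.ext ?_ (Prod.ext ?_ ?_)
      · simp [hw]; ring
      · simp [hw]; ring
      · ext i; simp [hw]
    rw [e2]
    simp only [map_smul, smul_eq_mul, starCross_zero_right, PiLp.zero_apply, PiLp.add_apply,
      PiLp.smul_apply, mul_zero, add_zero]
    have e3 : ∑ i, -(d + t) * fderiv ℝ (B i) s w * (y i + t * (m * κ i)) =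
        -((d + t) * (∑ i, σ i * y i + t * (m * ∑ i, σ i * κ i))) := by
      simp only [Finset.mul_sum, ← Finset.sum_add_distrib, ← Finset.sum_neg_distrib]
      exact Finset.sum_congr rfl fun i _ => by simp only [hσ]; ring
    have e4 : ∀ i, ∑ k, (N i k + t * (a i * ξ k)) * (y k + t * (m * κ k)) =
        ∑ k, N i k * y k + t * (m * ∑ k, N i k * κ k) + t * (a i * ∑ k, ξ k * y k) := by
      intro i
      have : ∑ k, (N i k + t * (a i * ξ k)) * (y k + t * (m * κ k)) =
          ∑ k, N i k * y k + t * (m * ∑ k, N i k * κ k) + t * (a i * ∑ k, ξ k * y k) +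
            t * t * m * a i * ∑ k, ξ k * κ k := by
        simp only [Finset.mul_sum, ← Finset.sum_add_distrib]
        exact Finset.sum_congr rfl fun k _ => by ring
      rw [this, hξκ, mul_zero, add_zero]
    rw [show starVec h1 N = y from rfl, show starCross h3 N a ξ = κ from rfl]
    rw [e3]
    simp only [e4]
    ring
  have hm0 : (m : ℝ) ≠ 0 := Nat.cast_ne_zero.2 (by omega)
  have hf : ((m - 1).factorial : ℝ) ≠ 0 := by positivity
  have hsg : ((Equiv.Perm.sign π : ℤ) : ℝ) ≠ 0 := by simp
  have h5 : (m : ℝ) * ∑ i, σ i * κ i = 0 := by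
    have e1 := hval 1
    have e2 := hval (-1)
    have e0 := hval 0
    simp only [mul_add, Finset.sum_add_distrib] at e0 e1 e2
    have f : ∀ t : ℝ, ∀ g : Fin n → ℝ, ∑ i, B i s * (t * g i) = t * ∑ i, B i s * g i := by
      intro t g
      rw [Finset.mul_sum]
      exact Finset.sum_congr rfl fun i _ => by ring
    simp only [f] at e0 e1 e2
    linear_combination (e0 - (e1 + e2) / 2)
  rw [hσκ] at h5
  exact (mul_eq_zero.1 ((mul_eq_zero.1 ((mul_eq_zero.1 h5).resolve_left hm0)).resolve_left
    hf)).resolve_left hsg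

end Odd

end GasDynamics
end

/-! ### Odd dimensions: the Euler-Lagrange equation for the pressure -/

noncomputable section

namespace GasDynamics

variable {n : ℕ}

open Function Set

theorem hasDerivAt_inv_dens {s : State n} (hs : s.1 ≠ 0) (σ : State n) :
    HasDerivAt (fun τ : ℝ => (s + τ • σ).1⁻¹) (-(σ.1 * s.1⁻¹ ^ 2)) 0 := by
  have h1 : HasDerivAt (fun τ : ℝ => s.1 + τ * σ.1) σ.1 0 := by
    simpa using ((hasDerivAt_id (0 : ℝ)).mul_const σ.1).const_add s.1
  refine (h1.inv (by simpa using hs)).congr_deriv ?_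
  simp only [zero_mul, add_zero]
  field_simp

/-- If the derivative of `f` in the direction `w` vanishes on an open set, then so does the
derivative in this direction of any directional derivative of `f`. -/
theorem fderiv_fderiv_eq_zero {X : Type*} [NormedAddCommGroup X] [NormedSpace ℝ X] {D : Set X}
    (hD : IsOpen D) {f g : X → ℝ} (hf : ContDiffOn ℝ ∞ f D) {v w : X}
    (hw : ∀ s ∈ D, fderiv ℝ f s w = 0) (hg : ∀ s ∈ D, g s = fderiv ℝ f s v) {s : X}
    (hs : s ∈ D) : fderiv ℝ g s w = 0 := by
  have hd : DifferentiableAt ℝ (fderiv ℝ f) s :=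
    ((hf.fderiv_of_isOpen (m := ∞) hD (by simp)).contDiffAt
      (hD.mem_nhds hs)).differentiableAt (by simp)
  have h1 : ∀ u, HasFDerivAt (fun s => fderiv ℝ f s u) _ s := fun u =>
    hasFDerivAt_fderiv_comp (g := id) rfl hd (hasFDerivAt_id s) u
  have h2 : g =ᶠ[nhds s] fun s => fderiv ℝ f s v :=
    Filter.eventually_of_mem (hD.mem_nhds hs) hg
  have h3 : (fun s => fderiv ℝ f s w) =ᶠ[nhds s] fun _ => 0 :=
    Filter.eventually_of_mem (hD.mem_nhds hs) hw
  have h4 : fderiv ℝ (fderiv ℝ f) s v w = 0 := by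
    have e := congrArg (fun L : X →L[ℝ] ℝ => L v) (h3.fderiv_eq.symm.trans (h1 w).fderiv)
    simpa using e.symm
  have hsymm : IsSymmSndFDerivAt ℝ f s :=
    (hf.contDiffAt (hD.mem_nhds hs)).isSymmSndFDerivAt (by
      rw [minSmoothness_of_isRCLikeNormedField]; exact WithTop.coe_le_coe.2 le_top)
  rw [h2.fderiv_eq, (h1 v).fderiv]
  simpa using (hsymm.eq w v).trans h4

section Odd

variable {m : ℕ} (hm : 1 ≤ m) (h : n = 2 * m + 1)
variable {I J : Set ℝ} {F : ℝ × ℝ → ℝ} (hI : IsOpen I) (hJo : IsOpen J)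
  (hJ : ∀ r ∈ J, 0 < r) (hF : ContDiffOn ℝ ∞ F (I ×ˢ J))
variable {T : State n × Space n → ℝ} (hT : ContDiffOn ℝ ∞ T (stateDomain n I J ×ˢ univ))
variable {c : State n → ℝ} {B : Fin n → State n → ℝ}
  (hcs : ContDiffOn ℝ ∞ c (stateDomain n I J))
  (hB : ∀ i, ContDiffOn ℝ ∞ (B i) (stateDomain n I J))
  (hTB : ∀ s ∈ stateDomain n I J, ∀ y : Space n, T (s, y) = c s + ∑ i, B i s * y i)

variable (hc : IsConserved F I J (oddDensity h T))
include hm h hI hJo hJ hF hT hc hcs hB hTB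

/-- With the results on ∂B/∂u and on ρB_ρ + FB_p inserted, the Lagrangian is affine in a single
pressure-gradient component θ. Its slope is the quantity differentiated in the Euler-Lagrange
equation for `p`. -/
theorem convectiveLagrangian_affine_single {s : State n} (hs : s ∈ stateDomain n I J)
    (h1 : 1 + 2 * m = n) (h3 : 3 + 2 * (m - 1) = n) (j k : Fin n) (ζ : Fin n → ℝ)
    (N : Fin n → Fin n → ℝ) (θ : ℝ) :
    convectiveLagrangian F T (gradVortVector h) (vorticitySource hm h)
        (s, mkGrad ζ (fun l => (0 : Fin n → ℝ) l + θ * if k = l then 1 else 0) N) =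
      (c s - fderiv ℝ c s (s.1, F (s.2.1, s.1), 0)) * ∑ i, N i i +
        ∑ i, B i s * ∑ k, N i k * starVec h1 N k +
      θ * (-(s.1⁻¹ * fderiv ℝ c s (0, 0, EuclideanSpace.single k 1)) -
        s.1⁻¹ * fderiv ℝ (B j) s (0, 0, EuclideanSpace.single j 1) * starVec h1 N k +
        ∑ i, s.1⁻¹ ^ 2 * B i s * (m * starCross h3 N (Pi.single k 1) ζ i)) := by
  rw [convectiveLagrangian_affine hm h hI hJo hT hcs hB hTB hs h1 h3]
  set w : State n := (s.1, F (s.2.1, s.1), 0) with hw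
  set d := ∑ i, N i i
  have e1 : ((-(s.1 * d), -(F (s.2.1, s.1) * d), WithLp.toLp 2 fun i =>
        -(s.1⁻¹ * ((0 : Fin n → ℝ) i + θ * if k = i then 1 else 0))) : State n) =
      (-d) • w + (-(s.1⁻¹ * θ)) • (0, 0, EuclideanSpace.single k 1) := by
    refine Prod.ext ?_ (Prod.ext ?_ ?_)
    · simp [hw]; ring
    · simp [hw]; ring
    · ext i; simp [hw, eq_comm]
  have e2 : ∀ i, fderiv ℝ (B i) s (0, 0, EuclideanSpace.single k 1) =
      fderiv ℝ (B j) s (0, 0, EuclideanSpace.single j 1) * (Pi.single k 1 : Fin n → ℝ) i := fun i =>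
    fderiv_coeff_vel hm h hI hJo hJ hF hT hcs hB hTB hc hs (Pi.single k 1) i j
  have e3 : ∀ i, fderiv ℝ (B i) s w = 0 :=
    fun i => fderiv_coeff_thermo hm h hI hJo hJ hF hT hcs hB hTB hc hs i
  have e4 : starCross h3 N (fun l => (0 : Fin n → ℝ) l + θ * if k = l then 1 else 0) ζ =
      θ • starCross h3 N (Pi.single k 1) ζ := by
    ext i
    simp only [starCross, PiLp.smul_apply, smul_eq_mul]
    rw [← star_const_mul_left]
    congr 1; funext e
    simp only [Pi.zero_apply, zero_add, Pi.single_apply, eq_comm (a := k)]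
    ring
  rw [e1, e4]
  simp only [map_add, map_smul, smul_eq_mul, e2, e3, mul_zero, zero_add, PiLp.smul_apply]
  have e5 : ∑ i, -(s.1⁻¹ * θ) * (fderiv ℝ (B j) s (0, 0, EuclideanSpace.single j 1) *
      (Pi.single k 1 : Fin n → ℝ) i) * starVec h1 N i =
      -(s.1⁻¹ * θ) * fderiv ℝ (B j) s (0, 0, EuclideanSpace.single j 1) * starVec h1 N k := by
    rw [Finset.sum_eq_single k]
    · simp
    · intro i _ hi
      simp [hi]
    · simp
  rw [e5]
  simp only [mul_add, Finset.sum_add_distrib, Finset.mul_sum, sub_mul]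
  have e6 : ∀ i, B i s * (m * s.1⁻¹ ^ 2 * (θ * starCross h3 N (Pi.single k 1) ζ i)) =
      θ * (s.1⁻¹ ^ 2 * B i s * (m * starCross h3 N (Pi.single k 1) ζ i)) := fun i => by ring
  simp only [e6]
  ring

/-- The equation is evaluated at zero pressure gradient. The kinematic part contributes terms linear
in the pair of density and velocity gradients, collected in ℓ; those of B are nonlinear through ϖ.
In the factor 1 + m, the 1 comes from differentiating ρ⁻¹ and the m from the baroclinic term with
∂B/∂u = β. -/
theorem euler_lagrange_coeff {s : State n} (hs : s ∈ stateDomain n I J) (h1 : 1 + 2 * m = n)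
    (j : Fin n) :
    ∃ ℓ : (Fin n → ℝ) → (Fin n → Fin n → ℝ) → ℝ,
      (∀ ζ ζ' N N', ℓ (ζ + ζ') (N + N') = ℓ ζ N + ℓ ζ' N') ∧ ∀ ζ N,
      ∑ i, (fderiv ℝ (B i) s (0, 1, 0) + s.1⁻¹ *
          fderiv ℝ (fun s => fderiv ℝ (B j) s (0, 0, EuclideanSpace.single j 1)) s
            (0, 0, EuclideanSpace.single i 1)) * ∑ k, N i k * starVec h1 N k +
        (s.1⁻¹ * fderiv ℝ (fun s => fderiv ℝ (B j) s (0, 0, EuclideanSpace.single j 1)) s (1, 0, 0) -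
          (1 + m) * s.1⁻¹ ^ 2 * fderiv ℝ (B j) s (0, 0, EuclideanSpace.single j 1)) *
          ∑ k, ζ k * starVec h1 N k = ℓ ζ N := by
  have h3 : 3 + 2 * (m - 1) = n := by omega
  have hD := isOpen_stateDomain (n := n) hI hJo
  have hs0 : s.1 ≠ 0 := (hJ _ hs.1).ne'
  have hL := isNullLagrangian_oddDensity hm h hI hJo hJ hF hT hc
  have hLs := contDiffOn_convectiveLagrangian hI hJo hJ hF hT
    (contDiff_gradVortVector h) (contDiffOn_vorticitySource hm h hJ)
  set β : State n → ℝ := fun s => fderiv ℝ (B j) s (0, 0, EuclideanSpace.single j 1) with hβ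
  have hβs : ContDiffOn ℝ ∞ β (stateDomain n I J) :=
    ((hB j).fderiv_of_isOpen (m := ∞) hD (by simp)).clm_apply contDiffOn_const
  set g : State n → ℝ := fun s => c s - fderiv ℝ c s (s.1, F (s.2.1, s.1), 0) with hg
  have hFs : ContDiffOn ℝ ∞ (fun s : State n => F (s.2.1, s.1)) (stateDomain n I J) :=
    hF.comp (contDiff_snd.fst.prodMk contDiff_fst).contDiffOn fun z hz => ⟨hz.2, hz.1⟩
  have hgs : ContDiffOn ℝ ∞ g (stateDomain n I J) :=
    hcs.sub ((hcs.fderiv_of_isOpen (m := ∞) hD (by simp)).clm_apply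
      (contDiffOn_fst.prodMk (hFs.prodMk contDiffOn_const)))
  set γ : Fin n → State n → ℝ := fun k s =>
    -(s.1⁻¹ * fderiv ℝ c s (0, 0, EuclideanSpace.single k 1)) with hγ
  have hγs : ∀ k, ContDiffOn ℝ ∞ (γ k) (stateDomain n I J) := fun k =>
    ((contDiffOn_fst.inv fun z hz => (hJ _ hz.1).ne').mul
      ((hcs.fderiv_of_isOpen (m := ∞) hD (by simp)).clm_apply contDiffOn_const)).neg
  have hform := fun {s : State n} (hs : s ∈ stateDomain n I J) =>
    convectiveLagrangian_affine_single hm h hI hJo hJ hF hT hcs hB hTB hc hs h1 h3 j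
  -- `γ` and `g` are the contributions of `c` to the slope in θ and to the coefficient of the
  -- divergence of the velocity.
  refine ⟨fun ζ N => ∑ k, fderiv ℝ (γ k) s (ζ k, 0, WithLp.toLp 2 fun i => N i k) -
    fderiv ℝ g s (0, 1, 0) * ∑ i, N i i, fun ζ ζ' N N' => ?_, fun ζ N => ?_⟩
  · have e : ∀ k, ((((ζ + ζ') k, 0, WithLp.toLp 2 fun i => (N + N') i k)) : State n) =
        (ζ k, 0, WithLp.toLp 2 fun i => N i k) + (ζ' k, 0, WithLp.toLp 2 fun i => N' i k) := by
      intro k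
      refine Prod.ext ?_ (Prod.ext ?_ ?_)
      · simp
      · simp
      · ext i; simp
    simp only [e, map_add, Finset.sum_add_distrib]
    simp only [Pi.add_apply, Finset.sum_add_distrib]
    ring
  set y := starVec h1 N
  have key := euler_lagrange_mkGrad_pres hI hJo hLs hL hs ζ 0 N
  have hlhs : deriv (fun τ : ℝ => convectiveLagrangian F T (gradVortVector h)
      (vorticitySource hm h) (s + τ • ((0, 1, 0) : State n), mkGrad ζ 0 N)) 0 =
      fderiv ℝ g s (0, 1, 0) * ∑ i, N i i +
        ∑ i, fderiv ℝ (B i) s (0, 1, 0) * ∑ k, N i k * y k := by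
    have h4 : HasDerivAt (fun τ : ℝ => g (s + τ • ((0, 1, 0) : State n)) * ∑ i, N i i +
        ∑ i, B i (s + τ • ((0, 1, 0) : State n)) * ∑ k, N i k * y k)
        (fderiv ℝ g s (0, 1, 0) * ∑ i, N i i +
          ∑ i, fderiv ℝ (B i) s (0, 1, 0) * ∑ k, N i k * y k) 0 :=
      ((hasDerivAt_state_line hI hJo hgs hs _).mul_const _).add (HasDerivAt.fun_sum fun i _ =>
        (hasDerivAt_state_line hI hJo (hB i) hs _).mul_const _)
    refine (h4.congr_of_eventuallyEq ?_).deriv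
    filter_upwards [line_mem_stateDomain hI hJo hs ((0, 1, 0) : State n)] with τ hτ
    have := hform hτ j ζ N 0
    simp only [zero_mul, add_zero] at this
    exact this
  have hrhs : ∀ k, deriv (fun τ : ℝ => deriv (fun θ : ℝ =>
      convectiveLagrangian F T (gradVortVector h) (vorticitySource hm h)
        (s + τ • ((ζ k, (0 : Fin n → ℝ) k, WithLp.toLp 2 fun i => N i k) : State n),
          mkGrad ζ (fun l => (0 : Fin n → ℝ) l + θ * if k = l then 1 else 0) N)) 0) 0 =
      fderiv ℝ (γ k) s (ζ k, 0, WithLp.toLp 2 fun i => N i k) -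
        (-(ζ k * s.1⁻¹ ^ 2) * β s + s.1⁻¹ * (ζ k * fderiv ℝ β s (1, 0, 0) +
          ∑ i, N i k * fderiv ℝ β s (0, 0, EuclideanSpace.single i 1))) * y k +
        ∑ i, (-(2 * ζ k * s.1⁻¹ ^ 3) * B i s + s.1⁻¹ ^ 2 *
          (ζ k * fderiv ℝ (B i) s (1, 0, 0) + β s * N i k)) *
          (m * starCross h3 N (Pi.single k 1) ζ i) := by
    intro k
    set σ : State n := (ζ k, (0 : Fin n → ℝ) k, WithLp.toLp 2 fun i => N i k) with hσ
    have hσ' : σ = ζ k • (1, 0, 0) + (0, 0, WithLp.toLp 2 fun i => N i k) := by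
      refine Prod.ext ?_ (Prod.ext ?_ ?_)
      · simp [hσ]
      · simp [hσ]
      · ext i; simp [hσ]
    have hβσ : fderiv ℝ β s σ = ζ k * fderiv ℝ β s (1, 0, 0) +
        ∑ i, N i k * fderiv ℝ β s (0, 0, EuclideanSpace.single i 1) := by
      rw [hσ', map_add, map_smul, state_vel_eq_sum, map_sum]
      simp only [map_smul, smul_eq_mul]
    have hBσ : ∀ i, fderiv ℝ (B i) s σ = ζ k * fderiv ℝ (B i) s (1, 0, 0) + β s * N i k := by
      intro i
      rw [hσ', map_add, map_smul, smul_eq_mul,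
        fderiv_coeff_vel hm h hI hJo hJ hF hT hcs hB hTB hc hs _ i j]
    rw [← hβσ]
    simp only [← hBσ]
    have hinv := hasDerivAt_inv_dens hs0 σ
    have hs' : (s + (0 : ℝ) • σ) = s := by simp
    have h4 : HasDerivAt (fun τ : ℝ => γ k (s + τ • σ) -
        (s + τ • σ).1⁻¹ * β (s + τ • σ) * y k +
        ∑ i, (s + τ • σ).1⁻¹ ^ 2 * B i (s + τ • σ) * (m * starCross h3 N (Pi.single k 1) ζ i))
        (fderiv ℝ (γ k) s σ -
        (-(ζ k * s.1⁻¹ ^ 2) * β s + s.1⁻¹ * fderiv ℝ β s σ) * y k +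
        ∑ i, (-(2 * ζ k * s.1⁻¹ ^ 3) * B i s + s.1⁻¹ ^ 2 * fderiv ℝ (B i) s σ) *
          (m * starCross h3 N (Pi.single k 1) ζ i)) 0 := by
      refine ((hasDerivAt_state_line hI hJo (hγs k) hs σ).sub (HasDerivAt.mul_const ?_ _)).add
        (HasDerivAt.fun_sum fun i _ => HasDerivAt.mul_const ?_ _)
      · refine (hinv.mul (hasDerivAt_state_line hI hJo hβs hs σ)).congr_deriv ?_
        rw [hs']
      · refine ((hinv.pow 2).mul (hasDerivAt_state_line hI hJo (hB i) hs σ)).congr_deriv ?_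
        simp only [Pi.pow_apply, hs']
        simp only [hσ]
        ring
    refine (h4.congr_of_eventuallyEq ?_).deriv
    filter_upwards [line_mem_stateDomain hI hJo hs σ] with τ hτ
    simp only [hform hτ k ζ N]
    have h5 : ∀ A C : ℝ, deriv (fun θ : ℝ => A + θ * C) 0 = C := fun A C => by
      simp
    rw [h5]
  rw [hlhs, Finset.sum_congr rfl fun k _ => hrhs k] at key
  -- All these terms contain ζ ∧ ζ.
  have hX1 : ∑ k, ∑ i, ζ k * ((-(2 * s.1⁻¹ ^ 3) * B i s + s.1⁻¹ ^ 2 *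
      fderiv ℝ (B i) s (1, 0, 0)) * (m * starCross h3 N (Pi.single k 1) ζ i)) = 0 := by
    rw [Finset.sum_comm]
    refine Finset.sum_eq_zero fun i _ => ?_
    have := sum_mul_starCross_single h3 N ζ i
    calc _ = ((-(2 * s.1⁻¹ ^ 3) * B i s + s.1⁻¹ ^ 2 * fderiv ℝ (B i) s (1, 0, 0)) * m) *
          ∑ k, ζ k * starCross h3 N (Pi.single k 1) ζ i := by
          rw [Finset.mul_sum]
          exact Finset.sum_congr rfl fun k _ => by ring
      _ = 0 := by rw [this, mul_zero]
  -- Because ∂B/∂u is a multiple of the identity, the velocity gradient is contracted back into the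
  -- dual and the vorticity vector reappears.
  have hX2 : ∑ k, ∑ i, s.1⁻¹ ^ 2 * β s * m * (N i k * starCross h3 N (Pi.single k 1) ζ i) =
      s.1⁻¹ ^ 2 * β s * m * ∑ k, ζ k * y k := by
    rw [← sum_sum_mul_starCross h1 hm h3]
    simp only [Finset.mul_sum]
  have hN : ∑ k, ∑ i, s.1⁻¹ * (N i k * fderiv ℝ β s (0, 0, EuclideanSpace.single i 1)) * y k =
      ∑ i, s.1⁻¹ * fderiv ℝ β s (0, 0, EuclideanSpace.single i 1) * ∑ k, N i k * y k := by
    rw [Finset.sum_comm]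
    refine Finset.sum_congr rfl fun i _ => ?_
    rw [Finset.mul_sum]
    exact Finset.sum_congr rfl fun k _ => by ring
  have hsplit : ∑ k, (fderiv ℝ (γ k) s (ζ k, 0, WithLp.toLp 2 fun i => N i k) -
        (-(ζ k * s.1⁻¹ ^ 2) * β s + s.1⁻¹ * (ζ k * fderiv ℝ β s (1, 0, 0) +
          ∑ i, N i k * fderiv ℝ β s (0, 0, EuclideanSpace.single i 1))) * y k +
        ∑ i, (-(2 * ζ k * s.1⁻¹ ^ 3) * B i s + s.1⁻¹ ^ 2 *
          (ζ k * fderiv ℝ (B i) s (1, 0, 0) + β s * N i k)) *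
          (m * starCross h3 N (Pi.single k 1) ζ i)) =
      ∑ k, fderiv ℝ (γ k) s (ζ k, 0, WithLp.toLp 2 fun i => N i k) +
      (s.1⁻¹ ^ 2 * β s - s.1⁻¹ * fderiv ℝ β s (1, 0, 0)) * ∑ k, ζ k * y k -
      ∑ k, ∑ i, s.1⁻¹ * (N i k * fderiv ℝ β s (0, 0, EuclideanSpace.single i 1)) * y k +
      ∑ k, ∑ i, ζ k * ((-(2 * s.1⁻¹ ^ 3) * B i s + s.1⁻¹ ^ 2 *
        fderiv ℝ (B i) s (1, 0, 0)) * (m * starCross h3 N (Pi.single k 1) ζ i)) +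
      ∑ k, ∑ i, s.1⁻¹ ^ 2 * β s * m * (N i k * starCross h3 N (Pi.single k 1) ζ i) := by
    rw [Finset.mul_sum, ← Finset.sum_add_distrib, ← Finset.sum_sub_distrib,
      ← Finset.sum_add_distrib, ← Finset.sum_add_distrib]
    refine Finset.sum_congr rfl fun k _ => ?_
    rw [add_assoc _ (∑ i, _) (∑ i, _), ← Finset.sum_add_distrib, ← Finset.sum_mul,
      ← Finset.mul_sum]
    congr 1
    · ring
    · exact Finset.sum_congr rfl fun i _ => by ring
  rw [hsplit, hX1, hX2, hN] at key
  simp only [add_mul, Finset.sum_add_distrib]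
  linear_combination key

end Odd

end GasDynamics
end

/-! ### Odd dimensions: constancy of the coefficients and the classification -/

noncomputable section

namespace GasDynamics

variable {n : ℕ}

open Function Set

section Odd

variable {m : ℕ} (hm : 1 ≤ m) (h : n = 2 * m + 1)
variable {I J : Set ℝ} {F : ℝ × ℝ → ℝ} (hI : IsOpen I) (hJo : IsOpen J)
  (hJ : ∀ r ∈ J, 0 < r) (hF : ContDiffOn ℝ ∞ F (I ×ˢ J))
variable {T : State n × Space n → ℝ} (hT : ContDiffOn ℝ ∞ T (stateDomain n I J ×ˢ univ))

section Affine

variable {c : State n → ℝ} {B : Fin n → State n → ℝ}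
  (hcs : ContDiffOn ℝ ∞ c (stateDomain n I J))
  (hB : ∀ i, ContDiffOn ℝ ∞ (B i) (stateDomain n I J))
  (hTB : ∀ s ∈ stateDomain n I J, ∀ y : Space n, T (s, y) = c s + ∑ i, B i s * y i)

variable (hc : IsConserved F I J (oddDensity h T))
include hm h hI hJo hJ hF hT hc hcs hB hTB

/-- The right side ℓ is additive while the left side is not, so both coefficients vanish. Testing
additivity on `(ζ, 0) + (0, N)` isolates the term in ζ · ϖ; adding to N a symmetric matrix, which
leaves ϖ unchanged and has no vorticity of its own, isolates the other. -/
theorem coeff_equations {s : State n} (hs : s ∈ stateDomain n I J) (i j : Fin n) :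
    fderiv ℝ (B i) s (0, 1, 0) + s.1⁻¹ *
      fderiv ℝ (fun s => fderiv ℝ (B j) s (0, 0, EuclideanSpace.single j 1)) s
        (0, 0, EuclideanSpace.single i 1) = 0 ∧
    s.1⁻¹ * fderiv ℝ (fun s => fderiv ℝ (B j) s (0, 0, EuclideanSpace.single j 1)) s (1, 0, 0) -
      (1 + m) * s.1⁻¹ ^ 2 * fderiv ℝ (B j) s (0, 0, EuclideanSpace.single j 1) = 0 := by
  have h1 : 1 + 2 * m = n := by omega
  obtain ⟨ℓ, hadd, hℓ⟩ := euler_lagrange_coeff hm h hI hJo hJ hF hT hcs hB hTB hc hs h1 j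
  set V : Fin n → ℝ := fun i => fderiv ℝ (B i) s (0, 1, 0) + s.1⁻¹ *
      fderiv ℝ (fun s => fderiv ℝ (B j) s (0, 0, EuclideanSpace.single j 1)) s
        (0, 0, EuclideanSpace.single i 1) with hV
  set W := s.1⁻¹ * fderiv ℝ (fun s => fderiv ℝ (B j) s (0, 0, EuclideanSpace.single j 1)) s
      (1, 0, 0) - (1 + m) * s.1⁻¹ ^ 2 * fderiv ℝ (B j) s (0, 0, EuclideanSpace.single j 1)
  have hf : (m.factorial : ℝ) ≠ 0 := by positivity
  set o := freePos h1 0 with ho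
  set N := rowForm h1 1
  -- The form built from the identity matrix has vorticity m! times a coordinate vector.
  have hy : ∀ k, starVec h1 N k = m.factorial * (Pi.single o 1 : Fin n → ℝ) k := by
    intro k
    rw [starVec_rowForm, Matrix.adjugate_one, Matrix.one_apply, Pi.single_apply]
  have hsum : ∀ z : Fin n → ℝ, ∑ k, z k * starVec h1 N k = m.factorial * z o := by
    intro z
    rw [Finset.sum_eq_single o]
    · rw [hy]; simp [mul_comm]
    · intro k _ hk
      rw [hy]; simp [hk]
    · simp
  have hz : starVec h1 (0 : Fin n → Fin n → ℝ) = 0 := starVec_zero h1 hm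
  have hW : W = 0 := by
    have e1 := hℓ (Pi.single o 1) N
    have e2 := hℓ 0 N
    have e3 := hℓ (Pi.single o 1) 0
    have e4 := hadd (Pi.single o 1) 0 0 N
    rw [add_zero, zero_add] at e4
    rw [hsum] at e1 e2
    simp only [hz, PiLp.zero_apply, mul_zero, Finset.sum_const_zero, add_zero, Pi.zero_apply,
      Pi.single_eq_same, mul_one] at e1 e2 e3
    have : W * m.factorial = 0 := by linear_combination e1 - e2 - e3 + e4
    exact (mul_eq_zero.1 this).resolve_right hf
  -- The symmetric test matrix is x ⊗ x; choosing x as a coordinate vector, then as a sum of two,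
  -- yields all components of V.
  have hVx : ∀ x : Fin n → ℝ, (∑ i, V i * x i) * x o = 0 := by
    intro x
    set S : Fin n → Fin n → ℝ := fun i k => x i * x k
    have e1 := hℓ 0 (N + S)
    have e2 := hℓ 0 N
    have e3 := hℓ 0 S
    have e4 := hadd 0 0 N S
    have hS : starVec h1 S = 0 := by
      have := starVec_add_symm h1 hm (fun _ _ => 0) x
      rw [starVec_zero h1 hm] at this
      simpa using this
    have hNS : starVec h1 (N + S) = starVec h1 N := starVec_add_symm h1 hm N x
    rw [add_zero] at e4
    rw [hNS] at e1
    simp only [hS, hsum, PiLp.zero_apply, mul_zero, Finset.sum_const_zero, add_zero,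
      Pi.zero_apply] at e1 e2 e3
    have e5 : ∑ i, V i * (m.factorial * (N + S) i o) =
        ∑ i, V i * (m.factorial * N i o) + m.factorial * ((∑ i, V i * x i) * x o) := by
      rw [Finset.sum_mul, Finset.mul_sum, ← Finset.sum_add_distrib]
      refine Finset.sum_congr rfl fun i _ => ?_
      simp only [Pi.add_apply, S]
      ring
    rw [e5] at e1
    have : (m.factorial : ℝ) * ((∑ i, V i * x i) * x o) = 0 := by
      linear_combination e1 - e2 - e3 + e4
    exact (mul_eq_zero.1 this).resolve_left hf
  have hV0 : V o = 0 := by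
    have := hVx (Pi.single o 1)
    simpa [Pi.single_apply] using this
  refine ⟨?_, hW⟩
  change V i = 0
  rcases eq_or_ne i o with rfl | hi
  · exact hV0
  · have := hVx (Pi.single o 1 + Pi.single i 1)
    simpa [Pi.single_apply, mul_add, Finset.sum_add_distrib, hi.symm, hV0] using this

/-- For j ≠ i, ∂β/∂u_i is the u_j-derivative of ∂B_j/∂u_i = 0. So the first coefficient equation
gives B_p = 0, and the entropy-type equation then gives B_ρ = 0. Hence β_ρ = 0, and the second
coefficient equation gives β = 0. -/
theorem fderiv_coeff_eq_zero {s : State n} (hs : s ∈ stateDomain n I J) (i : Fin n) :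
    fderiv ℝ (B i) s = 0 := by
  have hD := isOpen_stateDomain (n := n) hI hJo
  have : Nontrivial (Fin n) := Fin.nontrivial_iff_two_le.2 (by omega)
  set β : Fin n → State n → ℝ :=
    fun j s => fderiv ℝ (B j) s (0, 0, EuclideanSpace.single j 1) with hβ
  have hvel : ∀ s ∈ stateDomain n I J, ∀ (w : Fin n → ℝ) (i j : Fin n),
      fderiv ℝ (B i) s (0, 0, WithLp.toLp 2 w) = β j s * w i := fun s hs w i j =>
    fderiv_coeff_vel hm h hI hJo hJ hF hT hcs hB hTB hc hs w i j
  have heq := fun (s) (hs : s ∈ stateDomain n I J) (i j : Fin n) =>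
    coeff_equations hm h hI hJo hJ hF hT hcs hB hTB hc hs i j
  have hpres : ∀ s ∈ stateDomain n I J, ∀ i, fderiv ℝ (B i) s (0, 1, 0) = 0 := by
    intro s hs i
    -- The function β can be read off from any diagonal entry of the Jacobian; one with an index
    -- different from `i` makes the mixed derivative vanish. This needs at least two dimensions.
    obtain ⟨j, hj⟩ := exists_ne i
    have h1 : fderiv ℝ (β j) s (0, 0, EuclideanSpace.single i 1) = 0 := by
      refine fderiv_fderiv_eq_zero hD (hB j) (v := (0, 0, EuclideanSpace.single j 1))
        (fun s hs => ?_) (fun _ _ => rfl) hs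
      have := hvel s hs (Pi.single i 1) j j
      simpa [hj] using this
    have h2 := (heq s hs i j).1
    rw [h1, mul_zero, add_zero] at h2
    exact h2
  have hdens : ∀ s ∈ stateDomain n I J, ∀ i, fderiv ℝ (B i) s (1, 0, 0) = 0 := by
    intro s hs i
    have h1 := fderiv_coeff_thermo hm h hI hJo hJ hF hT hcs hB hTB hc hs i
    have e : ((s.1, F (s.2.1, s.1), 0) : State n) =
        s.1 • (1, 0, 0) + F (s.2.1, s.1) • (0, 1, 0) := by
      refine Prod.ext ?_ (Prod.ext ?_ ?_) <;> simp
    rw [e, map_add, map_smul, map_smul, hpres s hs, smul_zero, add_zero, smul_eq_mul] at h1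
    exact (mul_eq_zero.1 h1).resolve_left (hJ _ hs.1).ne'
  have hβ0 : β i s = 0 := by
    have h1 : fderiv ℝ (β i) s (1, 0, 0) = 0 :=
      fderiv_fderiv_eq_zero hD (hB i) (v := (0, 0, EuclideanSpace.single i 1))
        (fun s hs => hdens s hs i) (fun _ _ => rfl) hs
    have h2 := (heq s hs i i).2
    rw [h1, mul_zero, zero_sub, neg_eq_zero] at h2
    refine (mul_eq_zero.1 h2).resolve_left (mul_ne_zero (by positivity) ?_)
    exact pow_ne_zero 2 (inv_ne_zero (hJ _ hs.1).ne')
  refine ContinuousLinearMap.ext fun z => ?_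
  obtain ⟨a, b, w⟩ := z
  have e : ((a, b, w) : State n) = a • (1, 0, 0) + b • (0, 1, 0) +
      (0, 0, WithLp.toLp 2 fun k => w k) := by
    refine Prod.ext ?_ (Prod.ext ?_ ?_) <;> simp
  rw [e, map_add, map_add, map_smul, map_smul, hpres s hs, hdens s hs, hvel s hs _ i i, hβ0]
  simp

end Affine

include hm h hI hJo hJ hF hT in
/-- A conserved density of vorticity form is the flux of vorticity through a fixed direction, up
to a kinematic density. -/
theorem exists_inner_of_isConserved (hIc : I.OrdConnected) (hJc : J.OrdConnected)
    (hc : IsConserved F I J (oddDensity h T)) :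
    ∃ b : Space n, ∀ s ∈ stateDomain n I J, ∀ y : Space n, T (s, y) = inner ℝ b y + T (s, 0) := by
  have hD := isOpen_stateDomain (n := n) hI hJo
  have hDc : IsPreconnected (stateDomain n I J) := by
    have h1 := hJc.isPreconnected.prod
      (hIc.isPreconnected.prod (isPreconnected_univ (α := Space n)))
    convert h1 using 1
    ext s
    simp [stateDomain]
  -- The coefficients are the vorticity derivatives of T at ϖ = 0, where `oddDensity_affine` expands
  -- T.
  set B : Fin n → State n → ℝ := fun i s => fderiv ℝ T (s, 0) (0, EuclideanSpace.single i 1)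
    with hBdef
  have hmap : MapsTo (fun s : State n => (s, (0 : Space n))) (stateDomain n I J)
      (stateDomain n I J ×ˢ univ) := fun s hs => ⟨hs, mem_univ _⟩
  have hι : ContDiffOn ℝ ∞ (fun s : State n => (s, (0 : Space n))) (stateDomain n I J) :=
    (contDiff_id.prodMk contDiff_const).contDiffOn
  have hcs : ContDiffOn ℝ ∞ (fun s : State n => T (s, 0)) (stateDomain n I J) := hT.comp hι hmap
  have hB : ∀ i, ContDiffOn ℝ ∞ (B i) (stateDomain n I J) := fun i =>
    ((hT.fderiv_of_isOpen (m := ∞) (hD.prod isOpen_univ) (by simp)).comp hι hmap).clm_apply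
      contDiffOn_const
  have hTB : ∀ s ∈ stateDomain n I J, ∀ y : Space n,
      T (s, y) = T (s, 0) + ∑ i, B i s * y i := by
    intro s hs y
    rw [oddDensity_affine hm h hI hJo hJ hF hT hc hs y]
    have e : ((0, y) : State n × Space n) = ∑ i, y i • (0, EuclideanSpace.single i 1) := by
      refine Prod.ext ?_ ?_
      · simp [Prod.fst_sum]
      · ext k
        simp [Prod.snd_sum, Pi.single_apply]
    rw [e, map_sum]
    simp only [map_smul, smul_eq_mul, hBdef, mul_comm]
  have hconst : ∀ i, ∃ b : ℝ, ∀ s ∈ stateDomain n I J, B i s = b := fun i =>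
    hD.exists_is_const_of_fderiv_eq_zero (𝕜 := ℝ) hDc
      (fun s hs => (((hB i).contDiffAt (hD.mem_nhds hs)).differentiableAt
        (by simp)).differentiableWithinAt)
      fun s hs => fderiv_coeff_eq_zero hm h hI hJo hJ hF hT hcs hB hTB hc hs i
  choose b hb using hconst
  refine ⟨WithLp.toLp 2 b, fun s hs y => ?_⟩
  rw [hTB s hs y, add_comm]
  congr 1
  simp only [PiLp.inner_apply, hb _ s hs]
  simp [mul_comm]

include hI hJo hJ hF hm in
theorem isConserved_oddDensity_iff (hIc : I.OrdConnected) (hJc : J.OrdConnected)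
    (hT : ContDiffOn ℝ ∞ T (stateDomain n I J ×ˢ univ)) :
    IsConserved F I J (oddDensity h T) ↔
      ∃ (b : Space n) (c : State n → ℝ),
        ContDiffOn ℝ ∞ c (stateDomain n I J) ∧ IsConserved F I J (kinematicDensity c) ∧
        ∀ s ∈ stateDomain n I J, ∀ ϖ : Space n, T (s, ϖ) = inner ℝ b ϖ + c s := by
  have hϖ : ∀ v, Admissible I J v → ∀ x, ∃ η', HasDerivAt (fun ε : ℝ =>
      vortVector h (fun z => v z + ε • evolution F v z) x) η' 0 := fun v hv x => by
    have hev := hv.contDiff_evolution hJ hF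
    refine ⟨_, (hasDerivAt_gradVortVector hm h hJ hF hv x).congr_of_eventuallyEq
      (.of_forall fun ε => ?_)⟩
    exact vortVector_eq_gradVortVector h (hv.1.add (hev.const_smul ε)) x
  have hdT : ∀ T : State n × Space n → ℝ, ContDiffOn ℝ ∞ T (stateDomain n I J ×ˢ univ) →
      ∀ v, Admissible I J v → ∀ x, DifferentiableAt ℝ
        (fun ε : ℝ => oddDensity h T (fun z => v z + ε • evolution F v z) x) 0 :=
    fun T hT v hv x => by
      obtain ⟨η', hη⟩ := hϖ v hv x
      exact (hasDerivAt_density_evolution hI hJo hT hv hη).differentiableAt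
  have hbsm : ∀ b : Space n, ContDiffOn ℝ ∞ (fun z : State n × Space n => (inner ℝ b z.2 : ℝ))
      (stateDomain n I J ×ˢ univ) := fun b => (contDiff_const.inner ℝ contDiff_snd).contDiffOn
  constructor
  · intro hc
    obtain ⟨b, hb⟩ := exists_inner_of_isConserved hm h hI hJo hJ hF hT hIc hJc hc
    refine ⟨b, fun s => T (s, 0), ?_, ?_, hb⟩
    · exact hT.comp (f := fun s => (s, 0)) (contDiff_id.prodMk contDiff_const).contDiffOn
        fun s hs => ⟨hs, mem_univ _⟩
    · refine hc.of_eq_add (c := -1) (isConserved_inner_vortVector hm hJ h hF b)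
        (hdT T hT) (hdT _ (hbsm b)) fun v hv x => ?_
      filter_upwards [eventually_mem_stateDomain hI hJo hv x] with ε hε
      have := hb _ hε (vortVector h (fun z => v z + ε • evolution F v z) x)
      rw [kinematicDensity, oddDensity, this]
      ring
  · rintro ⟨b, c, hcs, hcc, hTb⟩
    refine (isConserved_inner_vortVector hm hJ h hF b).of_eq_add (c := 1) hcc
      (hdT _ (hbsm b)) (hdT (fun z => c z.1) (hcs.comp contDiff_fst.contDiffOn fun z hz => hz.1))
      fun v hv x => ?_
    filter_upwards [eventually_mem_stateDomain hI hJo hv x] with ε hε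
    have := hTb _ hε (vortVector h (fun z => v z + ε • evolution F v z) x)
    rw [kinematicDensity, oddDensity, this]
    ring

end Odd

end GasDynamics
end

theorem theorem4 (n m : ℕ) (hm : 1 ≤ m) (I J : Set ℝ)
    (hI : IsOpen I) (hI' : I.OrdConnected) (hI₀ : I.Nonempty)
    (hJ : IsOpen J) (hJ' : J.OrdConnected) (hJ₀ : J.Nonempty) (hJpos : ∀ r ∈ J, 0 < r)
    (F : ℝ × ℝ → ℝ) (hF : ContDiffOn ℝ ∞ F (I ×ˢ J)) :
    (∀ hn : n = 2 * m,
      -- all conserved densities of vorticity form, up to kinematic ones, are `S ϖ`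
      (∀ T : GasDynamics.State n × ℝ → ℝ,
        ContDiffOn ℝ ∞ T (GasDynamics.stateDomain n I J ×ˢ Set.univ) →
        (GasDynamics.IsConserved F I J (GasDynamics.evenDensity hn T) ↔
          ∃ (S : ℝ × ℝ → ℝ) (c : GasDynamics.State n → ℝ),
            GasDynamics.IsEntropy F I J S ∧
            ContDiffOn ℝ ∞ c (GasDynamics.stateDomain n I J) ∧
            GasDynamics.IsConserved F I J (GasDynamics.kinematicDensity c) ∧
            ∀ s ∈ GasDynamics.stateDomain n I J, ∀ ϖ : ℝ,
              T (s, ϖ) = S (s.2.1, s.1) * ϖ + c s)) ∧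
      (∀ S : ℝ × ℝ → ℝ, GasDynamics.IsEntropy F I J S →
        -- `S ϖ` is trivial exactly if `S` is constant
        (GasDynamics.IsTrivial I J (GasDynamics.entropyVorticity hn S) ↔
          ∃ k : ℝ, ∀ z ∈ I ×ˢ J, S z = k) ∧
        -- `S ϖ` is equivalent to minus the circulatory entropy density
        GasDynamics.IsTrivial I J (fun v x =>
          GasDynamics.entropyVorticity hn S v x +
            GasDynamics.circulatoryEntropy hm hn S v x) ∧
        -- `∇S = S_p (∇p - ρ⁻¹ F ∇ρ)`
        (∀ v : GasDynamics.Field n, GasDynamics.Admissible I J v → ∀ x i,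
          GasDynamics.pd i (fun y => S (GasDynamics.thermo v y)) x =
            GasDynamics.derivP S (GasDynamics.thermo v x) *
              (GasDynamics.pd i (GasDynamics.pres v) x -
                (GasDynamics.dens v x)⁻¹ * F (GasDynamics.thermo v x) *
                  GasDynamics.pd i (GasDynamics.dens v) x)) ∧
        (∀ e : ℝ × ℝ → ℝ, GasDynamics.IsEnergy F I J e →
          -- `e_S = e_p / S_p`
          (∀ v : GasDynamics.Field n, GasDynamics.Admissible I J v → ∀ x i,
            GasDynamics.derivP S (GasDynamics.thermo v x) ≠ 0 →
            GasDynamics.energyEntropyGrad F e v x i =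
              GasDynamics.derivP e (GasDynamics.thermo v x) /
                GasDynamics.derivP S (GasDynamics.thermo v x) *
                GasDynamics.pd i (fun y => S (GasDynamics.thermo v y)) x) ∧
          -- the two forms of the local conservation law
          GasDynamics.ContinuityEquation F I J (GasDynamics.entropyVorticity hn S)
            (GasDynamics.entropyVorticityFlux hm hn F S e) ∧
          GasDynamics.ContinuityEquation F I J (GasDynamics.circulatoryEntropy hm hn S)
            (GasDynamics.circulatoryEntropyFlux hm hn S e)))) ∧
    (∀ hn : n = 2 * m + 1,
      -- all conserved densities of vorticity form, up to kinematic ones, are `b · ϖ`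
      (∀ T : GasDynamics.State n × GasDynamics.Space n → ℝ,
        ContDiffOn ℝ ∞ T (GasDynamics.stateDomain n I J ×ˢ Set.univ) →
        (GasDynamics.IsConserved F I J (GasDynamics.oddDensity hn T) ↔
          ∃ (b : GasDynamics.Space n) (c : GasDynamics.State n → ℝ),
            ContDiffOn ℝ ∞ c (GasDynamics.stateDomain n I J) ∧
            GasDynamics.IsConserved F I J (GasDynamics.kinematicDensity c) ∧
            ∀ s ∈ GasDynamics.stateDomain n I J, ∀ ϖ : GasDynamics.Space n,
              T (s, ϖ) = inner ℝ b ϖ + c s)) ∧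
      -- `b · ϖ` is trivial
      (∀ b : GasDynamics.Space n,
        GasDynamics.IsTrivial I J (fun v x =>
          inner ℝ b (GasDynamics.vortVector hn v x)))) := by
  refine ⟨fun hn => ⟨fun T hT => ?_, fun S hS => ⟨⟨fun ht => ?_, ?_⟩, ?_, ?_, ?_⟩⟩,
    fun hn => ⟨fun T hT => ?_, fun b => ?_⟩⟩
  · exact GasDynamics.isConserved_evenDensity_iff hm hn hI hJ hJpos hF hJ' hJ₀ hT
  · exact GasDynamics.eq_const_of_isTrivial hm hn hI hJ hI' hJ' hS.1 ht
  · rintro ⟨k, hk⟩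
    exact GasDynamics.isTrivial_of_eq_const hm hn hS.1 hk
  · exact GasDynamics.isTrivial_entropyVorticity_add hm hn hS.1
  · exact fun v hv x i => GasDynamics.pd_entropy hI hJ hJpos hS hv x i
  · refine fun e he => ⟨fun v hv x i hSp => ?_,
      GasDynamics.continuityEquation_entropyVorticity hm hn hI hJ hJpos hF hS he,
      GasDynamics.continuityEquation_circulatoryEntropy hm hn hI hJ hJpos hF hS he⟩
    rw [GasDynamics.pd_entropy hI hJ hJpos hS hv x i, GasDynamics.energyEntropyGrad, ← mul_assoc,
      div_mul_cancel₀ _ hSp]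
  · exact GasDynamics.isConserved_oddDensity_iff hm hn hI hJ hJpos hF hI' hJ' hT
  · exact GasDynamics.isTrivial_inner_vortVector hm hn b
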